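/- Let $\mathbb S^1=\mathbb R/\mathbb Z$, $e_k(x)=e^{2\pi i kx}$, $\hat u(k)=\int_{\mathbb S^1}u\,e_{-k}\,dx$, $D=d/dx$. For $s>1/2$ let $H^s=H^s(\mathbb S^1,\mathbb C)$ be the completion of $C^\infty(\mathbb S^1,\mathbb C)$ for the norm $\|u\|_{H^s}=\big(\sum_{k\in\mathbb Z}(1+k^2)^s|\hat u(k)|^2\big)^{1/2}$, regarded as a space of continuous functions, and let $H^s(\mathbb S^1,\mathbb R)$ be its real subspace of real-valued functions. For $q>3/2$ let $\mathcal D^q$ be the group of orientation-preserving diffeomorphisms of $\mathbb S^1$ of class $H^q$, that is, the maps $\varphi(x)=x+f(x)$ mod $1$ with $f\in H^q(\mathbb S^1,\mathbb R)$ and $1+f'>0$; it is a smooth Hilbert manifold modelled on $H^q(\mathbb S^1,\mathbb R)$, with charts the local inverses of $f\mapsto(x\mapsto x+f(x))$. Write $R_\varphi v=v\circ\varphi$. Let $P$ be a Fourier multiplier on $C^\infty(\mathbb S^1,\mathbb C)$, $Pu=\sum_k p(k)\hat u(k)e_k$, of order $r\ge 1$, i.e. $|p(k)|\le C(1+k^2)^{r/2}$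 for all $k\in\mathbb Z$ and some constant $C$, and let $q>\tfrac32+r$. Define $(n+1)$-linear operators $P_n$ on $C^\infty(\mathbb S^1,\mathbb C)$ by $P_0=P$ and $$P_{n+1}(u_0,\dots,u_{n+1})=[u_{n+1}D,\,P_n(\,\cdot\,,u_1,\dots,u_n)]\,u_0-\sum_{k=1}^nP_n(u_0,\dots,u_{n+1}Du_k,\dots,u_n).$$ Suppose that for every $n\in\mathbb N$ the operator $P_n$ extends to a bounded $(n+1)$-linear operator from $(H^q)^{n+1}$ to $H^{q-r}$, again denoted by $P_n$. Then for every $\varphi\in\mathcal D^q$ the operator $P_\varphi:=R_\varphi PR_{\varphi^{-1}}$ is a well-defined bounded operator from $H^q$ to $H^{q-r}$, and the map $$\varphi\mapsto P_\varphi,\qquad \mathcal D^q\to\mathcal L(H^q,H^{q-r})$$ is smooth ($C^\infty$, for the operator norm). For $n\ge1$ its $n$-th Fréchet derivative at $\varphi$ (in any of the above charts) is $P_{n,\varphi}:=R_\varphi P_nR_{\varphi^{-1}}$, that is, $$D^nP_\varphi(\delta\varphi_1,\dots,\delta\varphi_n)v=P_n\big(v\circ\varphi^{-1},\delta\varphi_1\circ\varphi^{-1},\dots,\delta\varphi_n\circ\varphi^{-1}\big)\circ\varphi$$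 for all $v\in H^q$ and $\delta\varphi_1,\dots,\delta\varphi_n\in H^q(\mathbb S^1,\mathbb R)$. -/

import Mathlib

open scoped ContDiff Manifold

noncomputable section

/-! ### Sobolev spaces of functions on the circle `ℝ/ℤ` -/

/-- The Sobolev condition of order `s` for a continuous complex function on the circle:
`∑ₖ (1 + k²)ˢ |û(k)|² < ∞`, where `û(k) = ∫ u(x) exp(-2πikx) dx`. -/
def MemSobolev (s : ℝ) (u : UnitAddCircle → ℂ) : Prop :=
  Summable fun k : ℤ => (1 + (k : ℝ) ^ 2) ^ s * ‖fourierCoeff u k‖ ^ 2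

theorem sobolev_weight (s : ℝ) (k : ℤ) (z : ℂ) :
    ‖(((1 + (k : ℝ) ^ 2) ^ (s / 2) : ℝ) : ℂ) * z‖ ^ 2 = (1 + (k : ℝ) ^ 2) ^ s * ‖z‖ ^ 2 := by
  have h : (0 : ℝ) < 1 + (k : ℝ) ^ 2 := by positivity
  rw [norm_mul, mul_pow, Complex.norm_real, Real.norm_of_nonneg (by positivity),
    ← Real.rpow_natCast, ← Real.rpow_mul h.le]
  norm_num

theorem memSobolev_iff (s : ℝ) (u : UnitAddCircle → ℂ) : MemSobolev s u ↔
    Memℓp (fun k : ℤ => (((1 + (k : ℝ) ^ 2) ^ (s / 2) : ℝ) : ℂ) * fourierCoeff u k) 2 := by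
  rw [memℓp_gen_iff (by norm_num)]
  simp only [MemSobolev, ← sobolev_weight, ENNReal.toReal_ofNat, Real.rpow_two]

theorem integrable_circle (f : C(UnitAddCircle, ℂ)) :
    MeasureTheory.Integrable f AddCircle.haarAddCircle :=
  f.continuous.integrable_of_hasCompactSupport (HasCompactSupport.of_compactSpace _)

theorem fourierCoeff_add_circle (f g : C(UnitAddCircle, ℂ)) (k : ℤ) :
    fourierCoeff (f + g : C(UnitAddCircle, ℂ)) k = fourierCoeff f k + fourierCoeff g k := by
  rw [ContinuousMap.coe_add]
  exact congrFun (fourierCoeff.add (integrable_circle f) (integrable_circle g)) k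

theorem fourierCoeff_smul_circle (c : ℂ) (f : C(UnitAddCircle, ℂ)) (k : ℤ) :
    fourierCoeff (c • f : C(UnitAddCircle, ℂ)) k = c * fourierCoeff f k := by
  rw [ContinuousMap.coe_smul, fourierCoeff.const_smul, smul_eq_mul]

/-- The continuous functions on the circle of Sobolev class `s`, as a complex vector space. -/
def sobolevSubmodule (s : ℝ) : Submodule ℂ C(UnitAddCircle, ℂ) where
  carrier := {f | MemSobolev s f}
  zero_mem' := by
    have h (k : ℤ) : fourierCoeff (0 : C(UnitAddCircle, ℂ)) k = 0 := by
      simpa using fourierCoeff_smul_circle 0 0 k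
    change Summable fun k : ℤ => _ * ‖fourierCoeff (0 : C(UnitAddCircle, ℂ)) k‖ ^ 2
    simp only [h]
    simp
  add_mem' := by
    intro f g hf hg
    simp only [Set.mem_ofPred_eq, memSobolev_iff] at *
    convert hf.add hg using 1
    ext k
    simp only [fourierCoeff_add_circle, Pi.add_apply, mul_add]
  smul_mem' := by
    intro c f hf
    simp only [Set.mem_ofPred_eq, memSobolev_iff] at *
    convert hf.const_smul c using 1
    ext k
    simp only [fourierCoeff_smul_circle, Pi.smul_apply, smul_eq_mul]
    ring

/-- The Sobolev space `Hˢ(𝕊¹, ℂ)` for `s > 1/2`, the completion of `C^∞(𝕊¹, ℂ)` for the norm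
`(∑ₖ (1 + k²)ˢ |û(k)|²)^{1/2}`; since `s > 1/2`, its elements are continuous functions.
(The name is a type of its own, so that the sup norm is not inherited.) -/
def SobolevC (s : ℝ) : Type := sobolevSubmodule s

namespace SobolevC

variable {s : ℝ}

instance : AddCommGroup (SobolevC s) := inferInstanceAs (AddCommGroup (sobolevSubmodule s))
instance : Module ℂ (SobolevC s) := inferInstanceAs (Module ℂ (sobolevSubmodule s))

/-- The underlying continuous function. -/
def toFun : SobolevC s →ₗ[ℂ] C(UnitAddCircle, ℂ) := (sobolevSubmodule s).subtype

instance : CoeFun (SobolevC s) (fun _ => UnitAddCircle → ℂ) := ⟨fun f => f.toFun⟩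

theorem toFun_injective : Function.Injective (toFun (s := s)) := Subtype.val_injective

@[ext] theorem ext {f g : SobolevC s} (h : ∀ x, f x = g x) : f = g :=
  toFun_injective (ContinuousMap.ext h)

theorem memSobolev (f : SobolevC s) : MemSobolev s f := f.2

/-- The weighted sequence of Fourier coefficients. -/
def weightedCoeff : SobolevC s →ₗ[ℂ] lp (fun _ : ℤ => ℂ) 2 where
  toFun f := ⟨fun k => (((1 + (k : ℝ) ^ 2) ^ (s / 2) : ℝ) : ℂ) * fourierCoeff f k,
    (memSobolev_iff s f).1 f.memSobolev⟩
  map_add' f g := by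
    ext k
    change _ * fourierCoeff (f.toFun + g.toFun : C(UnitAddCircle, ℂ)) k = _ * _ + _ * _
    rw [fourierCoeff_add_circle, mul_add]
  map_smul' c f := by
    ext k
    change _ * fourierCoeff (c • f.toFun : C(UnitAddCircle, ℂ)) k = c * (_ * _)
    rw [fourierCoeff_smul_circle, mul_left_comm]

theorem weightedCoeff_injective : Function.Injective (weightedCoeff (s := s)) := by
  refine (injective_iff_map_eq_zero _).2 fun f hf => ?_
  have h : fourierCoeff f = 0 := by
    ext k
    have h1 : (((1 + (k : ℝ) ^ 2) ^ (s / 2) : ℝ) : ℂ) * fourierCoeff f k = 0 :=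
      congrFun (congrArg Subtype.val hf) k
    have h2 : (1 + (k : ℝ) ^ 2) ^ (s / 2) ≠ 0 := by positivity
    simpa [h2] using h1
  ext x
  have := has_pointwise_sum_fourier_series_of_summable (f := f.toFun) (by rw [h]; exact summable_zero) x
  rw [h] at this
  simpa using this.unique (by simp)

instance : NormedAddCommGroup (SobolevC s) :=
  NormedAddCommGroup.induced _ _ weightedCoeff weightedCoeff_injective

instance : NormedSpace ℂ (SobolevC s) := NormedSpace.induced ℂ _ _ weightedCoeff

theorem norm_sq (f : SobolevC s) :
    ‖f‖ ^ 2 = ∑' k : ℤ, (1 + (k : ℝ) ^ 2) ^ s * ‖fourierCoeff f k‖ ^ 2 := by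
  have h := lp.norm_rpow_eq_tsum (p := 2) (by norm_num) (weightedCoeff f)
  simp only [ENNReal.toReal_ofNat, Real.rpow_two] at h
  have h' : ‖f‖ = ‖weightedCoeff f‖ := rfl
  rw [h', h]
  exact tsum_congr fun k => sobolev_weight s k _

end SobolevC

/-- The real Sobolev space `Hˢ(𝕊¹, ℝ)` as a real subspace of the continuous functions. -/
def sobolevSubmoduleR (s : ℝ) : Submodule ℝ C(UnitAddCircle, ℝ) :=
  ((sobolevSubmodule s).restrictScalars ℝ).comap
    (Complex.ofRealCLM.compLeftContinuous ℝ UnitAddCircle).toLinearMap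

/-- The real Sobolev space `Hˢ(𝕊¹, ℝ)`, `s > 1/2`: the real-valued functions in
`Hˢ(𝕊¹, ℂ)`, with the same norm. -/
def SobolevR (s : ℝ) : Type := sobolevSubmoduleR s

namespace SobolevR

variable {s : ℝ}

instance : AddCommGroup (SobolevR s) := inferInstanceAs (AddCommGroup (sobolevSubmoduleR s))
instance : Module ℝ (SobolevR s) := inferInstanceAs (Module ℝ (sobolevSubmoduleR s))

/-- The underlying continuous function. -/
def toFun : SobolevR s →ₗ[ℝ] C(UnitAddCircle, ℝ) := (sobolevSubmoduleR s).subtype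

instance : CoeFun (SobolevR s) (fun _ => UnitAddCircle → ℝ) := ⟨fun f => f.toFun⟩

theorem toFun_injective : Function.Injective (toFun (s := s)) := Subtype.val_injective

@[ext] theorem ext {f g : SobolevR s} (h : ∀ x, f x = g x) : f = g :=
  toFun_injective (ContinuousMap.ext h)

/-- A real-valued function, regarded as a complex-valued one. -/
def toComplex : SobolevR s →ₗ[ℝ] SobolevC s where
  toFun f := ⟨Complex.ofRealCLM.compLeftContinuous ℝ UnitAddCircle f.1, f.2⟩
  map_add' f g := Subtype.ext (map_add _ f.1 g.1)
  map_smul' c f := Subtype.ext (map_smul _ c f.1)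

@[simp] theorem toComplex_apply (f : SobolevR s) (x : UnitAddCircle) :
    f.toComplex x = (f x : ℂ) := rfl

theorem toComplex_injective : Function.Injective (toComplex (s := s)) := by
  intro f g h
  ext x
  have : f.toComplex x = g.toComplex x := by rw [h]
  simpa using this

instance : NormedAddCommGroup (SobolevR s) :=
  NormedAddCommGroup.induced _ _ toComplex toComplex_injective

instance : NormedSpace ℝ (SobolevR s) := NormedSpace.induced ℝ _ _ toComplex

theorem norm_toComplex (f : SobolevR s) : ‖f.toComplex‖ = ‖f‖ := rfl

end SobolevR

/-! ### Smooth functions and Fourier multipliers -/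

/-- The algebra `C^∞(𝕊¹, ℂ)` of smooth complex functions on the circle. -/
def SmoothC : Subalgebra ℂ (UnitAddCircle → ℂ) where
  carrier := {f | ContDiff ℝ ∞ fun t : ℝ => f t}
  add_mem' {f g} (hf : ContDiff ℝ ∞ fun t : ℝ => f t) (hg : ContDiff ℝ ∞ fun t : ℝ => g t) :=
    show ContDiff ℝ ∞ fun t : ℝ => f t + g t from hf.add hg
  mul_mem' {f g} (hf : ContDiff ℝ ∞ fun t : ℝ => f t) (hg : ContDiff ℝ ∞ fun t : ℝ => g t) :=
    show ContDiff ℝ ∞ fun t : ℝ => f t * g t from hf.mul hg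
  algebraMap_mem' c := show ContDiff ℝ ∞ fun _ : ℝ => c from contDiff_const

namespace SmoothC

theorem contDiff (f : SmoothC) : ContDiff ℝ ∞ fun t : ℝ => f.1 t := f.2

theorem periodic (f : UnitAddCircle → ℂ) : Function.Periodic (fun t : ℝ => f t) 1 := by
  intro t
  simp

theorem periodic_deriv (f : UnitAddCircle → ℂ) :
    Function.Periodic (deriv fun t : ℝ => f t) 1 := by
  intro t
  rw [← deriv_comp_add_const]
  congr 1
  exact funext (periodic f)

/-- The derivative `D = d/dx` on smooth functions on the circle. -/
def D (f : SmoothC) : SmoothC :=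
  ⟨(periodic_deriv f.1).lift, by
    change ContDiff ℝ ∞ fun t : ℝ => (periodic_deriv f.1).lift t
    simp only [Function.Periodic.lift_coe]
    exact (contDiff_infty_iff_deriv.1 (contDiff f)).2⟩

theorem D_apply (f : SmoothC) (t : ℝ) : (D f).1 t = deriv (fun t : ℝ => f.1 t) t := rfl

theorem continuous (f : SmoothC) : Continuous f.1 := by
  have : Continuous fun t : ℝ => f.1 t := (contDiff f).continuous
  exact (QuotientAddGroup.isQuotientMap_mk _).continuous_iff.2 this

theorem fourierCoeff_D (f : SmoothC) (k : ℤ) :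
    fourierCoeff (D f).1 k = 2 * Real.pi * Complex.I * k * fourierCoeff f.1 k := by
  rcases eq_or_ne k 0 with rfl | hk
  · have h : ∫ t in (0 : ℝ)..1, deriv (fun t : ℝ => f.1 t) t = f.1 (1 : ℝ) - f.1 (0 : ℝ) := by
      apply intervalIntegral.integral_deriv_eq_sub
      · intro t _
        exact ((contDiff f).differentiable (by simp)).differentiableAt
      · exact ((contDiff_infty_iff_deriv.1 (contDiff f)).2.continuous).intervalIntegrable _ _
    have h2 : f.1 (1 : ℝ) = f.1 (0 : ℝ) := by simp [AddCircle.coe_period]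
    rw [fourierCoeff_eq_intervalIntegral _ _ 0]
    simp only [D_apply, zero_add]
    simp [h, h2]
  · have h := fourierCoeffOn_of_hasDerivAt (zero_lt_one' ℝ) (f := fun t : ℝ => f.1 t)
      (f' := fun t : ℝ => (D f).1 t) hk
      (fun t _ => ((contDiff f).differentiable (by simp)).differentiableAt.hasDerivAt)
      ((contDiff (D f)).continuous.intervalIntegrable _ _)
    have e (g : UnitAddCircle → ℂ) :
        fourierCoeffOn (zero_lt_one' ℝ) (fun t : ℝ => g t) k = fourierCoeff g k := by
      rw [fourierCoeffOn_eq_integral, fourierCoeff_eq_intervalIntegral _ _ 0]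
      simp
    rw [e, e] at h
    have h2 : f.1 (1 : ℝ) = f.1 (0 : ℝ) := by simp [AddCircle.coe_period]
    rw [h, h2]
    have : (k : ℂ) ≠ 0 := by exact_mod_cast hk
    have := Complex.two_pi_I_ne_zero
    have := Complex.I_ne_zero
    field_simp
    simp

theorem norm_fourierCoeff_le (f : SmoothC) : ∃ B, ∀ k, ‖fourierCoeff f.1 k‖ ≤ B := by
  let g : C(UnitAddCircle, ℂ) := ⟨f.1, continuous f⟩
  refine ⟨‖g‖, fun k => ?_⟩
  have : ∀ x, ‖fourier (-k) x • f.1 x‖ ≤ ‖g‖ := fun x => by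
    rw [norm_smul, fourier_apply, Circle.norm_coe, one_mul]
    exact g.norm_coe_le_norm x
  have h := MeasureTheory.norm_integral_le_of_norm_le_const
    (μ := AddCircle.haarAddCircle) (Filter.Eventually.of_forall this)
  rwa [MeasureTheory.probReal_univ, mul_one] at h

theorem rapid_decay (m : ℕ) (f : SmoothC) :
    ∃ B, ∀ k : ℤ, (1 + (k : ℝ) ^ 2) ^ m * ‖fourierCoeff f.1 k‖ ≤ B := by
  induction m generalizing f with
  | zero => simpa using norm_fourierCoeff_le f
  | succ m ih =>
    obtain ⟨B, hB⟩ := ih f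
    obtain ⟨B', hB'⟩ := ih (D (D f))
    refine ⟨B + B', fun k => ?_⟩
    have h : ‖fourierCoeff (D (D f)).1 k‖
        = (2 * Real.pi) ^ 2 * ((k : ℝ) ^ 2 * ‖fourierCoeff f.1 k‖) := by
      rw [fourierCoeff_D, fourierCoeff_D]
      simp only [norm_mul, Complex.norm_I, Complex.norm_real, Complex.norm_intCast,
        Real.norm_of_nonneg Real.pi_pos.le, Complex.norm_ofNat]
      rw [← sq_abs (k : ℝ)]
      ring
    have h2 : (k : ℝ) ^ 2 * ‖fourierCoeff f.1 k‖ ≤ ‖fourierCoeff (D (D f)).1 k‖ := by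
      rw [h]
      refine le_mul_of_one_le_left (by positivity) ?_
      nlinarith [Real.pi_gt_three]
    have h3 : (0 : ℝ) ≤ (1 + (k : ℝ) ^ 2) ^ m := by positivity
    have := mul_le_mul_of_nonneg_left h2 h3
    calc (1 + (k : ℝ) ^ 2) ^ (m + 1) * ‖fourierCoeff f.1 k‖
        = (1 + (k : ℝ) ^ 2) ^ m * ‖fourierCoeff f.1 k‖
          + (1 + (k : ℝ) ^ 2) ^ m * ((k : ℝ) ^ 2 * ‖fourierCoeff f.1 k‖) := by ring
      _ ≤ B + B' := add_le_add (hB k) (this.trans (hB' k))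

end SmoothC

theorem summable_sobolev_weight {a : ℝ} (ha : a < -(1 / 2)) :
    Summable fun k : ℤ => (1 + (k : ℝ) ^ 2) ^ a := by
  have h := (Real.summable_abs_int_rpow (b := -(2 * a)) (by linarith))
  refine Summable.of_norm_bounded_eventually (g := fun k : ℤ => |(k : ℝ)| ^ (- -(2 * a))) h ?_
  have : ∀ᶠ k : ℤ in Filter.cofinite, k ≠ 0 := by
    simpa using (Set.finite_singleton (0 : ℤ)).eventually_cofinite_notMem
  filter_upwards [this] with k hk
  have hk' : 0 < |(k : ℝ)| := by simpa using hk
  rw [Real.norm_of_nonneg (by positivity), neg_neg, Real.rpow_mul hk'.le, Real.rpow_two, sq_abs]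
  apply Real.rpow_le_rpow_of_nonpos
  · have := sq_abs (k : ℝ); positivity
  · linarith
  · linarith

theorem SmoothC.memSobolev (s : ℝ) (f : SmoothC) : MemSobolev s f.1 := by
  obtain ⟨m, hm⟩ := exists_nat_ge s
  obtain ⟨B, hB⟩ := rapid_decay m f
  obtain ⟨B', hB'⟩ := rapid_decay 1 f
  refine Summable.of_nonneg_of_le (fun k => by positivity) (fun k => ?_)
    ((summable_sobolev_weight (a := -1) (by norm_num)).mul_left (B * B'))
  have h1 : (1 : ℝ) ≤ 1 + (k : ℝ) ^ 2 := by nlinarith [sq_nonneg (k : ℝ)]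
  have h2 : (1 + (k : ℝ) ^ 2) ^ s ≤ (1 + (k : ℝ) ^ 2) ^ m := by
    rw [← Real.rpow_natCast _ m]
    exact Real.rpow_le_rpow_of_exponent_le h1 hm
  have h3 := mul_le_mul (hB k) (hB' k) (by positivity)
    (le_trans (by positivity) (hB k))
  rw [Real.rpow_neg_one, ← div_eq_mul_inv, le_div_iff₀ (by positivity)]
  calc _ ≤ (1 + (k : ℝ) ^ 2) ^ m * ‖fourierCoeff f.1 k‖ ^ 2 * (1 + (k : ℝ) ^ 2) := by gcongr
    _ ≤ B * B' := by linarith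

/-- The inclusion `C^∞(𝕊¹, ℂ) ⊆ Hˢ(𝕊¹, ℂ)`. -/
def SmoothC.toSobolev (s : ℝ) (f : SmoothC) : SobolevC s :=
  ⟨⟨f.1, SmoothC.continuous f⟩, SmoothC.memSobolev s f⟩

/-- `P` is the Fourier multiplier with symbol `p`: `P u = ∑ₖ p(k) û(k) eₖ` for smooth `u`. -/
def IsFourierMultiplier (P : SmoothC →ₗ[ℂ] SmoothC) (p : ℤ → ℂ) : Prop :=
  ∀ (u : SmoothC) (k : ℤ), fourierCoeff (P u).1 k = p k * fourierCoeff u.1 k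

/-- The symbol `p` is of order `r`: `|p(k)| ≤ C (1 + k²)^{r/2}`. -/
def HasOrder (p : ℤ → ℂ) (r : ℝ) : Prop :=
  ∃ C : ℝ, ∀ k : ℤ, ‖p k‖ ≤ C * (1 + (k : ℝ) ^ 2) ^ (r / 2)

/-- The `(n+1)`-linear operators defined by `P₀ = P` and
`Pₙ₊₁(u₀, …, uₙ₊₁) = [uₙ₊₁ D, Pₙ(·, u₁, …, uₙ)] u₀ - ∑_{k=1}^n Pₙ(u₀, …, uₙ₊₁ D uₖ, …, uₙ)`.
The second half of the commutator is the term `k = 0` of the sum below. -/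
def multiOp (P : SmoothC →ₗ[ℂ] SmoothC) : (n : ℕ) → (Fin (n + 1) → SmoothC) → SmoothC
  | 0, u => P (u 0)
  | n + 1, u =>
    u (Fin.last (n + 1)) * SmoothC.D (multiOp P n (Fin.init u))
      - ∑ k : Fin (n + 1), multiOp P n
          (Function.update (Fin.init u) k (u (Fin.last (n + 1)) * SmoothC.D (u k.castSucc)))

/-! ### Sobolev functions of order `s > 3/2` are continuously differentiable -/

theorem SobolevC.exists_bound {s : ℝ} (hs : 3 / 2 < s) : ∃ K : ℝ, 0 ≤ K ∧ ∀ f : SobolevC s,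
    Summable (fun k : ℤ => (1 + (k : ℝ) ^ 2) ^ (1 / 2 : ℝ) * ‖fourierCoeff f k‖) ∧
    ∑' k : ℤ, (1 + (k : ℝ) ^ 2) ^ (1 / 2 : ℝ) * ‖fourierCoeff f k‖ ≤ K * ‖f‖ := by
  have hw := summable_sobolev_weight (a := 1 - s) (by linarith)
  refine ⟨(∑' k : ℤ, (1 + (k : ℝ) ^ 2) ^ (1 - s)) ^ (1 / 2 : ℝ), by positivity, fun f => ?_⟩
  have ea (k : ℤ) : ((1 + (k : ℝ) ^ 2) ^ ((1 - s) / 2)) ^ (2 : ℝ) = (1 + (k : ℝ) ^ 2) ^ (1 - s) := by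
    rw [← Real.rpow_mul (by positivity)]
    congr 1
    ring
  have eb (k : ℤ) : ((1 + (k : ℝ) ^ 2) ^ (s / 2) * ‖fourierCoeff f k‖) ^ (2 : ℝ)
      = (1 + (k : ℝ) ^ 2) ^ s * ‖fourierCoeff f k‖ ^ 2 := by
    rw [Real.mul_rpow (by positivity) (by positivity), ← Real.rpow_mul (by positivity),
      Real.rpow_two]
    congr 2
    ring
  have ec (k : ℤ) : (1 + (k : ℝ) ^ 2) ^ ((1 - s) / 2)
      * ((1 + (k : ℝ) ^ 2) ^ (s / 2) * ‖fourierCoeff f k‖)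
      = (1 + (k : ℝ) ^ 2) ^ (1 / 2 : ℝ) * ‖fourierCoeff f k‖ := by
    rw [← mul_assoc, ← Real.rpow_add (by positivity)]
    congr 2
    ring
  have h := Real.summable_and_inner_le_Lp_mul_Lq_tsum_of_nonneg Real.HolderConjugate.two_two
    (f := fun k : ℤ => (1 + (k : ℝ) ^ 2) ^ ((1 - s) / 2))
    (g := fun k : ℤ => (1 + (k : ℝ) ^ 2) ^ (s / 2) * ‖fourierCoeff f k‖)
    (fun k => by positivity) (fun k => by positivity)
    (by simpa only [ea] using hw) (by simp only [eb]; exact f.memSobolev)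
  simp only [ea, eb, ec, ← SobolevC.norm_sq] at h
  refine ⟨h.1, h.2.trans_eq ?_⟩
  congr 1
  rw [← Real.sqrt_eq_rpow, Real.sqrt_sq (norm_nonneg _)]

theorem SobolevC.exists_C1 {s : ℝ} (hs : 3 / 2 < s) : ∃ K : ℝ, 0 ≤ K ∧ ∀ f : SobolevC s,
    (∀ x, ‖f x‖ ≤ K * ‖f‖) ∧ ∃ f' : ℝ → ℂ, Continuous f' ∧
      (∀ t, HasDerivAt (fun t : ℝ => f t) (f' t) t) ∧ ∀ t, ‖f' t‖ ≤ K * ‖f‖ := by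
  obtain ⟨K, hK, h⟩ := exists_bound hs
  refine ⟨2 * Real.pi * K, by positivity, fun f => ?_⟩
  obtain ⟨h1, h2⟩ := h f
  have hpi : (1 : ℝ) ≤ 2 * Real.pi := by linarith [Real.pi_gt_three]
  have one_le (k : ℤ) : (1 : ℝ) ≤ (1 + (k : ℝ) ^ 2) ^ (1 / 2 : ℝ) :=
    Real.one_le_rpow (by nlinarith [sq_nonneg (k : ℝ)]) (by norm_num)
  have abs_le (k : ℤ) : |(k : ℝ)| ≤ (1 + (k : ℝ) ^ 2) ^ (1 / 2 : ℝ) := by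
    rw [← Real.sqrt_eq_rpow]
    exact Real.abs_le_sqrt (by linarith)
  have b0 (k : ℤ) : ‖fourierCoeff f k‖ ≤ (1 + (k : ℝ) ^ 2) ^ (1 / 2 : ℝ) * ‖fourierCoeff f k‖ :=
    le_mul_of_one_le_left (norm_nonneg _) (one_le k)
  have s0 : Summable fun k : ℤ => ‖fourierCoeff f k‖ :=
    Summable.of_nonneg_of_le (fun _ => norm_nonneg _) b0 h1
  have hsum (x : UnitAddCircle) : HasSum (fun k : ℤ => fourierCoeff f k • fourier k x) (f x) :=
    has_pointwise_sum_fourier_series_of_summable (f := f.toFun) s0.of_norm x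
  have nf (k : ℤ) (x : UnitAddCircle) : ‖fourier k x‖ = 1 := by
    rw [fourier_apply, Circle.norm_coe]
  have hKf : 0 ≤ K * ‖f‖ := by positivity
  refine ⟨fun x => ?_, fun t => ∑' k : ℤ, fourierCoeff f k •
      (2 * Real.pi * Complex.I * k * fourier k (t : UnitAddCircle)), ?_, ?_, ?_⟩
  · rw [← (hsum x).tsum_eq]
    refine (norm_tsum_le_tsum_norm ?_).trans ?_
    · simpa only [norm_smul, nf, mul_one] using s0
    · have : ∑' k : ℤ, ‖fourierCoeff f k‖ ≤ K * ‖f‖ := (s0.tsum_le_tsum b0 h1).trans h2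
      simp only [norm_smul, nf, mul_one]
      nlinarith
  all_goals
    have nd (k : ℤ) (t : ℝ) : ‖fourierCoeff f k •
        (2 * Real.pi * Complex.I * k * fourier k (t : UnitAddCircle))‖
        ≤ 2 * Real.pi * ((1 + (k : ℝ) ^ 2) ^ (1 / 2 : ℝ) * ‖fourierCoeff f k‖) := by
      simp only [norm_smul, norm_mul, Complex.norm_I, Complex.norm_real, Complex.norm_intCast,
        Real.norm_of_nonneg Real.pi_pos.le, Complex.norm_ofNat, nf, mul_one]
      have := mul_le_mul_of_nonneg_right (abs_le k) (norm_nonneg (fourierCoeff f k))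
      nlinarith [Real.pi_pos]
    have h3 := h1.mul_left (2 * Real.pi)
  · refine continuous_tsum (fun k => ?_) h3 nd
    have : Continuous fun t : ℝ => fourier k (t : UnitAddCircle) :=
      (fourier k).continuous.comp (AddCircle.continuous_mk' 1)
    fun_prop
  · intro t
    have e : (fun t : ℝ => f t) = fun t : ℝ =>
        ∑' k : ℤ, fourierCoeff f k • fourier k (t : UnitAddCircle) :=
      funext fun t => (hsum t).tsum_eq.symm
    rw [e]
    have hk (k : ℤ) (y : ℝ) : HasDerivAt
        (fun t : ℝ => fourierCoeff f k • fourier k (t : UnitAddCircle))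
        (fourierCoeff f k • (2 * Real.pi * Complex.I * k * fourier k (y : UnitAddCircle))) y := by
      have := (hasDerivAt_fourier 1 k y).const_smul (fourierCoeff f k)
      rwa [Complex.ofReal_one, div_one] at this
    have h0 := (hsum (0 : ℝ)).summable
    exact hasDerivAt_tsum (y₀ := (0 : ℝ)) h3 hk nd h0 t
  · intro t
    have h4 : Summable fun k : ℤ => ‖fourierCoeff f k •
        (2 * Real.pi * Complex.I * k * fourier k (t : UnitAddCircle))‖ :=
      Summable.of_nonneg_of_le (fun _ => norm_nonneg _) (nd · t) h3
    refine (norm_tsum_le_tsum_norm h4).trans ((h4.tsum_le_tsum (nd · t) h3).trans ?_)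
    rw [tsum_mul_left, mul_assoc (2 * Real.pi)]
    exact mul_le_mul_of_nonneg_left h2 (by positivity)

theorem SobolevR.exists_C1 {s : ℝ} (hs : 3 / 2 < s) : ∃ K : ℝ, 0 ≤ K ∧ ∀ f : SobolevR s,
    (∀ x, |f x| ≤ K * ‖f‖) ∧ Continuous (deriv fun t : ℝ => f t) ∧
      (Differentiable ℝ fun t : ℝ => f t) ∧ ∀ t, |deriv (fun t : ℝ => f t) t| ≤ K * ‖f‖ := by
  obtain ⟨K, hK, h⟩ := SobolevC.exists_C1 hs
  refine ⟨K, hK, fun f => ?_⟩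
  obtain ⟨h1, f', hc, hd, hb⟩ := h f.toComplex
  have hd' (t : ℝ) : HasDerivAt (fun t : ℝ => f t) (f' t).re t := by
    have := Complex.reCLM.hasFDerivAt.comp_hasDerivAt t (hd t)
    simpa [Function.comp_def] using this
  have e : (deriv fun t : ℝ => f t) = fun t => (f' t).re := funext fun t => (hd' t).deriv
  refine ⟨fun x => by simpa [norm_toComplex] using h1 x, ?_, fun t => (hd' t).differentiableAt, fun t => ?_⟩
  · rw [e]
    exact Complex.continuous_re.comp hc
  · rw [e]
    exact (Complex.abs_re_le_norm _).trans (hb t)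

/-- A real constant, as an element of the Sobolev space. -/
def SobolevR.const (s a : ℝ) : SobolevR s :=
  ⟨ContinuousMap.const _ a, SmoothC.memSobolev s (algebraMap ℂ SmoothC (a : ℂ))⟩

@[simp] theorem SobolevR.const_apply (s a : ℝ) (x : UnitAddCircle) :
    SobolevR.const s a x = a := rfl

/-! ### The Hilbert manifold of Sobolev diffeomorphisms of the circle -/

/-- The displacements `f ∈ H^q(𝕊¹, ℝ)` for which `x ↦ x + f(x)` is an orientation-preserving
diffeomorphism, that is `1 + f' > 0`. -/
def diffeoLifts (q : ℝ) : Set (SobolevR q) :=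
  {f | ∀ t : ℝ, 0 < 1 + deriv (fun t : ℝ => f t) t}

/-- `D^q(𝕊¹)` for `q > 3/2`: the orientation-preserving diffeomorphisms `φ` of the circle of
Sobolev class `H^q`, that is `φ(x) = x + f(x)` modulo `1` with `f ∈ H^q(𝕊¹, ℝ)` and
`1 + f' > 0` (a positive derivative makes `φ` a diffeomorphism, whose inverse is then of class
`H^q` too). -/
structure SobolevDiff (q : ℝ) where
  toEquiv : UnitAddCircle ≃ UnitAddCircle
  exists_lift : ∃ f ∈ diffeoLifts q, ∀ x, toEquiv x = x + (f x : UnitAddCircle)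

theorem eq_add_int_of_coe_eq {f g : C(UnitAddCircle, ℝ)}
    (h : ∀ x, (f x : UnitAddCircle) = g x) : ∃ n : ℤ, ∀ x, g x = f x + n := by
  have h1 (x : UnitAddCircle) : g x - f x ∈ AddSubgroup.zmultiples (1 : ℝ) := by
    rw [← QuotientAddGroup.eq_zero_iff]
    change ((g x - f x : ℝ) : UnitAddCircle) = 0
    rw [AddCircle.coe_sub, h x, sub_self]
  let F : UnitAddCircle → AddSubgroup.zmultiples (1 : ℝ) := fun x => ⟨g x - f x, h1 x⟩
  have hF : Continuous F := by
    apply Continuous.subtype_mk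
    fun_prop
  obtain ⟨n, hn⟩ := AddSubgroup.mem_zmultiples_iff.1 (h1 0)
  refine ⟨n, fun x => ?_⟩
  have := congrArg Subtype.val (PreconnectedSpace.constant inferInstance hF (x := x) (y := 0))
  simp only [F] at this
  simp only [zsmul_eq_mul, mul_one] at hn
  linarith

theorem add_lift_bijective {q : ℝ} (hq : 3 / 2 < q) {f : SobolevR q} (hf : f ∈ diffeoLifts q) :
    Function.Bijective fun x : UnitAddCircle => x + (f x : UnitAddCircle) := by
  obtain ⟨K, hK, h⟩ := SobolevR.exists_C1 hq
  obtain ⟨hb, -, hd, -⟩ := h f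
  have hd2 : Differentiable ℝ fun t : ℝ => t + f t := differentiable_id.add hd
  have hm : StrictMono fun t : ℝ => t + f t := by
    apply strictMono_of_deriv_pos
    intro t
    have : deriv (fun t : ℝ => t + f t) t = 1 + deriv (fun t : ℝ => f t) t :=
      ((hasDerivAt_id t).add (hd t).hasDerivAt).deriv
    rw [this]
    exact hf t
  have hs : Function.Surjective fun t : ℝ => t + f t := by
    apply hd2.continuous.surjective
    · refine Filter.tendsto_atTop_mono (fun t => ?_)
        (Filter.tendsto_atTop_add_const_right _ (-(K * ‖f‖)) Filter.tendsto_id)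
      have := (abs_le.1 (hb t)).1
      simp only [id]
      linarith
    · refine Filter.tendsto_atBot_mono (fun t => ?_)
        (Filter.tendsto_atBot_add_const_right _ (K * ‖f‖) Filter.tendsto_id)
      have := (abs_le.1 (hb t)).2
      simp only [id]
      linarith
  constructor
  · intro x y hxy
    induction x using QuotientAddGroup.induction_on with | H x => ?_
    induction y using QuotientAddGroup.induction_on with | H y => ?_
    change ((x + f x : ℝ) : UnitAddCircle) = ((y + f y : ℝ) : UnitAddCircle) at hxy
    obtain ⟨n, hn⟩ := (QuotientAddGroup.eq_iff_sub_mem.1 hxy)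
    have e : ((y + n : ℝ) : UnitAddCircle) = (y : UnitAddCircle) := by
      have : ((n : ℝ) : UnitAddCircle) = 0 := by
        refine AddCircle.coe_eq_zero_iff 1 |>.2 ⟨n, by simp⟩
      rw [AddCircle.coe_add, this, add_zero]
    have : x = y + n := by
      apply hm.injective
      simp only [e]
      simp only [zsmul_eq_mul, mul_one] at hn
      change _ = x + f x - (y + f y) at hn
      linarith
    change (x : UnitAddCircle) = (y : UnitAddCircle)
    rw [← e, this]
  · intro y
    induction y using QuotientAddGroup.induction_on with | H y => ?_
    obtain ⟨t, ht⟩ := hs y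
    exact ⟨t, congrArg ((↑) : ℝ → UnitAddCircle) ht⟩

theorem isOpen_diffeoLifts {q : ℝ} (hq : 3 / 2 < q) : IsOpen (diffeoLifts q) := by
  obtain ⟨K, hK, h⟩ := SobolevR.exists_C1 hq
  rw [Metric.isOpen_iff]
  intro f hf
  obtain ⟨-, hc, hd, -⟩ := h f
  obtain ⟨t₀, -, ht₀⟩ := (isCompact_Icc (a := (0 : ℝ)) (b := 1)).exists_isMinOn
    ⟨0, by simp⟩ hc.continuousOn
  have hmin (t : ℝ) : deriv (fun t : ℝ => f t) t₀ ≤ deriv (fun t : ℝ => f t) t := by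
    have hp : Function.Periodic (deriv fun t : ℝ => f t) 1 := by
      intro t
      rw [← deriv_comp_add_const]
      congr 1
      exact funext fun t => by simp
    obtain ⟨y, hy, e⟩ := hp.exists_mem_Ico₀ one_pos t
    rw [e]
    exact ht₀ (Set.Ico_subset_Icc_self hy)
  refine ⟨(1 + deriv (fun t : ℝ => f t) t₀) / (K + 1), div_pos (hf t₀) (by linarith), ?_⟩
  intro g hg t
  obtain ⟨-, -, hdg, -⟩ := h g
  obtain ⟨-, -, -, hb⟩ := h (g - f)
  have e : deriv (fun t : ℝ => (g - f) t) t
      = deriv (fun t : ℝ => g t) t - deriv (fun t : ℝ => f t) t := by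
    have h0 : (fun t : ℝ => (g - f) t) = (fun t : ℝ => g t) - fun t : ℝ => f t := by
      ext t
      simp
    rw [h0]
    exact ((hdg t).hasDerivAt.sub (hd t).hasDerivAt).deriv
  have h1 := (abs_le.1 (hb t)).1
  rw [e] at h1
  rw [Metric.mem_ball, dist_eq_norm, lt_div_iff₀ (by linarith)] at hg
  have := hmin t
  nlinarith [norm_nonneg (g - f)]

theorem continuous_eval_zero {q : ℝ} (hq : 3 / 2 < q) :
    Continuous fun f : SobolevR q => f (0 : UnitAddCircle) := by
  obtain ⟨K, hK, h⟩ := SobolevR.exists_C1 hq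
  let L : SobolevR q →ₗ[ℝ] ℝ :=
    { toFun := fun f => f 0
      map_add' := fun f g => by simp
      map_smul' := fun c f => by simp }
  exact (L.mkContinuous K fun f => (h f).1 0).continuous

theorem add_const_mem_diffeoLifts {q : ℝ} {f : SobolevR q} (hf : f ∈ diffeoLifts q) (a : ℝ) :
    f + SobolevR.const q a ∈ diffeoLifts q := by
  intro t
  have : (fun t : ℝ => (f + SobolevR.const q a) t) = fun t : ℝ => f t + a := by
    ext t
    simp
  rw [this, deriv_add_const]
  exact hf t

namespace SobolevDiff

variable {q : ℝ}

instance : CoeFun (SobolevDiff q) (fun _ => UnitAddCircle → UnitAddCircle) := ⟨fun φ => φ.toEquiv⟩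

theorem ext_apply {φ ψ : SobolevDiff q} (h : ∀ x, φ x = ψ x) : φ = ψ := by
  cases φ
  cases ψ
  congr
  exact Equiv.ext h

open Classical in
/-- The diffeomorphism `x ↦ x + f(x)`. -/
def ofLift [hq : Fact (3 / 2 < q)] (f : SobolevR q) : SobolevDiff q :=
  if hf : f ∈ diffeoLifts q then
    ⟨Equiv.ofBijective _ (add_lift_bijective hq.out hf), f, hf, fun _ => rfl⟩
  else ⟨Equiv.refl _, 0, fun t => by simp, fun x => by simp⟩

variable [Fact (3 / 2 < q)]

theorem ofLift_apply {f : SobolevR q} (hf : f ∈ diffeoLifts q) (x : UnitAddCircle) :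
    ofLift f x = x + (f x : UnitAddCircle) := by
  rw [ofLift, dif_pos hf]
  rfl

theorem exists_ofLift (φ : SobolevDiff q) : ∃ f ∈ diffeoLifts q, ofLift f = φ := by
  obtain ⟨f, hf, h⟩ := φ.exists_lift
  exact ⟨f, hf, ext_apply fun x => by rw [ofLift_apply hf, h]⟩

theorem ofLift_add_int {f : SobolevR q} (hf : f ∈ diffeoLifts q) (n : ℤ) :
    ofLift (f + SobolevR.const q n) = ofLift f := by
  refine ext_apply fun x => ?_
  rw [ofLift_apply hf, ofLift_apply (add_const_mem_diffeoLifts hf _)]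
  simp

theorem ofLift_eq {f g : SobolevR q} (hf : f ∈ diffeoLifts q) (hg : g ∈ diffeoLifts q)
    (h : ofLift f = ofLift g) : ∃ n : ℤ, g = f + SobolevR.const q n := by
  obtain ⟨n, hn⟩ := eq_add_int_of_coe_eq (f := f.toFun) (g := g.toFun) fun x => by
    have := ofLift_apply hf x
    rw [h, ofLift_apply hg] at this
    exact (add_left_cancel this).symm
  exact ⟨n, SobolevR.ext fun x => by simpa using hn x⟩

/-- The lifts `f` of diffeomorphisms with `|f(0) - c| < 1/2`. -/
def chartTarget (q c : ℝ) : Set (SobolevR q) := {f | f ∈ diffeoLifts q ∧ |f 0 - c| < 1 / 2}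

theorem ofLift_injOn (c : ℝ) : Set.InjOn (ofLift (q := q)) (chartTarget q c) := by
  intro f hf g hg h
  obtain ⟨n, rfl⟩ := ofLift_eq hf.1 hg.1 h
  have h1 := abs_lt.1 hf.2
  have h2 := abs_lt.1 hg.2
  simp only [map_add, ContinuousMap.add_apply, SobolevR.const_apply] at h2
  have h3 : (n : ℝ) < 1 := by linarith
  have h4 : (-1 : ℝ) < n := by linarith
  have : n = 0 := by
    have h3' : n < 1 := by exact_mod_cast h3
    have h4' : -1 < n := by exact_mod_cast h4
    omega
  subst this
  ext x
  simp

/-- The charts of `D^q`: the chart with parameter `c` sends `x ↦ x + f(x)` to `f`, where `f` is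
normalised by `|f(0) - c| < 1/2`. -/
def chart (q : ℝ) [Fact (3 / 2 < q)] (c : ℝ) : PartialEquiv (SobolevDiff q) (SobolevR q) :=
  ((ofLift_injOn c).toPartialEquiv _ _).symm

theorem chart_symm_apply (c : ℝ) (f : SobolevR q) : (chart q c).symm f = ofLift f := rfl

theorem chart_target (c : ℝ) : (chart q c).target = chartTarget q c := rfl

theorem chart_source (c : ℝ) : (chart q c).source = ofLift '' chartTarget q c := rfl

theorem chart_ofLift {c : ℝ} {f : SobolevR q} (hf : f ∈ chartTarget q c) :
    chart q c (ofLift f) = f := (chart q c).right_inv hf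

/-- Two charts differ locally by an integer translation. -/
theorem transition (c c' : ℝ) (f : SobolevR q) (hf : f ∈ ((chart q c).symm.trans (chart q c')).source) :
    ∃ n : ℤ, ∃ V : Set (SobolevR q), IsOpen V ∧ f ∈ V ∧
      V ⊆ ((chart q c).symm.trans (chart q c')).source ∧
      ∀ g ∈ V, (chart q c).symm.trans (chart q c') g = g + SobolevR.const q n := by
  have hq : 3 / 2 < q := Fact.out
  obtain ⟨hf1, g, hg, hgf⟩ := hf
  change f ∈ chartTarget q c at hf1
  obtain ⟨n, rfl⟩ := ofLift_eq hf1.1 hg.1 hgf.symm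
  refine ⟨n, {g | g ∈ diffeoLifts q ∧ |g 0 - c| < 1 / 2 ∧ |g 0 + n - c'| < 1 / 2}, ?_, ?_, ?_, ?_⟩
  · have := continuous_eval_zero hq
    refine (isOpen_diffeoLifts hq).inter (IsOpen.inter ?_ ?_)
    · exact isOpen_lt (this.sub continuous_const).abs continuous_const
    · exact isOpen_lt ((this.add continuous_const).sub continuous_const).abs continuous_const
  · exact ⟨hf1.1, hf1.2, by simpa using hg.2⟩
  · rintro g ⟨h1, h2, h3⟩
    refine ⟨⟨h1, h2⟩, g + SobolevR.const q n, ⟨add_const_mem_diffeoLifts h1 _, by simpa using h3⟩, ?_⟩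
    exact ofLift_add_int h1 n
  · rintro g ⟨h1, h2, h3⟩
    change chart q c' (ofLift g) = _
    rw [← ofLift_add_int h1 n]
    exact chart_ofLift ⟨add_const_mem_diffeoLifts h1 _, by simpa using h3⟩

/-- The atlas of `D^q`, which also defines its topology. -/
def chartedSpaceCore (q : ℝ) [Fact (3 / 2 < q)] :
    ChartedSpaceCore (SobolevR q) (SobolevDiff q) where
  atlas := Set.range (chart q)
  chartAt φ := chart q ((exists_ofLift φ).choose 0)
  mem_chart_source φ :=
    ⟨(exists_ofLift φ).choose, ⟨(exists_ofLift φ).choose_spec.1, by simp⟩,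
      (exists_ofLift φ).choose_spec.2⟩
  chart_mem_atlas φ := ⟨_, rfl⟩
  open_source := by
    rintro _ _ ⟨c, rfl⟩ ⟨c', rfl⟩
    refine isOpen_iff_forall_mem_open.2 fun f hf => ?_
    obtain ⟨n, V, hV, hfV, hs, -⟩ := transition c c' f hf
    exact ⟨V, hs, hV, hfV⟩
  continuousOn_toFun := by
    rintro _ _ ⟨c, rfl⟩ ⟨c', rfl⟩
    intro f hf
    obtain ⟨n, V, hV, hfV, hs, h⟩ := transition c c' f hf
    have h1 : ContinuousAt (fun g => g + SobolevR.const q n) f := by fun_prop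
    exact (h1.congr (Filter.eventuallyEq_of_mem (hV.mem_nhds hfV)
      fun g hg => (h g hg).symm)).continuousWithinAt

instance : TopologicalSpace (SobolevDiff q) := (chartedSpaceCore q).toTopologicalSpace

instance : ChartedSpace (SobolevR q) (SobolevDiff q) := (chartedSpaceCore q).toChartedSpace

/-- `D^q` is a smooth manifold modelled on the Hilbert space `H^q(𝕊¹, ℝ)`. -/
instance : IsManifold 𝓘(ℝ, SobolevR q) ∞ (SobolevDiff q) := by
  apply isManifold_of_contDiffOn
  rintro e e' he he'
  simp only [atlas, ChartedSpace.atlas, Set.mem_iUnion] at he he'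
  obtain ⟨_, ⟨c, rfl⟩, rfl⟩ := he
  obtain ⟨_, ⟨c', rfl⟩, rfl⟩ := he'
  simp only [modelWithCornersSelf_coe, modelWithCornersSelf_coe_symm, Function.id_comp,
    Function.comp_id, Set.preimage_id, Set.range_id, Set.inter_univ]
  intro f hf
  obtain ⟨n, V, hV, hfV, hs, h⟩ := transition c c' f hf
  have h1 : ContDiffAt ℝ ∞ (fun g => g + SobolevR.const q n) f := by fun_prop
  exact (h1.congr_of_eventuallyEq (Filter.eventuallyEq_of_mem (hV.mem_nhds hfV)
      fun g hg => h g hg)).contDiffWithinAt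

end SobolevDiff

/-- `y = R_φ T R_φ⁻¹ (u₀, …, uₙ)` where `R_φ v = v ∘ φ`: the functions `wᵢ = uᵢ ∘ φ⁻¹` belong to
`H^q`, and `y = T(w₀, …, wₙ) ∘ φ`. -/
def IsConjugate {q σ : ℝ} {n : ℕ} (φ : SobolevDiff q)
    (T : ContinuousMultilinearMap ℂ (fun _ : Fin (n + 1) => SobolevC q) (SobolevC σ))
    (u : Fin (n + 1) → SobolevC q) (y : SobolevC σ) : Prop :=
  ∃ w : Fin (n + 1) → SobolevC q,
    (∀ i x, w i x = u i (φ.toEquiv.symm x)) ∧ ∀ x, y x = T w (φ x)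

end

/-! The obstacle is that `φ ↦ R_φ` is only strongly continuous: differentiating `v ∘ φ` in `φ` costs
a derivative of `v`, so `R_φ P R_φ⁻¹` cannot be differentiated factor by factor in operator norm.
For a smooth diffeomorphism, smooth direction and smooth arguments the formal computation is
legitimate. Along a segment in direction `δφ`, the derivative of `R_φ Pₙ R_φ⁻¹ (u₀, …, uₙ)` is `R_φ
Pₙ₊₁ R_φ⁻¹ (u₀, …, uₙ, δφ)`; the commutator and the sum in the recursion are exactly what the
product rule produces (`hasDerivAt_conj_smooth`).

Boundedness of all the `Pₙ` then makes up for the lost derivative. Since `R_φ` and `R_φ⁻¹` are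
locally uniformly bounded, so is every `R_φ Pₙ R_φ⁻¹`. The mean value inequality on segments turns a
bound at level `n + 2` into a Lipschitz estimate at level `n + 1`, and this into a quadratic Taylor
remainder at level `n`. These inequalities involve only expressions jointly continuous in the
diffeomorphism and the arguments, so they pass from smooth data to all data by density
(`norm_conj_sub_le`, `norm_conj_taylor_le`). The remainder is uniform over bounded arguments, hence
an operator norm estimate, and level `n + 1` is the Fréchet derivative of level `n`
(`hasFDerivAt_conjDeriv`). Each new direction enters as the last argument; symmetry of second
derivatives (`apply_snoc_eq_apply_cons`) moves it to the front, as a Taylor series requires.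

The analytic input is `DiffeoBounds.exists_energy_comp_le`: composition with `φ` and `φ⁻¹` is
bounded on `Hˢ`, `1/2 < s ≤ q`, locally uniformly in `φ`. Order 0 is a change of variables, orders 1
and 2 follow from the chain rule and the product estimate `exists_energy_mul_le`, fractional orders
below 2 from interpolation, and higher orders by induction. Squared norms are handled as `energy`,
with values in `[0, ∞]`, so that estimates can be written before finiteness is known. -/

noncomputable section

open scoped ENNReal Topology
open MeasureTheory

/-! ### The Sobolev energy of a continuous function -/

/-- The `k`-th Fourier coefficient as a continuous linear functional on continuous functions. -/
def fourierCoeffCLM (k : ℤ) : C(UnitAddCircle, ℂ) →L[ℂ] ℂ :=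
  LinearMap.mkContinuous
    { toFun := fun u => fourierCoeff u k
      map_add' := fun f g => fourierCoeff_add_circle f g k
      map_smul' := fun c f => fourierCoeff_smul_circle c f k } 1 (by
    intro g
    have : ∀ x, ‖fourier (-k) x • g x‖ ≤ ‖g‖ := fun x => by
      rw [norm_smul, fourier_apply, Circle.norm_coe, one_mul]
      exact g.norm_coe_le_norm x
    have h := MeasureTheory.norm_integral_le_of_norm_le_const
      (μ := AddCircle.haarAddCircle) (Filter.Eventually.of_forall this)
    rw [MeasureTheory.probReal_univ, mul_one] at h
    rw [one_mul]
    exact h)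

theorem fourierCoeffCLM_apply (k : ℤ) (u : C(UnitAddCircle, ℂ)) :
    fourierCoeffCLM k u = fourierCoeff u k := rfl

/-- The extended Sobolev energy `∑ₖ (1 + k²)ˢ |û(k)|²`. -/
def energy (s : ℝ) (u : C(UnitAddCircle, ℂ)) : ℝ≥0∞ :=
  ∑' k : ℤ, ENNReal.ofReal ((1 + (k : ℝ) ^ 2) ^ s) * ‖fourierCoeff u k‖ₑ ^ 2

theorem energy_term (s : ℝ) (z : ℂ) (k : ℤ) :
    ENNReal.ofReal ((1 + (k : ℝ) ^ 2) ^ s) * ‖z‖ₑ ^ 2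
      = ENNReal.ofReal ((1 + (k : ℝ) ^ 2) ^ s * ‖z‖ ^ 2) := by
  rw [ENNReal.ofReal_mul (by positivity), ENNReal.ofReal_pow (norm_nonneg _), ofReal_norm]

theorem energy_ne_top_iff {s : ℝ} {u : C(UnitAddCircle, ℂ)} : energy s u ≠ ⊤ ↔ MemSobolev s u := by
  simp only [energy, energy_term]
  constructor
  · intro h
    have := ENNReal.summable_toReal h
    refine this.congr fun k => ?_
    rw [ENNReal.toReal_ofReal (by positivity)]
  · intro h
    exact h.tsum_ofReal_ne_top

theorem energy_toFun {s : ℝ} (f : SobolevC s) : energy s f.toFun = ENNReal.ofReal (‖f‖ ^ 2) := by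
  simp only [energy, energy_term]
  rw [SobolevC.norm_sq, ENNReal.ofReal_tsum_of_nonneg (fun k => by positivity) f.memSobolev]

theorem energy_mono {s s' : ℝ} (h : s ≤ s') (u : C(UnitAddCircle, ℂ)) : energy s u ≤ energy s' u := by
  refine ENNReal.tsum_le_tsum fun k => ?_
  gcongr
  nlinarith [sq_nonneg (k : ℝ)]

theorem ennreal_two_mul_le (a b : ℝ≥0∞) : 2 * (a * b) ≤ a ^ 2 + b ^ 2 := by
  wlog h : a ≤ b generalizing a b
  · rw [mul_comm a, add_comm]
    exact this b a (le_of_not_ge h)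
  obtain ⟨c, rfl⟩ := exists_add_of_le h
  -- With `b = a + c`, the difference of the two sides is `c ^ 2`; this form avoids subtraction in
  -- `[0, ∞]`.
  calc 2 * (a * (a + c)) ≤ 2 * (a * (a + c)) + c ^ 2 := le_self_add
    _ = _ := by ring

theorem ennreal_add_sq_le (a b : ℝ≥0∞) : (a + b) ^ 2 ≤ 2 * (a ^ 2 + b ^ 2) := by
  calc (a + b) ^ 2 = a ^ 2 + b ^ 2 + 2 * (a * b) := by ring
    _ ≤ a ^ 2 + b ^ 2 + (a ^ 2 + b ^ 2) := by gcongr; exact ennreal_two_mul_le a b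
    _ = _ := by ring

theorem energy_add_le (s : ℝ) (u v : C(UnitAddCircle, ℂ)) :
    energy s (u + v) ≤ 2 * (energy s u + energy s v) := by
  simp only [energy]
  rw [← ENNReal.tsum_add, ← ENNReal.tsum_mul_left]
  refine ENNReal.tsum_le_tsum fun k => ?_
  rw [fourierCoeff_add_circle, ← mul_add, mul_left_comm]
  gcongr
  refine le_trans ?_ (ennreal_add_sq_le _ _)
  gcongr
  exact enorm_add_le _ _

theorem energy_smul (s : ℝ) (c : ℂ) (u : C(UnitAddCircle, ℂ)) :
    energy s (c • u) = ‖c‖ₑ ^ 2 * energy s u := by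
  simp only [energy]
  rw [← ENNReal.tsum_mul_left]
  refine tsum_congr fun k => ?_
  rw [fourierCoeff_smul_circle, enorm_mul, mul_pow]
  ring

/-- Parseval's identity. It converts order 0 into an integral, where a change of variables is
possible. -/
theorem energy_zero_eq (u : C(UnitAddCircle, ℂ)) :
    energy 0 u = ENNReal.ofReal (∫ x, ‖u x‖ ^ 2 ∂AddCircle.haarAddCircle) := by
  have h := hasSum_sq_fourierCoeff (ContinuousMap.toLp (E := ℂ) 2 AddCircle.haarAddCircle ℂ u)
  simp only [fourierCoeff_toLp] at h
  have e : ∫ x, ‖(ContinuousMap.toLp (E := ℂ) 2 AddCircle.haarAddCircle ℂ u) x‖ ^ 2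
      ∂AddCircle.haarAddCircle = ∫ x, ‖u x‖ ^ 2 ∂AddCircle.haarAddCircle := by
    refine integral_congr_ae ?_
    filter_upwards [ContinuousMap.coeFn_toLp (p := 2) (𝕜 := ℂ) AddCircle.haarAddCircle u] with x hx
    rw [hx]
  rw [e] at h
  simp only [energy, energy_term]
  simp only [Real.rpow_zero, one_mul]
  rw [← ENNReal.ofReal_tsum_of_nonneg (fun k => by positivity) h.summable, h.tsum_eq]

/-- The base point is free because a lift `t + f(t)` carries `[0, 1]` to the period starting at
`f(0)`. -/
theorem energy_zero_eq_interval (u : C(UnitAddCircle, ℂ)) (a : ℝ) :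
    energy 0 u = ENNReal.ofReal (∫ t in a..a + 1, ‖u (t : UnitAddCircle)‖ ^ 2) := by
  rw [energy_zero_eq, AddCircle.integral_haarAddCircle,
    ← AddCircle.intervalIntegral_preimage 1 a]
  simp

theorem energy_zero_mul_le (u v : C(UnitAddCircle, ℂ)) {B : ℝ} (hB : ∀ x, ‖u x‖ ≤ B) :
    energy 0 (u * v) ≤ ENNReal.ofReal (B ^ 2) * energy 0 v := by
  rw [energy_zero_eq, energy_zero_eq, ← ENNReal.ofReal_mul (by positivity), ← integral_const_mul]
  refine ENNReal.ofReal_le_ofReal (integral_mono_of_nonneg ?_ ?_ ?_)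
  · exact Filter.Eventually.of_forall fun x => by positivity
  · refine Continuous.integrable_of_hasCompactSupport ?_ (HasCompactSupport.of_compactSpace _)
    fun_prop
  · refine Filter.Eventually.of_forall fun x => ?_
    simp only [ContinuousMap.mul_apply, norm_mul, mul_pow]
    have := hB x
    gcongr

theorem energy_zero_le (u : C(UnitAddCircle, ℂ)) {B : ℝ} (hB : ∀ x, ‖u x‖ ≤ B) :
    energy 0 u ≤ ENNReal.ofReal (B ^ 2) := by
  rw [energy_zero_eq]
  refine ENNReal.ofReal_le_ofReal ?_
  have h : ∫ x, ‖u x‖ ^ 2 ∂AddCircle.haarAddCircle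
      ≤ ∫ x : UnitAddCircle, B ^ 2 ∂AddCircle.haarAddCircle := by
    refine integral_mono_of_nonneg ?_ (integrable_const _) ?_
    · exact Filter.Eventually.of_forall fun x => by positivity
    · refine Filter.Eventually.of_forall fun x => ?_
      have := hB x
      dsimp only
      gcongr
  simpa using h

/-- Lower semicontinuity of the energy under uniform convergence. -/
theorem energy_le_of_tendsto {ι : Type*} {l : Filter ι} [l.NeBot] {s : ℝ}
    {u : ι → C(UnitAddCircle, ℂ)} {v : C(UnitAddCircle, ℂ)} (h : Filter.Tendsto u l (nhds v))
    {B : ℝ≥0∞} (hB : ∀ i, energy s (u i) ≤ B) : energy s v ≤ B := by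
  -- Each finite partial sum is continuous for uniform convergence, and the energy is their
  -- supremum.
  rw [energy, ENNReal.tsum_eq_iSup_sum]
  refine iSup_le fun S => ?_
  have h1 (k : ℤ) : Filter.Tendsto (fun i => ‖fourierCoeff (u i) k‖ₑ ^ 2) l
      (nhds (‖fourierCoeff v k‖ₑ ^ 2)) := by
    have := ((fourierCoeffCLM k).continuous.tendsto v).comp h
    exact ((ENNReal.continuous_pow 2).tendsto _).comp this.enorm
  have h2 := tendsto_finsetSum S fun k _ =>
    ENNReal.Tendsto.const_mul (a := ENNReal.ofReal ((1 + (k : ℝ) ^ 2) ^ s)) (h1 k)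
      (Or.inr ENNReal.ofReal_ne_top)
  refine le_of_tendsto h2 (Filter.Eventually.of_forall fun i => ?_)
  exact (ENNReal.sum_le_tsum S).trans (hB i)

/-! ### Derivatives -/

/-- `u'` is the derivative of `u`, both continuous functions on the circle. -/
def IsDerivC (u u' : C(UnitAddCircle, ℂ)) : Prop :=
  ∀ t : ℝ, HasDerivAt (fun t : ℝ => u t) (u' t) t

theorem continuous_coe_comp {X : Type*} [TopologicalSpace X] (u : C(UnitAddCircle, X)) :
    Continuous fun t : ℝ => u t := u.continuous.comp (AddCircle.continuous_mk' 1)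

theorem IsDerivC.mul {u u' v v' : C(UnitAddCircle, ℂ)} (hu : IsDerivC u u') (hv : IsDerivC v v') :
    IsDerivC (u * v) (u' * v + u * v') := fun t => (hu t).mul (hv t)

/-- Integration by parts, with boundary terms cancelling by periodicity. The frequency 0 is
separate, since there the formula cannot be divided by `k`; it says that `u'` has mean zero. -/
theorem IsDerivC.fourierCoeff {u u' : C(UnitAddCircle, ℂ)} (hu : IsDerivC u u') (k : ℤ) :
    fourierCoeff u' k = 2 * Real.pi * Complex.I * k * _root_.fourierCoeff u k := by
  have h2 : u (1 : ℝ) = u (0 : ℝ) := by simp [AddCircle.coe_period]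
  rcases eq_or_ne k 0 with rfl | hk
  · have h : ∫ t in (0 : ℝ)..1, u' (t : UnitAddCircle) = u (1 : ℝ) - u (0 : ℝ) :=
      intervalIntegral.integral_eq_sub_of_hasDerivAt (f := fun t : ℝ => u t) (fun t _ => hu t)
        ((continuous_coe_comp u').intervalIntegrable _ _)
    rw [fourierCoeff_eq_intervalIntegral _ _ 0]
    simp only [zero_add]
    simp [h, h2]
  · have h := fourierCoeffOn_of_hasDerivAt (zero_lt_one' ℝ) (f := fun t : ℝ => u t)
      (f' := fun t : ℝ => u' t) hk (fun t _ => hu t)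
      ((continuous_coe_comp u').intervalIntegrable _ _)
    have e (g : UnitAddCircle → ℂ) :
        fourierCoeffOn (zero_lt_one' ℝ) (fun t : ℝ => g t) k = _root_.fourierCoeff g k := by
      rw [fourierCoeffOn_eq_integral, fourierCoeff_eq_intervalIntegral _ _ 0]
      simp
    rw [e, e] at h
    rw [h, h2]
    have : (k : ℂ) ≠ 0 := by exact_mod_cast hk
    have := Complex.two_pi_I_ne_zero
    have := Complex.I_ne_zero
    field_simp
    simp

theorem IsDerivC.enorm_fourierCoeff_sq {u u' : C(UnitAddCircle, ℂ)} (hu : IsDerivC u u') (k : ℤ) :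
    ‖_root_.fourierCoeff u' k‖ₑ ^ 2
      = ENNReal.ofReal ((2 * Real.pi) ^ 2 * (k : ℝ) ^ 2) * ‖_root_.fourierCoeff u k‖ₑ ^ 2 := by
  rw [hu.fourierCoeff, enorm_mul, mul_pow]
  congr 1
  rw [← ofReal_norm, ← ENNReal.ofReal_pow (norm_nonneg _)]
  congr 1
  simp only [norm_mul, Complex.norm_I, Complex.norm_real, Complex.norm_intCast,
    Real.norm_of_nonneg Real.pi_pos.le, Complex.norm_ofNat, mul_pow, sq_abs]
  ring

/-- The extra weight `1 + k²` is at most `1 + (2πk)²`. Together with `IsDerivC.energy_deriv_le` this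
allows induction on the order of regularity, fractional orders included. -/
theorem IsDerivC.energy_succ_le {u u' : C(UnitAddCircle, ℂ)} (hu : IsDerivC u u') (s : ℝ) :
    energy (s + 1) u ≤ energy s u + energy s u' := by
  simp only [energy]
  rw [← ENNReal.tsum_add]
  refine ENNReal.tsum_le_tsum fun k => ?_
  rw [hu.enorm_fourierCoeff_sq, ← mul_assoc, ← add_mul, ← ENNReal.ofReal_mul (by positivity),
    ← ENNReal.ofReal_add (by positivity) (by positivity)]
  gcongr
  rw [Real.rpow_add (by positivity), Real.rpow_one, mul_add, mul_one]
  have h1 : (0 : ℝ) ≤ (1 + (k : ℝ) ^ 2) ^ s * (k : ℝ) ^ 2 := by positivity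
  have h2 : (1 : ℝ) ≤ (2 * Real.pi) ^ 2 := by nlinarith [Real.pi_gt_three]
  nlinarith

theorem IsDerivC.energy_deriv_le {u u' : C(UnitAddCircle, ℂ)} (hu : IsDerivC u u') (s : ℝ) :
    energy s u' ≤ ENNReal.ofReal ((2 * Real.pi) ^ 2) * energy (s + 1) u := by
  simp only [energy]
  rw [← ENNReal.tsum_mul_left]
  refine ENNReal.tsum_le_tsum fun k => ?_
  rw [hu.enorm_fourierCoeff_sq, ← mul_assoc, ← mul_assoc, ← ENNReal.ofReal_mul (by positivity),
    ← ENNReal.ofReal_mul (by positivity)]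
  refine mul_le_mul_left (ENNReal.ofReal_le_ofReal ?_) _
  rw [Real.rpow_add (by positivity), Real.rpow_one]
  have : (0 : ℝ) ≤ (1 + (k : ℝ) ^ 2) ^ s * (2 * Real.pi) ^ 2 := by positivity
  nlinarith

theorem exists_isDerivC {s : ℝ} (hs : 3 / 2 < s) {u : C(UnitAddCircle, ℂ)} (hu : energy s u ≠ ⊤) :
    ∃ u', IsDerivC u u' := by
  obtain ⟨K, hK, h⟩ := SobolevC.exists_C1 hs
  obtain ⟨-, f', hc, hd, -⟩ := h ⟨u, energy_ne_top_iff.1 hu⟩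
  have hd' : ∀ t : ℝ, HasDerivAt (fun t : ℝ => u t) (f' t) t := hd
  have e : deriv (fun t : ℝ => u t) = f' := funext fun t => (hd' t).deriv
  have hp : Function.Periodic f' 1 := e ▸ SmoothC.periodic_deriv u
  refine ⟨⟨hp.lift, (QuotientAddGroup.isQuotientMap_mk _).continuous_iff.2 ?_⟩, fun t => ?_⟩
  · exact hc
  · exact hd' t

/-! ### Products -/

/-- Cauchy–Schwarz without summability hypotheses: sum `2 (fᵢ gⱼ)(fⱼ gᵢ) ≤ (fᵢ gⱼ)² + (fⱼ gᵢ)²` over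
all pairs. -/
theorem ennreal_tsum_mul_sq_le {ι : Type*} (f g : ι → ℝ≥0∞) :
    (∑' i, f i * g i) ^ 2 ≤ (∑' i, f i ^ 2) * ∑' i, g i ^ 2 := by
  have key : 2 * (∑' i, f i * g i) ^ 2 ≤ 2 * ((∑' i, f i ^ 2) * ∑' i, g i ^ 2) := by
    calc 2 * (∑' i, f i * g i) ^ 2
        = ∑' i, ∑' j, 2 * ((f i * g j) * (f j * g i)) := by
          rw [pow_two, ← ENNReal.tsum_mul_right, ← ENNReal.tsum_mul_left]
          refine tsum_congr fun i => ?_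
          rw [← ENNReal.tsum_mul_left, ← ENNReal.tsum_mul_left]
          refine tsum_congr fun j => ?_
          ring
      _ ≤ ∑' i, ∑' j, ((f i * g j) ^ 2 + (f j * g i) ^ 2) :=
          ENNReal.tsum_le_tsum fun i => ENNReal.tsum_le_tsum fun j => ennreal_two_mul_le _ _
      _ = 2 * ((∑' i, f i ^ 2) * ∑' i, g i ^ 2) := by
          have e : ∑' i, ∑' j, (f i * g j) ^ 2 = (∑' i, f i ^ 2) * ∑' i, g i ^ 2 := by
            simp only [mul_pow, ENNReal.tsum_mul_left, ENNReal.tsum_mul_right]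
          simp only [ENNReal.tsum_add]
          rw [e, ENNReal.tsum_comm (f := fun i j => (f j * g i) ^ 2), e, two_mul]
  exact (ENNReal.mul_le_mul_iff_right (by norm_num) (by norm_num)).1 key

theorem ennreal_tsum_weighted_sq_le {ι : Type*} (a b : ι → ℝ≥0∞) :
    (∑' i, a i * b i) ^ 2 ≤ (∑' i, a i) * ∑' i, a i * b i ^ 2 := by
  have h (x : ℝ≥0∞) : (x ^ (1 / 2 : ℝ)) ^ 2 = x := by
    rw [← ENNReal.rpow_natCast, ← ENNReal.rpow_mul]
    norm_num
  have := ennreal_tsum_mul_sq_le (fun i => a i ^ (1 / 2 : ℝ)) fun i => a i ^ (1 / 2 : ℝ) * b i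
  simpa only [mul_pow, h, ← mul_assoc, ← pow_two] using this

/-- Young's inequality for the convolution of a summable and a square summable sequence. -/
theorem ennreal_tsum_conv_sq_le (a b : ℤ → ℝ≥0∞) :
    ∑' k, (∑' l, a l * b (k - l)) ^ 2 ≤ (∑' l, a l) ^ 2 * ∑' l, b l ^ 2 := by
  calc ∑' k, (∑' l, a l * b (k - l)) ^ 2
      ≤ ∑' k, (∑' l, a l) * ∑' l, a l * b (k - l) ^ 2 :=
        ENNReal.tsum_le_tsum fun k => ennreal_tsum_weighted_sq_le _ _
    _ = (∑' l, a l) * ∑' l, a l * ∑' k, b (k - l) ^ 2 := by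
        rw [ENNReal.tsum_mul_left, ENNReal.tsum_comm]
        simp only [ENNReal.tsum_mul_left]
    _ = _ := by
        have (l : ℤ) : ∑' k, b (k - l) ^ 2 = ∑' k, b k ^ 2 :=
          (Equiv.subRight l).tsum_eq fun k => b k ^ 2
        simp only [this, ENNReal.tsum_mul_right]
        ring

theorem ofReal_weight_rpow_half_sq (b : ℝ) (k : ℤ) :
    ENNReal.ofReal ((1 + (k : ℝ) ^ 2) ^ (b / 2)) ^ 2 = ENNReal.ofReal ((1 + (k : ℝ) ^ 2) ^ b) := by
  rw [← ENNReal.ofReal_pow (by positivity), ← Real.rpow_natCast, ← Real.rpow_mul (by positivity)]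
  norm_num

/-- The sum of the moduli of the Fourier coefficients, with a weight, is controlled by the
energy. -/
theorem exists_tsum_enorm_le {a : ℝ} (ha : 1 / 2 < a) : ∃ C : ℝ≥0∞, C ≠ ⊤ ∧
    ∀ (b : ℝ) (u : ℤ → ℂ), (∑' k : ℤ, ENNReal.ofReal ((1 + (k : ℝ) ^ 2) ^ ((b - a) / 2)) * ‖u k‖ₑ) ^ 2
      ≤ C * ∑' k : ℤ, ENNReal.ofReal ((1 + (k : ℝ) ^ 2) ^ b) * ‖u k‖ₑ ^ 2 := by
  refine ⟨∑' k : ℤ, ENNReal.ofReal ((1 + (k : ℝ) ^ 2) ^ (-a)),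
    (summable_sobolev_weight (a := -a) (by linarith)).tsum_ofReal_ne_top, fun b u => ?_⟩
  have h := ennreal_tsum_mul_sq_le (fun k : ℤ => ENNReal.ofReal ((1 + (k : ℝ) ^ 2) ^ (-a / 2)))
    fun k => ENNReal.ofReal ((1 + (k : ℝ) ^ 2) ^ (b / 2)) * ‖u k‖ₑ
  simp only [mul_pow, ofReal_weight_rpow_half_sq, ← mul_assoc] at h
  refine le_of_eq_of_le ?_ h
  congr 1
  refine tsum_congr fun k => ?_
  rw [← ENNReal.ofReal_mul (by positivity), ← Real.rpow_add (by positivity)]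
  congr 4
  ring

theorem summable_fourierCoeff {a : ℝ} (ha : 1 / 2 < a) {u : C(UnitAddCircle, ℂ)}
    (hu : energy a u ≠ ⊤) : Summable fun k => ‖fourierCoeff u k‖ := by
  obtain ⟨C, hC, h⟩ := exists_tsum_enorm_le ha
  have h1 := h a (fourierCoeff u)
  simp only [sub_self, zero_div, Real.rpow_zero, ENNReal.ofReal_one, one_mul] at h1
  have h2 : (∑' k, ‖fourierCoeff u k‖ₑ) ≠ ⊤ := by
    intro h3
    rw [h3, ENNReal.top_pow two_ne_zero, top_le_iff] at h1
    exact ENNReal.mul_ne_top hC hu h1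
  simpa using ENNReal.summable_toReal h2

theorem hasSum_fourier {a : ℝ} (ha : 1 / 2 < a) {u : C(UnitAddCircle, ℂ)}
    (hu : energy a u ≠ ⊤) : HasSum (fun k => fourierCoeff u k • fourier k) u :=
  hasSum_fourier_series_of_summable (summable_fourierCoeff ha hu).of_norm

theorem fourierCoeff_fourier_mul (l k : ℤ) (v : C(UnitAddCircle, ℂ)) :
    fourierCoeff (fourier l * v : C(UnitAddCircle, ℂ)) k = fourierCoeff v (k - l) := by
  simp only [fourierCoeff, ContinuousMap.mul_apply, smul_eq_mul, ← mul_assoc, ← fourier_add]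
  congr! 4
  ring_nf

/-- The Fourier series of `u` converges uniformly, so it may be multiplied by `v` and the `k`-th
coefficient taken termwise; multiplication by `e_l` shifts frequencies by `l`. -/
theorem fourierCoeff_mul {a : ℝ} (ha : 1 / 2 < a) {u : C(UnitAddCircle, ℂ)}
    (hu : energy a u ≠ ⊤) (v : C(UnitAddCircle, ℂ)) (k : ℤ) :
    HasSum (fun l => fourierCoeff u l * fourierCoeff v (k - l))
      (fourierCoeff (u * v : C(UnitAddCircle, ℂ)) k) := by
  have h := ((hasSum_fourier ha hu).mul_right v).mapL (fourierCoeffCLM k)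
  change HasSum _ (fourierCoeffCLM k (u * v))
  convert h using 1
  ext l
  rw [smul_mul_assoc, map_smul, fourierCoeffCLM_apply, fourierCoeff_fourier_mul, smul_eq_mul]

/-- The larger of the two frequencies dominates the sum. If it is `m`, the first term suffices. If
it is `l`, write `b = a + (b - a)` and, the exponent `b - a` being nonpositive, replace `l` by the
smaller `m` in that factor. -/
theorem weight_rpow_le {a b : ℝ} (hb : 0 ≤ b) (hab : b ≤ a) (l m : ℤ) :
    (1 + ((l + m : ℤ) : ℝ) ^ 2) ^ (b / 2) ≤ 4 ^ (b / 2) * ((1 + (m : ℝ) ^ 2) ^ (b / 2)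
      + (1 + (l : ℝ) ^ 2) ^ (a / 2) * (1 + (m : ℝ) ^ 2) ^ ((b - a) / 2)) := by
  push_cast
  have h0 : 1 + ((l : ℝ) + m) ^ 2 ≤ 2 * (1 + (l : ℝ) ^ 2) + 2 * (1 + (m : ℝ) ^ 2) := by
    nlinarith [sq_nonneg ((l : ℝ) - m)]
  rcases le_total ((l : ℝ) ^ 2) ((m : ℝ) ^ 2) with h | h
  · calc (1 + ((l : ℝ) + m) ^ 2) ^ (b / 2) ≤ (4 * (1 + (m : ℝ) ^ 2)) ^ (b / 2) :=
          Real.rpow_le_rpow (by positivity) (by linarith) (by positivity)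
      _ = 4 ^ (b / 2) * (1 + (m : ℝ) ^ 2) ^ (b / 2) := Real.mul_rpow (by positivity) (by positivity)
      _ ≤ _ := by
        gcongr
        exact le_add_of_nonneg_right (by positivity)
  · calc (1 + ((l : ℝ) + m) ^ 2) ^ (b / 2) ≤ (4 * (1 + (l : ℝ) ^ 2)) ^ (b / 2) :=
          Real.rpow_le_rpow (by positivity) (by linarith) (by positivity)
      _ = 4 ^ (b / 2) * (1 + (l : ℝ) ^ 2) ^ (b / 2) := Real.mul_rpow (by positivity) (by positivity)
      _ = 4 ^ (b / 2) * ((1 + (l : ℝ) ^ 2) ^ (a / 2) * (1 + (l : ℝ) ^ 2) ^ ((b - a) / 2)) := by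
        rw [← Real.rpow_add (by positivity)]
        congr 2
        ring
      _ ≤ 4 ^ (b / 2) * ((1 + (l : ℝ) ^ 2) ^ (a / 2) * (1 + (m : ℝ) ^ 2) ^ ((b - a) / 2)) := by
        gcongr 4 ^ (b / 2) * ((1 + (l : ℝ) ^ 2) ^ (a / 2) * ?_)
        exact Real.rpow_le_rpow_of_nonpos (by positivity) (by linarith) (by linarith)
      _ ≤ _ := by
        gcongr
        exact le_add_of_nonneg_left (by positivity)

/-- The product of a function of class `Hᵃ`, `a > 1/2`, and a function of class `Hᵇ`,
`0 ≤ b ≤ a`, is of class `Hᵇ`. -/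
theorem exists_energy_mul_le {a b : ℝ} (ha : 1 / 2 < a) (hb : 0 ≤ b) (hab : b ≤ a) :
    ∃ C : ℝ≥0∞, C ≠ ⊤ ∧ ∀ u v : C(UnitAddCircle, ℂ), energy a u ≠ ⊤ →
      energy b (u * v) ≤ C * (energy a u * energy b v) := by
  obtain ⟨C, hC, h⟩ := exists_tsum_enorm_le ha
  refine ⟨ENNReal.ofReal (4 ^ (b / 2)) ^ 2 * 4 * C, by finiteness, fun u v hu => ?_⟩
  set w : ℝ → ℤ → ℝ≥0∞ := fun s k => ENNReal.ofReal ((1 + (k : ℝ) ^ 2) ^ (s / 2)) with hw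
  have hw2 (s : ℝ) (k : ℤ) : ENNReal.ofReal ((1 + (k : ℝ) ^ 2) ^ s) = w s k ^ 2 :=
    (ofReal_weight_rpow_half_sq s k).symm
  set c := ENNReal.ofReal (4 ^ (b / 2))
  set U : ℤ → ℝ≥0∞ := fun k => ‖fourierCoeff u k‖ₑ
  set V : ℤ → ℝ≥0∞ := fun k => ‖fourierCoeff v k‖ₑ
  have hwt (k l : ℤ) : w b k ≤ c * (w b (k - l) + w a l * w (b - a) (k - l)) := by
    simp only [hw, c]
    rw [← ENNReal.ofReal_mul (by positivity), ← ENNReal.ofReal_add (by positivity) (by positivity),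
      ← ENNReal.ofReal_mul (by positivity)]
    refine ENNReal.ofReal_le_ofReal ?_
    simpa using weight_rpow_le hb hab l (k - l)
  -- The weighted convolution splits into two convolutions of an `ℓ¹` with an `ℓ²` sequence: plain
  -- `U` with `V` of weight `b`, and `V` of weight `b - a` (summable because `a > 1/2`) with `U` of
  -- weight `a`.
  have hk (k : ℤ) : w b k * ‖fourierCoeff (u * v : C(UnitAddCircle, ℂ)) k‖ₑ
      ≤ c * (∑' l, U l * (w b (k - l) * V (k - l))
        + ∑' l, (w (b - a) l * V l) * (w a (k - l) * U (k - l))) := by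
    -- The reflection `l ↦ k - l` puts the summable factor first, as Young's inequality expects.
    have e : ∑' l, (w (b - a) l * V l) * (w a (k - l) * U (k - l))
        = ∑' l, (w a l * U l) * (w (b - a) (k - l) * V (k - l)) := by
      rw [← (Equiv.subLeft k).tsum_eq]
      refine tsum_congr fun l => ?_
      simp only [Equiv.subLeft_apply, sub_sub_cancel]
      ring
    calc w b k * ‖fourierCoeff (u * v : C(UnitAddCircle, ℂ)) k‖ₑ
        ≤ w b k * ∑' l, U l * V (k - l) := by
          gcongr
          rw [← (fourierCoeff_mul ha hu v k).tsum_eq]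
          refine (enorm_tsum_le_tsum_enorm).trans_eq ?_
          exact tsum_congr fun l => enorm_mul _ _
      _ ≤ ∑' l, c * (U l * (w b (k - l) * V (k - l))
            + (w a l * U l) * (w (b - a) (k - l) * V (k - l))) := by
          rw [← ENNReal.tsum_mul_left]
          refine ENNReal.tsum_le_tsum fun l => ?_
          calc w b k * (U l * V (k - l))
              ≤ c * (w b (k - l) + w a l * w (b - a) (k - l)) * (U l * V (k - l)) := by
                gcongr
                exact hwt k l
            _ = _ := by ring
      _ = _ := by rw [ENNReal.tsum_mul_left, ENNReal.tsum_add, e]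
  have hU : (∑' k, U k) ^ 2 ≤ C * energy a u := by
    have h1 := h a (fourierCoeff u)
    simp only [sub_self, zero_div, Real.rpow_zero, ENNReal.ofReal_one, one_mul] at h1
    exact h1
  have hV : (∑' k, w (b - a) k * V k) ^ 2 ≤ C * energy b v := h b (fourierCoeff v)
  calc energy b (u * v)
      = ∑' k, (w b k * ‖fourierCoeff (u * v : C(UnitAddCircle, ℂ)) k‖ₑ) ^ 2 := by
        simp only [energy, hw2, mul_pow]
    _ ≤ ∑' k, (c ^ 2 * 2) * ((∑' l, U l * (w b (k - l) * V (k - l))) ^ 2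
        + (∑' l, (w (b - a) l * V l) * (w a (k - l) * U (k - l))) ^ 2) := by
        refine ENNReal.tsum_le_tsum fun k => ?_
        refine (pow_le_pow_left' (hk k) 2).trans ?_
        rw [mul_pow, mul_assoc]
        gcongr
        exact ennreal_add_sq_le _ _
    _ ≤ (c ^ 2 * 2) * ((∑' k, U k) ^ 2 * energy b v
        + (∑' k, w (b - a) k * V k) ^ 2 * energy a u) := by
        rw [ENNReal.tsum_mul_left, ENNReal.tsum_add]
        gcongr
        · refine (ennreal_tsum_conv_sq_le U fun k => w b k * V k).trans_eq ?_
          simp only [energy, hw2, mul_pow, V]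
        · refine (ennreal_tsum_conv_sq_le (fun k => w (b - a) k * V k)
            fun k => w a k * U k).trans_eq ?_
          simp only [energy, hw2, mul_pow, U]
    _ ≤ (c ^ 2 * 2) * ((C * energy a u) * energy b v + (C * energy b v) * energy a u) := by
        gcongr
    _ = _ := by ring

/-! ### Reciprocals of Sobolev functions. -/

/-- This is `(1/h)' = -h'/h²`; the nesting `k * (k * h')` lets a product estimate with multiplier
`k` be applied twice. -/
theorem IsDerivC.inv {h h' k : C(UnitAddCircle, ℂ)} (hh : IsDerivC h h') (e : h * k = 1) :
    IsDerivC k (-(k * (k * h'))) := by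
  intro t
  have e1 (x : UnitAddCircle) : h x * k x = 1 := DFunLike.congr_fun e x
  have e2 (x : UnitAddCircle) : h x ≠ 0 := left_ne_zero_of_mul_eq_one (e1 x)
  have e3 (x : UnitAddCircle) : k x = (h x)⁻¹ := eq_inv_of_mul_eq_one_right (e1 x)
  have e4 : (fun t : ℝ => k t) = fun t : ℝ => (h t)⁻¹ := funext fun t => e3 t
  rw [e4]
  refine ((hh t).fun_inv (e2 t)).congr_deriv ?_
  simp only [ContinuousMap.neg_apply, ContinuousMap.mul_apply, e3]
  field_simp

theorem energy_neg (s : ℝ) (u : C(UnitAddCircle, ℂ)) : energy s (-u) = energy s u := by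
  have e : -u = (-1 : ℂ) • u := by
    ext x
    simp
  rw [e, energy_smul]
  simp

/-- If `h` is of class `Hᵃ`, `a > 3/2`, and `|1/h| ≤ B`, then `1/h` is of class `Hᵃ`. -/
theorem exists_energy_inv_le {a : ℝ} (ha : 3 / 2 < a) (B : ℝ) {M : ℝ≥0∞} (hM : M ≠ ⊤) :
    ∃ C : ℝ≥0∞, C ≠ ⊤ ∧ ∀ h k : C(UnitAddCircle, ℂ), h * k = 1 → (∀ x, ‖k x‖ ≤ B) →
      energy a h ≤ M → energy a k ≤ C := by
  set D := ENNReal.ofReal ((2 * Real.pi) ^ 2)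
  have hD : D ≠ ⊤ := ENNReal.ofReal_ne_top
  have hb (b : ℝ) (hba : b ≤ a) (h h' : C(UnitAddCircle, ℂ)) (hh : IsDerivC h h')
      (hE : energy a h ≤ M) : energy (b - 1) h' ≤ D * M := by
    refine (hh.energy_deriv_le (b - 1)).trans ?_
    gcongr
    refine le_trans (energy_mono ?_ h) hE
    linarith
  -- Bootstrap in steps of one order: control of `k` at order `b - 1` controls `k' = -k² h'` at
  -- order `b - 1`, hence `k` at order `b`. The start `b = 1` needs only the sup bound on `k`.
  suffices H : ∀ n : ℕ, ∀ b : ℝ, 1 ≤ b → b ≤ a → b ≤ n + 1 → ∃ C : ℝ≥0∞, C ≠ ⊤ ∧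
      ∀ h k : C(UnitAddCircle, ℂ), h * k = 1 → (∀ x, ‖k x‖ ≤ B) →
        energy a h ≤ M → energy b k ≤ C by
    obtain ⟨n, hn⟩ := exists_nat_ge a
    exact H n a (by linarith) le_rfl (by linarith)
  intro n
  induction n with
  | zero =>
    intro b hb1 hba hbn
    obtain rfl : b = 1 := le_antisymm (by simpa using hbn) hb1
    set E := ENNReal.ofReal (B ^ 2)
    refine ⟨E + E * (E * (D * M)), by finiteness, fun h k e hk hE => ?_⟩
    obtain ⟨h', hh⟩ := exists_isDerivC ha (ne_top_of_le_ne_top hM hE)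
    have h1 := (hh.inv e).energy_succ_le 0
    have h2 := hb 1 (by linarith) h h' hh hE
    rw [energy_neg, zero_add] at h1
    rw [sub_self] at h2
    refine h1.trans (add_le_add (energy_zero_le k hk) ?_)
    refine (energy_zero_mul_le k _ hk).trans ?_
    gcongr
    refine (energy_zero_mul_le k _ hk).trans ?_
    gcongr
  | succ n ih =>
    intro b hb1 hba hbn
    push_cast at hbn
    -- The multiplier order must exceed `1/2` and be at least `b - 1`; the lower cutoff 1 covers the
    -- range `b < 2`.
    have hc : max 1 (b - 1) ≤ n + 1 := max_le (by linarith [(Nat.cast_nonneg n : (0 : ℝ) ≤ n)]) (by linarith)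
    obtain ⟨C, hC, H⟩ := ih (max 1 (b - 1)) (le_max_left _ _) (max_le (by linarith) (by linarith)) hc
    have hlt : 1 / 2 < max 1 (b - 1) := lt_of_lt_of_le (by norm_num) (le_max_left _ _)
    obtain ⟨C', hC', H'⟩ := exists_energy_mul_le hlt (b := b - 1) (by linarith) (le_max_right _ _)
    refine ⟨C + C' * (C * (C' * (C * (D * M)))), by finiteness, fun h k e hk hE => ?_⟩
    obtain ⟨h', hh⟩ := exists_isDerivC ha (ne_top_of_le_ne_top hM hE)
    have h1 := (hh.inv e).energy_succ_le (b - 1)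
    have h2 := hb b hba h h' hh hE
    have h3 := H h k e hk hE
    have h4 := ne_top_of_le_ne_top hC h3
    rw [energy_neg, sub_add_cancel] at h1
    refine h1.trans (add_le_add ((energy_mono (le_max_right _ _) k).trans h3) ?_)
    refine (H' k _ h4).trans ?_
    gcongr
    refine (H' k _ h4).trans ?_
    gcongr

/-! ### Lifts of circle diffeomorphisms -/

/-- `φ(x) = x + f(x)` with `f` of class `C¹` with derivative `f'`, and `1 + f' > 0`. -/
structure IsLift (φ : UnitAddCircle ≃ₜ UnitAddCircle) (f f' : C(UnitAddCircle, ℝ)) : Prop where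
  apply_eq : ∀ x, φ x = x + (f x : UnitAddCircle)
  hasDerivAt : ∀ t : ℝ, HasDerivAt (fun t : ℝ => f t) (f' t) t
  pos : ∀ x, 0 < 1 + f' x

namespace IsLift

variable {φ : UnitAddCircle ≃ₜ UnitAddCircle} {f f' : C(UnitAddCircle, ℝ)}

theorem apply_coe (h : IsLift φ f f') (t : ℝ) : φ t = ((t + f t : ℝ) : UnitAddCircle) := by
  rw [h.apply_eq, AddCircle.coe_add]

theorem hasDerivAt_add (h : IsLift φ f f') (t : ℝ) :
    HasDerivAt (fun t : ℝ => t + f t) (1 + f' t) t := (hasDerivAt_id t).add (h.hasDerivAt t)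

theorem strictMono (h : IsLift φ f f') : StrictMono fun t : ℝ => t + f t := by
  apply strictMono_of_deriv_pos
  intro t
  rw [(h.hasDerivAt_add t).deriv]
  exact h.pos t

theorem surjective (_ : IsLift φ f f') : Function.Surjective fun t : ℝ => t + f t := by
  have hb (t : ℝ) : |f t| ≤ ‖f‖ := f.norm_coe_le_norm t
  have hc : Continuous fun t : ℝ => t + f t := continuous_id.add (continuous_coe_comp f)
  apply hc.surjective
  · refine Filter.tendsto_atTop_mono (fun t => ?_)
      (Filter.tendsto_atTop_add_const_right _ (-‖f‖) Filter.tendsto_id)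
    have := (abs_le.1 (hb t)).1
    simp only [id]
    linarith
  · refine Filter.tendsto_atBot_mono (fun t => ?_)
      (Filter.tendsto_atBot_add_const_right _ ‖f‖ Filter.tendsto_id)
    have := (abs_le.1 (hb t)).2
    simp only [id]
    linarith

/-- The lift of `φ` to the real line. -/
def homeo (h : IsLift φ f f') : ℝ ≃ₜ ℝ :=
  (StrictMono.orderIsoOfSurjective _ h.strictMono h.surjective).toHomeomorph

theorem homeo_apply (h : IsLift φ f f') (t : ℝ) : h.homeo t = t + f t := rfl

theorem symm_coe (h : IsLift φ f f') (s : ℝ) : φ.symm s = (h.homeo.symm s : ℝ) := by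
  rw [φ.symm_apply_eq, h.apply_coe, ← h.homeo_apply, h.homeo.apply_symm_apply]

theorem hasDerivAt_homeo_symm (h : IsLift φ f f') (s : ℝ) :
    HasDerivAt h.homeo.symm (1 + f' (h.homeo.symm s : ℝ))⁻¹ s :=
  HasDerivAt.of_local_left_inverse (f := h.homeo) h.homeo.symm.continuous.continuousAt
    (h.hasDerivAt_add _) (h.pos _).ne' (Filter.Eventually.of_forall h.homeo.apply_symm_apply)

/-- Substitute `s = t + f(t)` over one period; the endpoints are `f(0)` and `f(0) + 1`. -/
theorem energy_zero_eq (h : IsLift φ f f') (z : C(UnitAddCircle, ℂ)) :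
    energy 0 z = ENNReal.ofReal (∫ t in (0 : ℝ)..1, ‖z (φ t)‖ ^ 2 * (1 + f' t)) := by
  have h1 := intervalIntegral.integral_comp_mul_deriv (a := 0) (b := 1)
    (f := fun t : ℝ => t + f t) (f' := fun t : ℝ => 1 + f' t)
    (g := fun t : ℝ => ‖z t‖ ^ 2) (fun t _ => h.hasDerivAt_add t)
    (continuous_const.add (continuous_coe_comp f')).continuousOn
    ((continuous_coe_comp z).norm.pow 2)
  have h2 : (1 : ℝ) + f (1 : ℝ) = 0 + f (0 : ℝ) + 1 := by
    simp [AddCircle.coe_period, add_comm]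
  rw [energy_zero_eq_interval z (0 + f (0 : ℝ)), ← h2, ← h1]
  simp only [Function.comp_apply, h.apply_coe]

theorem isDerivC_comp (h : IsLift φ f f') {v v' a : C(UnitAddCircle, ℂ)} (hv : IsDerivC v v')
    (ha : ∀ x, a x = 1 + (f' x : ℂ)) :
    IsDerivC (v.comp φ) (a * v'.comp φ) := by
  intro t
  have h1 := (hv (t + f t)).scomp t (h.hasDerivAt_add t)
  have e : (fun t : ℝ => (v.comp φ : C(UnitAddCircle, ℂ)) t) = (fun t : ℝ => v t) ∘ fun t : ℝ => t + f t := by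
    ext t
    simp [h.apply_eq]
  rw [e]
  refine h1.congr_deriv ?_
  simp [h.apply_eq, ha]

theorem isDerivC_comp_symm (h : IsLift φ f f') {v v' k : C(UnitAddCircle, ℂ)} (hv : IsDerivC v v')
    (hk : ∀ x, k x = (1 + (f' x : ℂ))⁻¹) :
    IsDerivC (v.comp φ.symm) ((k * v').comp φ.symm) := by
  intro s
  have h1 := (hv (h.homeo.symm s)).scomp s (h.hasDerivAt_homeo_symm s)
  have e : (fun t : ℝ => (v.comp φ.symm : C(UnitAddCircle, ℂ)) t) = (fun t : ℝ => v t) ∘ h.homeo.symm := by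
    ext t
    simp [h.symm_coe]
  rw [e]
  refine h1.congr_deriv ?_
  simp [h.symm_coe, hk]

/-- Insert the Jacobian, using `1 ≤ B (1 + f')`, and change variables. The bound for `φ⁻¹` below is
the same argument with `1 + f' ≤ B`. -/
theorem energy_zero_comp_le (h : IsLift φ f f') {B : ℝ} (hB : ∀ x, (1 + f' x)⁻¹ ≤ B)
    (v : C(UnitAddCircle, ℂ)) : energy 0 (v.comp φ) ≤ ENNReal.ofReal B * energy 0 v := by
  have hB0 : 0 ≤ B := (inv_nonneg.2 (h.pos 0).le).trans (hB 0)
  rw [h.energy_zero_eq v, energy_zero_eq_interval _ 0, ← ENNReal.ofReal_mul hB0, zero_add,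
    ← intervalIntegral.integral_const_mul]
  have hc : Continuous fun t : ℝ => v (φ t) := continuous_coe_comp (v.comp φ)
  have hc' := continuous_coe_comp f'
  refine ENNReal.ofReal_le_ofReal (intervalIntegral.integral_mono (by norm_num)
    (Continuous.intervalIntegrable (by fun_prop) _ _)
    (Continuous.intervalIntegrable (by fun_prop) _ _) fun t => ?_)
  have h1 := hB t
  have h2 := h.pos t
  have h3 : 1 ≤ B * (1 + f' t) := by rwa [inv_le_iff_one_le_mul₀ h2] at h1
  change ‖v (φ t)‖ ^ 2 ≤ B * (‖v (φ t)‖ ^ 2 * (1 + f' t))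
  nlinarith [sq_nonneg ‖v (φ t)‖]

theorem energy_zero_comp_symm_le (h : IsLift φ f f') {B : ℝ} (hB : ∀ x, 1 + f' x ≤ B)
    (v : C(UnitAddCircle, ℂ)) : energy 0 (v.comp φ.symm) ≤ ENNReal.ofReal B * energy 0 v := by
  have hB0 : 0 ≤ B := (h.pos 0).le.trans (hB 0)
  rw [h.energy_zero_eq, energy_zero_eq_interval v 0, ← ENNReal.ofReal_mul hB0, zero_add,
    ← intervalIntegral.integral_const_mul]
  have hc : Continuous fun t : ℝ => v t := continuous_coe_comp v
  have hc' := continuous_coe_comp f'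
  have e (t : ℝ) : (v.comp φ.symm) (φ t) = v t := by simp
  simp only [e]
  refine ENNReal.ofReal_le_ofReal (intervalIntegral.integral_mono (by norm_num)
    (Continuous.intervalIntegrable (by fun_prop) _ _)
    (Continuous.intervalIntegrable (by fun_prop) _ _) fun t => ?_)
  dsimp only
  rw [mul_comm]
  have := hB t
  gcongr

end IsLift

/-- Quantitative bounds for a circle diffeomorphism of class `H^q`: `a = φ'`, `k = 1/φ'`. -/
structure DiffeoBounds (q B : ℝ) (M : ℝ≥0∞) (φ : UnitAddCircle ≃ₜ UnitAddCircle)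
    (a k : C(UnitAddCircle, ℂ)) : Prop where
  isDerivC_comp : ∀ v v', IsDerivC v v' → IsDerivC (v.comp φ) (a * v'.comp φ)
  isDerivC_comp_symm : ∀ v v', IsDerivC v v' → IsDerivC (v.comp φ.symm) ((k * v').comp φ.symm)
  energy_zero_comp_le : ∀ v, energy 0 (v.comp φ) ≤ ENNReal.ofReal B * energy 0 v
  energy_zero_comp_symm_le : ∀ v, energy 0 (v.comp φ.symm) ≤ ENNReal.ofReal B * energy 0 v
  energy_le : energy (q - 1) a ≤ M
  energy_inv_le : energy (q - 1) k ≤ M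

/-! ### Trigonometric polynomials -/

/-- The trigonometric polynomial with frequencies in `S` and coefficients `c`. -/
def trigPoly (S : Finset ℤ) (c : ℤ → ℂ) : C(UnitAddCircle, ℂ) := ∑ k ∈ S, c k • fourier k

theorem fourierCoeff_trigPoly (S : Finset ℤ) (c : ℤ → ℂ) (k : ℤ) :
    fourierCoeff (trigPoly S c) k = if k ∈ S then c k else 0 := by
  rw [← fourierCoeffCLM_apply, trigPoly, map_sum]
  simp only [map_smul, fourierCoeffCLM_apply, fourierCoeff_fourier, smul_eq_mul, Pi.single_apply,
    mul_ite, mul_one, mul_zero]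
  exact Finset.sum_ite_eq S k c

theorem isDerivC_trigPoly (S : Finset ℤ) (c : ℤ → ℂ) :
    IsDerivC (trigPoly S c) (trigPoly S fun k => c k * (2 * Real.pi * Complex.I * k)) := by
  intro t
  have h (k : ℤ) := (hasDerivAt_fourier 1 k t).const_smul (c k)
  have h1 := HasDerivAt.fun_sum (u := S) fun k _ => h k
  have e : (fun t : ℝ => trigPoly S c t) = fun t : ℝ => ∑ k ∈ S, c k • fourier k (t : UnitAddCircle) := by
    ext t
    simp [trigPoly, ContinuousMap.sum_apply]
  rw [e]
  refine h1.congr_deriv ?_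
  simp [trigPoly, ContinuousMap.sum_apply, mul_assoc]

theorem energy_trigPoly_le (s : ℝ) (S : Finset ℤ) (u : C(UnitAddCircle, ℂ)) :
    energy s (trigPoly S (fourierCoeff u)) ≤ energy s u := by
  refine ENNReal.tsum_le_tsum fun k => ?_
  rw [fourierCoeff_trigPoly]
  gcongr
  split_ifs <;> simp

theorem tendsto_trigPoly {a : ℝ} (ha : 1 / 2 < a) {u : C(UnitAddCircle, ℂ)}
    (hu : energy a u ≠ ⊤) :
    Filter.Tendsto (fun S => trigPoly S (fourierCoeff u)) Filter.atTop (nhds u) :=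
  hasSum_fourier ha hu

/-! ### Interpolation -/

/-- Scaling `l ↦ l / W` extracts `W ^ τ`. The remaining integral converges at 0 because `τ < 1` and
at infinity because `τ > 0`. It represents an intermediate power as an average of quantities that
interpolation can treat one at a time; the constant, being neither 0 nor infinite, can be cancelled.
-/
theorem exists_lintegral_min {τ : ℝ} (h0 : 0 < τ) (h1 : τ < 1) : ∃ c : ℝ≥0∞, c ≠ 0 ∧ c ≠ ⊤ ∧
    ∀ W : ℝ, 0 < W → ∫⁻ l in Set.Ioi (0 : ℝ), ENNReal.ofReal (l ^ (-τ - 1)) *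
      ENNReal.ofReal (min 1 (l * W)) = c * ENNReal.ofReal (W ^ τ) := by
  set g : ℝ → ℝ := fun l => l ^ (-τ - 1) * min 1 l with hg
  have hint : IntegrableOn g (Set.Ioi 0) := by
    rw [← Set.Ioc_union_Ioi_eq_Ioi (zero_le_one' ℝ)]
    refine IntegrableOn.union ?_ ?_
    · have h2 : IntegrableOn (fun l : ℝ => l ^ (-τ)) (Set.Ioc 0 1) := by
        have := intervalIntegral.intervalIntegrable_rpow' (a := 0) (b := 1) (r := -τ) (by linarith)
        rwa [intervalIntegrable_iff_integrableOn_Ioc_of_le zero_le_one] at this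
      refine h2.congr_fun (fun l hl => ?_) measurableSet_Ioc
      simp only [hg]
      rw [min_eq_right hl.2, ← Real.rpow_add_one hl.1.ne']
      simp
    · refine (integrableOn_Ioi_rpow_of_lt (a := -τ - 1) (by linarith) one_pos).congr_fun
        (fun l hl => ?_) measurableSet_Ioi
      simp only [hg]
      rw [min_eq_left (le_of_lt hl), mul_one]
  have hpos : 0 < ∫ l in Set.Ioi (0 : ℝ), g l := by
    rw [setIntegral_pos_iff_support_of_nonneg_ae]
    · refine lt_of_lt_of_le ?_ (measure_mono (s := Set.Ioi (0 : ℝ)) fun l hl => ⟨?_, hl⟩)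
      · simp
      · have : 0 < l := hl
        simp only [hg, Function.mem_support]
        positivity
    · refine (ae_restrict_iff' measurableSet_Ioi).2 (Filter.Eventually.of_forall fun l hl => ?_)
      have : 0 < l := hl
      simp only [hg, Pi.zero_apply]
      positivity
    · exact hint
  refine ⟨ENNReal.ofReal (∫ l in Set.Ioi (0 : ℝ), g l), by simpa using hpos, by finiteness,
    fun W hW => ?_⟩
  have h2 : ∫ l in Set.Ioi (0 : ℝ), g (W * l) = W⁻¹ * ∫ l in Set.Ioi (0 : ℝ), g l := by
    have := integral_comp_mul_left_Ioi g 0 hW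
    rwa [mul_zero, smul_eq_mul] at this
  have h3 : IntegrableOn (fun l => g (W * l)) (Set.Ioi 0) := by
    have := (integrableOn_Ioi_comp_mul_left_iff g 0 hW).2
    rw [mul_zero] at this
    exact this hint
  calc ∫⁻ l in Set.Ioi (0 : ℝ), ENNReal.ofReal (l ^ (-τ - 1)) * ENNReal.ofReal (min 1 (l * W))
      = ∫⁻ l in Set.Ioi (0 : ℝ), ENNReal.ofReal (W ^ (τ + 1)) * ENNReal.ofReal (g (W * l)) := by
        refine setLIntegral_congr_fun measurableSet_Ioi fun l hl => ?_
        have hl : 0 < l := hl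
        rw [← ENNReal.ofReal_mul (by positivity), ← ENNReal.ofReal_mul (by positivity)]
        congr 1
        simp only [hg]
        rw [Real.mul_rpow hW.le hl.le, ← mul_assoc, ← mul_assoc, ← Real.rpow_add hW]
        simp [mul_comm]
    _ = ENNReal.ofReal (W ^ (τ + 1)) * ENNReal.ofReal (W⁻¹ * ∫ l in Set.Ioi (0 : ℝ), g l) := by
        rw [lintegral_const_mul' _ _ (by finiteness), ← h2,
          ofReal_integral_eq_lintegral_ofReal h3]
        refine (ae_restrict_iff' measurableSet_Ioi).2 (Filter.Eventually.of_forall fun l hl => ?_)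
        have : 0 < l := hl
        simp only [hg, Pi.zero_apply]
        positivity
    _ = _ := by
        rw [← ENNReal.ofReal_mul (by positivity), ← ENNReal.ofReal_mul (by positivity)]
        congr 1
        rw [Real.rpow_add hW, Real.rpow_one]
        field_simp

/-- Interpolation between `L²` and `H²`. -/
theorem energy_interpolation {s : ℝ} (h0 : 0 < s) (h2 : s < 2)
    (A : C(UnitAddCircle, ℂ) →+ C(UnitAddCircle, ℂ)) {C : ℝ≥0∞} (hC : C ≠ ⊤)
    (hA0 : ∀ S c, energy 0 (A (trigPoly S c)) ≤ C * energy 0 (trigPoly S c))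
    (hA2 : ∀ S c, energy 2 (A (trigPoly S c)) ≤ C * energy 2 (trigPoly S c))
    (S : Finset ℤ) (c : ℤ → ℂ) :
    energy s (A (trigPoly S c)) ≤ 4 * C * energy s (trigPoly S c) := by
  obtain ⟨d, hd0, hdt, hd⟩ := exists_lintegral_min (τ := s / 2) (by linarith) (by linarith)
  -- A Fourier-side form of the quadratic K-functional of the couple `(L², H²)`. The averaged weight
  -- is `((1 + k²)²)^(s/2) = (1 + k²)ˢ`.
  let K (l : ℝ) (u : C(UnitAddCircle, ℂ)) : ℝ≥0∞ :=
    ∑' k : ℤ, ENNReal.ofReal (min 1 (l * (1 + (k : ℝ) ^ 2) ^ (2 : ℝ))) * ‖fourierCoeff u k‖ₑ ^ 2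
  have hK (u : C(UnitAddCircle, ℂ)) : d * energy s u
      = ∫⁻ l in Set.Ioi (0 : ℝ), ENNReal.ofReal (l ^ (-(s / 2) - 1)) * K l u := by
    simp only [K, energy]
    simp_rw [← ENNReal.tsum_mul_left, ← mul_assoc]
    rw [lintegral_tsum]
    · refine tsum_congr fun k => ?_
      rw [lintegral_mul_const' _ _ (by finiteness), hd _ (by positivity),
        ← Real.rpow_mul (by positivity)]
      congr 5
      ring
    · intro k
      fun_prop
  have hadd (l : ℝ) (u v : C(UnitAddCircle, ℂ)) : K l (u + v) ≤ 2 * (K l u + K l v) := by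
    simp only [K]
    rw [← ENNReal.tsum_add, ← ENNReal.tsum_mul_left]
    refine ENNReal.tsum_le_tsum fun k => ?_
    rw [fourierCoeff_add_circle, ← mul_add, mul_left_comm]
    gcongr
    refine le_trans ?_ (ennreal_add_sq_le _ _)
    gcongr
    exact enorm_add_le _ _
  have hK0 (l : ℝ) (u : C(UnitAddCircle, ℂ)) : K l u ≤ energy 0 u := by
    refine ENNReal.tsum_le_tsum fun k => ?_
    gcongr
    rw [Real.rpow_zero]
    exact min_le_left _ _
  have hK2 (l : ℝ) (hl : 0 < l) (u : C(UnitAddCircle, ℂ)) : K l u ≤ ENNReal.ofReal l * energy 2 u := by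
    simp only [K, energy]
    rw [← ENNReal.tsum_mul_left]
    refine ENNReal.tsum_le_tsum fun k => ?_
    rw [← mul_assoc, ← ENNReal.ofReal_mul hl.le]
    gcongr
    exact min_le_right _ _
  -- Split the frequencies according to whether `l (1 + k²)² ≤ 1`: the low part is estimated in
  -- `H²`, the high part in `L²`, and each is bounded by `K l`. Both parts are again trigonometric
  -- polynomials. The factor 4 comes from the squared triangle inequality and the two parts.
  have key (l : ℝ) (hl : 0 < l) : K l (A (trigPoly S c)) ≤ 4 * C * K l (trigPoly S c) := by
    set p : ℤ → Prop := fun k => l * (1 + (k : ℝ) ^ 2) ^ (2 : ℝ) ≤ 1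
    classical
    have e : trigPoly S c = trigPoly (S.filter p) c + trigPoly (S.filter fun k => ¬ p k) c :=
      (Finset.sum_filter_add_sum_filter_not S p _).symm
    have e1 : ENNReal.ofReal l * energy 2 (trigPoly (S.filter p) c) ≤ K l (trigPoly S c) := by
      simp only [K, energy]
      rw [← ENNReal.tsum_mul_left]
      refine ENNReal.tsum_le_tsum fun k => ?_
      simp only [fourierCoeff_trigPoly, Finset.mem_filter]
      rw [← mul_assoc, ← ENNReal.ofReal_mul hl.le]
      by_cases hp : p k
      · rw [min_eq_right hp]
        simp [hp]
      · simp [hp]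
    have e2 : energy 0 (trigPoly (S.filter fun k => ¬ p k) c) ≤ K l (trigPoly S c) := by
      refine ENNReal.tsum_le_tsum fun k => ?_
      simp only [fourierCoeff_trigPoly, Finset.mem_filter]
      by_cases hp : p k
      · simp [hp]
      · rw [min_eq_left (le_of_not_ge hp)]
        simp [hp]
    calc K l (A (trigPoly S c))
        ≤ 2 * (K l (A (trigPoly (S.filter p) c))
          + K l (A (trigPoly (S.filter fun k => ¬ p k) c))) := by
          rw [e, map_add]
          exact hadd _ _ _
      _ ≤ 2 * (ENNReal.ofReal l * (C * energy 2 (trigPoly (S.filter p) c))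
          + C * energy 0 (trigPoly (S.filter fun k => ¬ p k) c)) := by
          gcongr
          · refine (hK2 l hl _).trans ?_
            gcongr
            exact hA2 _ _
          · exact (hK0 l _).trans (hA0 _ _)
      _ = 2 * C * (ENNReal.ofReal l * energy 2 (trigPoly (S.filter p) c)
          + energy 0 (trigPoly (S.filter fun k => ¬ p k) c)) := by ring
      _ ≤ 2 * C * (K l (trigPoly S c) + K l (trigPoly S c)) := by gcongr
      _ = _ := by ring
  -- Integrating the bound over `l` and cancelling `d` returns to the energies of order `s`.
  refine (ENNReal.mul_le_mul_iff_right hd0 hdt).1 ?_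
  rw [mul_left_comm, hK, hK, ← lintegral_const_mul' _ _ (by finiteness)]
  refine setLIntegral_mono' measurableSet_Ioi fun l hl => ?_
  rw [mul_left_comm]
  gcongr
  exact key l hl

/-! ### Composition with circle diffeomorphisms -/

namespace DiffeoBounds

variable {q B : ℝ} {M : ℝ≥0∞} {φ : UnitAddCircle ≃ₜ UnitAddCircle} {a k : C(UnitAddCircle, ℂ)}

/-- From order `s` to order `s + 1`. -/
theorem exists_energy_succ_le {s : ℝ} (hq : 5 / 2 < q) (hs : 0 ≤ s) (hsq : s + 1 ≤ q) (hM : M ≠ ⊤)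
    {C : ℝ≥0∞} (hC : C ≠ ⊤) :
    ∃ C' : ℝ≥0∞, C' ≠ ⊤ ∧ ∀ {φ a k}, DiffeoBounds q B M φ a k → ∀ v v', IsDerivC v v' →
      (energy s (v.comp φ) ≤ C * energy s v → energy s (v'.comp φ) ≤ C * energy s v' →
        energy (s + 1) (v.comp φ) ≤ C' * energy (s + 1) v) ∧
      (energy s (v.comp φ.symm) ≤ C * energy s v →
        energy s ((k * v').comp φ.symm) ≤ C * energy s (k * v') →
        energy (s + 1) (v.comp φ.symm) ≤ C' * energy (s + 1) v) := by
  -- The factors `φ'` and `1/φ'` are in `H^(q-1)`, so they multiply `Hˢ` as long as `s ≤ q - 1`.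
  obtain ⟨m, hm, hmul⟩ := exists_energy_mul_le (a := q - 1) (b := s) (by linarith) hs (by linarith)
  set D := ENNReal.ofReal ((2 * Real.pi) ^ 2)
  have hD : D ≠ ⊤ := ENNReal.ofReal_ne_top
  refine ⟨C + m * (M * (C * D)), by finiteness, fun {φ a k} h v v' hv => ⟨fun h1 h2 => ?_, fun h1 h2 => ?_⟩⟩
  · refine ((h.isDerivC_comp v v' hv).energy_succ_le s).trans ?_
    rw [add_mul]
    refine add_le_add (h1.trans (mul_le_mul_right (energy_mono (by linarith) v) _)) ?_
    refine (hmul _ _ (ne_top_of_le_ne_top hM h.energy_le)).trans ?_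
    simp only [mul_assoc]
    gcongr
    · exact h.energy_le
    · refine h2.trans ?_
      gcongr
      exact hv.energy_deriv_le s
  -- For the inverse the multiplication precedes the composition: `(v ∘ φ⁻¹)' = (k v') ∘ φ⁻¹`. Thus
  -- the order `s` bound is needed for `k v'`, not for `v'`.
  · refine ((h.isDerivC_comp_symm v v' hv).energy_succ_le s).trans ?_
    rw [add_mul]
    refine add_le_add (h1.trans (mul_le_mul_right (energy_mono (by linarith) v) _)) ?_
    refine h2.trans ?_
    have h3 := (hmul _ v' (ne_top_of_le_ne_top hM h.energy_inv_le))
    calc C * energy s (k * v') ≤ C * (m * (M * (D * energy (s + 1) v))) := by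
          gcongr
          refine h3.trans ?_
          gcongr
          · exact h.energy_inv_le
          · exact hv.energy_deriv_le s
      _ = _ := by ring

theorem exists_energy_one_le (hq : 5 / 2 < q) (hM : M ≠ ⊤) :
    ∃ C : ℝ≥0∞, C ≠ ⊤ ∧ ∀ {φ a k}, DiffeoBounds q B M φ a k → ∀ v v', IsDerivC v v' →
      energy 1 (v.comp φ) ≤ C * energy 1 v ∧ energy 1 (v.comp φ.symm) ≤ C * energy 1 v := by
  obtain ⟨C, hC, h⟩ := exists_energy_succ_le (B := B) (s := 0) hq le_rfl (by linarith) hM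
    (C := ENNReal.ofReal B) (by finiteness)
  rw [zero_add] at h
  refine ⟨C, hC, fun {φ a k} hφ v v' hv => ⟨?_, ?_⟩⟩
  · exact (h hφ v v' hv).1 (hφ.energy_zero_comp_le v) (hφ.energy_zero_comp_le v')
  · exact (h hφ v v' hv).2 (hφ.energy_zero_comp_symm_le v) (hφ.energy_zero_comp_symm_le _)

theorem exists_energy_two_le (hq : 5 / 2 < q) (hM : M ≠ ⊤) :
    ∃ C : ℝ≥0∞, C ≠ ⊤ ∧ ∀ {φ a k}, DiffeoBounds q B M φ a k →
      ∀ v v' v'', IsDerivC v v' → IsDerivC v' v'' →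
      energy 2 (v.comp φ) ≤ C * energy 2 v ∧ energy 2 (v.comp φ.symm) ≤ C * energy 2 v := by
  obtain ⟨C₁, hC₁, h₁⟩ := exists_energy_one_le (B := B) hq hM
  obtain ⟨C, hC, h⟩ := exists_energy_succ_le (B := B) (s := 1) hq zero_le_one (by linarith) hM hC₁
  norm_num at h
  refine ⟨C, hC, fun {φ a k} hφ v v' v'' hv hv' => ⟨?_, ?_⟩⟩
  · exact (h hφ v v' hv).1 (h₁ hφ v v' hv).1 (h₁ hφ v' v'' hv').1
  -- A second derivative of `v ∘ φ⁻¹` requires `k` itself to be differentiable, which `q - 1 > 3/2`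
  -- provides.
  · obtain ⟨k', hk'⟩ := exists_isDerivC (s := q - 1) (by linarith)
      (ne_top_of_le_ne_top hM hφ.energy_inv_le)
    exact (h hφ v v' hv).2 (h₁ hφ v v' hv).2 (h₁ hφ _ _ (hk'.mul hv')).2

/-- Composition with `χ`, as an additive map. -/
def compAddHom (χ : C(UnitAddCircle, UnitAddCircle)) : C(UnitAddCircle, ℂ) →+ C(UnitAddCircle, ℂ) where
  toFun v := v.comp χ
  map_zero' := rfl
  map_add' _ _ := rfl

/-- Fourier truncations converge uniformly, also after composition, and the energy is lower
semicontinuous. -/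
theorem energy_comp_le_of_trigPoly {s : ℝ} (hs : 1 / 2 < s) (χ : C(UnitAddCircle, UnitAddCircle))
    {C : ℝ≥0∞} (h : ∀ S c, energy s ((trigPoly S c).comp χ) ≤ C * energy s (trigPoly S c))
    {v : C(UnitAddCircle, ℂ)} (hv : energy s v ≠ ⊤) : energy s (v.comp χ) ≤ C * energy s v := by
  have h1 : Filter.Tendsto (fun S => (trigPoly S (fourierCoeff v)).comp χ) Filter.atTop
      (nhds (v.comp χ)) :=
    ((ContinuousMap.continuous_precomp χ).tendsto v).comp (tendsto_trigPoly hs hv)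
  refine energy_le_of_tendsto h1 fun S => (h _ _).trans ?_
  gcongr
  exact energy_trigPoly_le _ _ _

/-- Interpolate between orders 0 and 2 on trigonometric polynomials, which have all the derivatives
the order 2 bound asks for, and pass to the limit. -/
theorem exists_energy_comp_le_of_le_two {s : ℝ} (hq : 5 / 2 < q) (hs : 1 / 2 < s) (hs2 : s ≤ 2)
    (hM : M ≠ ⊤) : ∃ C : ℝ≥0∞, C ≠ ⊤ ∧ ∀ {φ a k}, DiffeoBounds q B M φ a k → ∀ v,
      energy s v ≠ ⊤ →
      energy s (v.comp φ) ≤ C * energy s v ∧ energy s (v.comp φ.symm) ≤ C * energy s v := by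
  obtain ⟨C, hC, h⟩ := exists_energy_two_le (B := B) hq hM
  refine ⟨4 * (C + ENNReal.ofReal B), by finiteness, fun {φ a k} hφ v hv => ?_⟩
  suffices H : ∀ χ : C(UnitAddCircle, UnitAddCircle),
      (∀ v, energy 0 (v.comp χ) ≤ ENNReal.ofReal B * energy 0 v) →
      (∀ v v' v'', IsDerivC v v' → IsDerivC v' v'' → energy 2 (v.comp χ) ≤ C * energy 2 v) →
      energy s (v.comp χ) ≤ 4 * (C + ENNReal.ofReal B) * energy s v from
    ⟨H φ hφ.energy_zero_comp_le fun v v' v'' h1 h2 => (h hφ v v' v'' h1 h2).1,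
      H φ.symm hφ.energy_zero_comp_symm_le fun v v' v'' h1 h2 => (h hφ v v' v'' h1 h2).2⟩
  intro χ h0 h2
  refine energy_comp_le_of_trigPoly hs χ (fun S c => ?_) hv
  have h2' (S c) : energy 2 ((trigPoly S c).comp χ)
      ≤ (C + ENNReal.ofReal B) * energy 2 (trigPoly S c) := by
    refine (h2 _ _ _ (isDerivC_trigPoly S c) (isDerivC_trigPoly S _)).trans ?_
    gcongr
    exact le_self_add
  rcases hs2.lt_or_eq with hlt | rfl
  · refine energy_interpolation (by linarith) hlt (compAddHom χ) (by finiteness) (fun S c => ?_) h2' S c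
    refine (h0 _).trans ?_
    gcongr
    exact le_add_self
  · refine (h2' S c).trans ?_
    gcongr
    exact le_mul_of_one_le_left zero_le (by norm_num)

/-- Composition with `φ` and with `φ⁻¹` is bounded on `Hˢ`, `1/2 < s ≤ q`, for `φ` of class
`H^q`, with a bound that depends only on the bounds for `φ`. -/
theorem exists_energy_comp_le {s : ℝ} (hq : 5 / 2 < q) (hs : 1 / 2 < s) (hsq : s ≤ q)
    (hM : M ≠ ⊤) : ∃ C : ℝ≥0∞, C ≠ ⊤ ∧ ∀ {φ a k}, DiffeoBounds q B M φ a k → ∀ v,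
      energy s v ≠ ⊤ →
      energy s (v.comp φ) ≤ C * energy s v ∧ energy s (v.comp φ.symm) ≤ C * energy s v := by
  -- Induction on an integer above `s`. Orders up to 2 come from interpolation; for `s > 2` the
  -- chain rule reduces to `s - 1`, which still exceeds `1/2`.
  obtain ⟨n, hn⟩ := exists_nat_ge s
  induction n generalizing s with
  | zero => exact exists_energy_comp_le_of_le_two hq hs (by norm_num at hn; linarith) hM
  | succ n ih =>
    rcases le_or_gt s 2 with h2 | h2
    · exact exists_energy_comp_le_of_le_two hq hs h2 hM
    push_cast at hn
    obtain ⟨C, hC, h⟩ := ih (s := s - 1) (by linarith) (by linarith) (by linarith)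
    obtain ⟨C', hC', h'⟩ := exists_energy_succ_le (B := B) (s := s - 1) hq (by linarith)
      (by linarith) hM hC
    obtain ⟨m, hm, hmul⟩ := exists_energy_mul_le (a := q - 1) (b := s - 1) (by linarith)
      (by linarith) (by linarith)
    rw [sub_add_cancel] at h'
    refine ⟨C', hC', fun {φ a k} hφ v hv => ?_⟩
    obtain ⟨v', hv'⟩ := exists_isDerivC (by linarith) hv
    have h0 : energy (s - 1) v ≠ ⊤ := ne_top_of_le_ne_top hv (energy_mono (by linarith) v)
    have h1 : energy (s - 1) v' ≠ ⊤ := by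
      have := hv'.energy_deriv_le (s - 1)
      rw [sub_add_cancel] at this
      exact ne_top_of_le_ne_top (by finiteness) this
    have h3 : energy (s - 1) (k * v') ≠ ⊤ := by
      have h4 := ne_top_of_le_ne_top hM hφ.energy_inv_le
      exact ne_top_of_le_ne_top (by finiteness) (hmul k v' h4)
    exact ⟨(h' hφ v v' hv').1 (h hφ v h0).1 (h hφ v' h1).1,
      (h' hφ v v' hv').2 (h hφ v h0).2 (h hφ _ h3).2⟩

end DiffeoBounds

/-! ### Local bounds on the group of Sobolev diffeomorphisms -/

theorem SobolevC.toFun_energy_ne_top {s : ℝ} (f : SobolevC s) : energy s f.toFun ≠ ⊤ :=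
  energy_ne_top_iff.2 f.memSobolev

/-- The function of class `Hˢ` given by a continuous function of finite energy. -/
def SobolevC.mk {s : ℝ} (u : C(UnitAddCircle, ℂ)) (hu : energy s u ≠ ⊤) : SobolevC s :=
  ⟨u, energy_ne_top_iff.1 hu⟩

@[simp] theorem SobolevC.mk_apply {s : ℝ} (u : C(UnitAddCircle, ℂ)) (hu : energy s u ≠ ⊤)
    (x : UnitAddCircle) : SobolevC.mk u hu x = u x := rfl

theorem SobolevR.exists_isDeriv {q : ℝ} (hq : 3 / 2 < q) (f : SobolevR q) :
    ∃ f' : C(UnitAddCircle, ℝ), (∀ t : ℝ, HasDerivAt (fun t : ℝ => f t) (f' t) t) ∧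
      ∃ g' : C(UnitAddCircle, ℂ), (∀ x, g' x = f' x) ∧ IsDerivC f.toComplex.toFun g' := by
  obtain ⟨g', hg⟩ := exists_isDerivC hq f.toComplex.toFun_energy_ne_top
  have hd (t : ℝ) : HasDerivAt (fun t : ℝ => f t) (g' t).re t := by
    have := Complex.reCLM.hasFDerivAt.comp_hasDerivAt t (hg t)
    simpa [Function.comp_def] using this
  refine ⟨⟨fun x => (g' x).re, by fun_prop⟩, hd, g', fun x => ?_, hg⟩
  induction x using QuotientAddGroup.induction_on with | H t => ?_
  exact (hg t).unique (hd t).ofReal_comp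

namespace SobolevDiff

variable {q : ℝ}

/-- A Sobolev diffeomorphism, as a homeomorphism. -/
def homeo (φ : SobolevDiff q) : UnitAddCircle ≃ₜ UnitAddCircle :=
  Continuous.homeoOfEquivCompactToT2 (f := φ.toEquiv) (by
    obtain ⟨f, -, h⟩ := φ.exists_lift
    have e : (φ.toEquiv : UnitAddCircle → UnitAddCircle) = fun x => x + (f x : UnitAddCircle) :=
      funext h
    rw [e]
    exact continuous_id.add ((AddCircle.continuous_mk' 1).comp f.toFun.continuous))

variable [Fact (3 / 2 < q)]

theorem isLift_homeo {f : SobolevR q} (hf : f ∈ diffeoLifts q) {f' : C(UnitAddCircle, ℝ)}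
    (hf' : ∀ t : ℝ, HasDerivAt (fun t : ℝ => f t) (f' t) t) :
    IsLift (ofLift f).homeo f.toFun f' where
  apply_eq x := ofLift_apply hf x
  hasDerivAt := hf'
  pos x := by
    induction x using QuotientAddGroup.induction_on with | H t => ?_
    have := hf t
    rwa [(hf' t).deriv] at this

/-- Near every diffeomorphism there are uniform bounds. -/
theorem exists_diffeoBounds {f₀ : SobolevR q} (hf₀ : f₀ ∈ diffeoLifts q) (hq : 5 / 2 < q) :
    ∃ ε > 0, ∃ B : ℝ, ∃ M : ℝ≥0∞, M ≠ ⊤ ∧ ∀ f ∈ Metric.ball f₀ ε, f ∈ diffeoLifts q ∧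
      ∃ a k, DiffeoBounds q B M (ofLift f).homeo a k := by
  have hq' : 3 / 2 < q := Fact.out
  obtain ⟨K, hK, h⟩ := SobolevR.exists_C1 hq'
  obtain ⟨ε₁, hε₁, hball⟩ := Metric.isOpen_iff.1 (isOpen_diffeoLifts hq') f₀ hf₀
  obtain ⟨f₀', hf₀', -⟩ := f₀.exists_isDeriv hq'
  have hL₀ := isLift_homeo hf₀ hf₀'
  obtain ⟨x₀, -, hx₀⟩ := isCompact_univ.exists_isMinOn (Set.univ_nonempty (α := UnitAddCircle))
    f₀'.continuous.continuousOn
  set m := 1 + f₀' x₀ with hm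
  have hm0 : 0 < m := hL₀.pos x₀
  -- Here `m` is the minimum of `φ₀'`. The second radius keeps the derivative within `m / 2` of
  -- `φ₀'`, so that `φ' ≥ m / 2` on the ball; `K + 1` avoids a zero denominator.
  set ε := min ε₁ (m / (2 * (K + 1)))
  have hε : 0 < ε := lt_min hε₁ (by positivity)
  have hKε : K * ε ≤ m / 2 := by
    calc K * ε ≤ (K + 1) * (m / (2 * (K + 1))) := by
          gcongr
          · linarith
          · exact min_le_right _ _
      _ = m / 2 := by field_simp
  -- The first entry bounds `1/φ'`, the second `φ'`. Next, `A` bounds the energy of `φ' = 1 + f'`.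
  set B := max (2 / m) (1 + K * (‖f₀‖ + ε))
  set A := 2 * (energy (q - 1) 1
    + ENNReal.ofReal ((2 * Real.pi) ^ 2) * ENNReal.ofReal ((‖f₀‖ + ε) ^ 2))
  have h1 : energy (q - 1) (1 : C(UnitAddCircle, ℂ)) ≠ ⊤ :=
    energy_ne_top_iff.2 (SmoothC.memSobolev (q - 1) 1)
  have hA : A ≠ ⊤ := by finiteness
  obtain ⟨C, hC, hinv⟩ := exists_energy_inv_le (a := q - 1) (by linarith) B hA
  refine ⟨ε, hε, B, max A C, by simp [hA, hC], fun f hf => ?_⟩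
  have hfm : f ∈ diffeoLifts q := hball (Metric.ball_subset_ball (min_le_left _ _) hf)
  refine ⟨hfm, ?_⟩
  obtain ⟨f', hf', g', hg', hg⟩ := f.exists_isDeriv hq'
  have hL := isLift_homeo hfm hf'
  rw [Metric.mem_ball, dist_eq_norm] at hf
  have hfn : ‖f‖ ≤ ‖f₀‖ + ε := by
    have : ‖f‖ ≤ ‖f₀‖ + ‖f - f₀‖ := norm_le_norm_add_norm_sub' f f₀
    linarith
  have hlow (x : UnitAddCircle) : m / 2 ≤ 1 + f' x := by
    induction x using QuotientAddGroup.induction_on with | H t => ?_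
    have h2 := (abs_le.1 ((h (f - f₀)).2.2.2 t)).1
    have e : deriv (fun t : ℝ => (f - f₀) t) t = f' t - f₀' t := by
      have : (fun t : ℝ => (f - f₀) t) = (fun t : ℝ => f t) - fun t : ℝ => f₀ t := by
        ext t
        simp
      rw [this]
      exact ((hf' t).sub (hf₀' t)).deriv
    rw [e] at h2
    have h3 : f₀' x₀ ≤ f₀' t := hx₀ (Set.mem_univ _)
    have h4 : K * ‖f - f₀‖ ≤ K * ε := by gcongr
    change m / 2 ≤ 1 + f' t
    linarith
  have hup (x : UnitAddCircle) : 1 + f' x ≤ B := by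
    induction x using QuotientAddGroup.induction_on with | H t => ?_
    have h2 := (abs_le.1 ((h f).2.2.2 t)).2
    rw [(hf' t).deriv] at h2
    refine le_trans ?_ (le_max_right _ _)
    have h4 : K * ‖f‖ ≤ K * (‖f₀‖ + ε) := by gcongr
    change 1 + f' t ≤ _
    linarith
  have hinvB (x : UnitAddCircle) : (1 + f' x)⁻¹ ≤ B := by
    refine le_trans ?_ (le_max_left _ _)
    rw [← inv_div]
    exact inv_anti₀ (by positivity) (hlow x)
  set a : C(UnitAddCircle, ℂ) := 1 + g' with ha
  have ha' (x : UnitAddCircle) : a x = 1 + (f' x : ℂ) := by simp [ha, hg']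
  have ha0 (x : UnitAddCircle) : a x ≠ 0 := by
    rw [ha']
    exact_mod_cast (hL.pos x).ne'
  set k : C(UnitAddCircle, ℂ) := ⟨fun x => (a x)⁻¹, a.continuous.inv₀ ha0⟩ with hk
  have hk' (x : UnitAddCircle) : k x = (1 + (f' x : ℂ))⁻¹ := by simp [hk, ha']
  have hkB (x : UnitAddCircle) : ‖k x‖ ≤ B := by
    have e : k x = (((1 + f' x)⁻¹ : ℝ) : ℂ) := by rw [hk']; push_cast; rfl
    rw [e, Complex.norm_real, Real.norm_of_nonneg (inv_nonneg.2 (hL.pos x).le)]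
    exact hinvB x
  have hEa : energy (q - 1) a ≤ A := by
    refine (energy_add_le _ _ _).trans ?_
    simp only [A]
    gcongr
    have h5 := hg.energy_deriv_le (q - 1)
    rw [sub_add_cancel, energy_toFun, SobolevR.norm_toComplex] at h5
    refine h5.trans ?_
    gcongr
  have hEk : energy (q - 1) k ≤ C := by
    refine hinv a k ?_ hkB hEa
    ext x
    exact mul_inv_cancel₀ (ha0 x)
  exact ⟨a, k, fun v v' hv => hL.isDerivC_comp hv ha', fun v v' hv => hL.isDerivC_comp_symm hv hk',
    hL.energy_zero_comp_le hinvB, hL.energy_zero_comp_symm_le hup, hEa.trans (le_max_left _ _),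
    hEk.trans (le_max_right _ _)⟩

end SobolevDiff

/-! ### Dense subspaces of smooth functions -/

theorem SobolevC.norm_le_of_energy_le {s : ℝ} {f : SobolevC s} {B : ℝ} (hB : 0 ≤ B)
    (h : energy s f.toFun ≤ ENNReal.ofReal (B ^ 2)) : ‖f‖ ≤ B := by
  rw [energy_toFun, ENNReal.ofReal_le_ofReal_iff (by positivity)] at h
  exact (sq_le_sq₀ (norm_nonneg _) hB).1 h

theorem contDiff_trigPoly (S : Finset ℤ) (c : ℤ → ℂ) :
    ContDiff ℝ ∞ fun t : ℝ => trigPoly S c t := by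
  simp only [trigPoly, ContinuousMap.sum_apply, ContinuousMap.smul_apply, fourier_coe_apply]
  have h : ContDiff ℝ ∞ fun t : ℝ => (t : ℂ) := Complex.ofRealCLM.contDiff
  refine ContDiff.sum fun k _ => ?_
  have h1 : ContDiff ℝ ∞ fun t : ℝ => Complex.exp (2 * Real.pi * Complex.I * k * t / (1 : ℝ)) := by
    fun_prop
  exact contDiff_const.mul h1

/-- The approximants are Fourier truncations: the squared error is a tail of the convergent energy
series. -/
theorem SmoothC.denseRange_toSobolev (s : ℝ) : DenseRange (SmoothC.toSobolev s) := by
  intro u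
  rw [Metric.mem_closure_range_iff]
  intro ε hε
  have h := ENNReal.tendsto_tsum_compl_atTop_zero u.toFun_energy_ne_top
  have hε' : (0 : ℝ≥0∞) < ENNReal.ofReal ((ε / 2) ^ 2) := by
    rw [ENNReal.ofReal_pos]
    positivity
  obtain ⟨S, hS⟩ := (h.eventually (gt_mem_nhds hε')).exists
  refine ⟨⟨trigPoly S (fourierCoeff u), contDiff_trigPoly _ _⟩, ?_⟩
  rw [dist_eq_norm]
  refine lt_of_le_of_lt (SobolevC.norm_le_of_energy_le (B := ε / 2) (by positivity) ?_) (by linarith)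
  refine le_trans (le_of_eq ?_) hS.le
  rw [energy, ← tsum_subtype_eq_of_support_subset (s := (↑S : Set ℤ)ᶜ)]
  · refine tsum_congr fun k => ?_
    congr 3
    have hk : (k : ℤ) ∉ S := k.2
    change fourierCoeffCLM k (u.toFun - trigPoly S (fourierCoeff u)) = fourierCoeffCLM k u.toFun
    rw [map_sub, fourierCoeffCLM_apply _ (trigPoly _ _), fourierCoeff_trigPoly, if_neg hk, sub_zero]
  · intro k hk hk'
    apply hk
    have hk' : k ∈ S := hk'
    have : fourierCoeffCLM k (u.toFun - trigPoly S (fourierCoeff u)) = 0 := by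
      rw [map_sub, fourierCoeffCLM_apply _ (trigPoly _ _), fourierCoeff_trigPoly, if_pos hk',
        fourierCoeffCLM_apply, sub_self]
    rw [fourierCoeffCLM_apply] at this
    change ENNReal.ofReal _ * ‖fourierCoeff (u.toFun - trigPoly S (fourierCoeff u) :
      C(UnitAddCircle, ℂ)) k‖ₑ ^ 2 = 0
    rw [this]
    simp

/-- Conjugation of a function conjugates its Fourier coefficients and reflects the frequency; the
weight is even in `k`. -/
theorem energy_star (s : ℝ) (u : C(UnitAddCircle, ℂ)) : energy s (star u) = energy s u := by
  rw [energy, energy, ← (Equiv.neg ℤ).tsum_eq]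
  refine tsum_congr fun k => ?_
  have : fourierCoeff (star u : C(UnitAddCircle, ℂ)) (-k) = star (fourierCoeff u k) := by
    simp only [fourierCoeff, neg_neg]
    change _ = (starRingEnd ℂ) _
    rw [← integral_conj]
    congr 1
    ext x
    rw [fourier_neg]
    simp
  rw [Equiv.neg_apply, this]
  simp

/-- Taking real parts does not increase the energy. -/
theorem energy_re_le (s : ℝ) {w : C(UnitAddCircle, ℝ)} {v : C(UnitAddCircle, ℂ)}
    (hw : ∀ x, w x = (v x).re) :
    energy s (Complex.ofRealCLM.compLeftContinuous ℝ UnitAddCircle w) ≤ energy s v := by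
  have e1 : Complex.ofRealCLM.compLeftContinuous ℝ UnitAddCircle w
      = (1 / 2 : ℂ) • v + (1 / 2 : ℂ) • star v := by
    ext x
    change ((w x : ℝ) : ℂ) = (1 / 2 : ℂ) * v x + (1 / 2 : ℂ) * (starRingEnd ℂ) (v x)
    rw [hw, Complex.re_eq_add_conj]
    ring
  rw [e1]
  refine (energy_add_le _ _ _).trans (le_of_eq ?_)
  rw [energy_smul, energy_smul, energy_star]
  have e2 : ‖(1 / 2 : ℂ)‖ₑ ^ 2 = ENNReal.ofReal (1 / 4) := by
    rw [← ofReal_norm, ← ENNReal.ofReal_pow (norm_nonneg _)]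
    norm_num
  have e3 : (2 : ℝ≥0∞) * 2 * ENNReal.ofReal (1 / 4) = 1 := by
    rw [show (2 : ℝ≥0∞) * 2 = ENNReal.ofReal 4 by norm_num, ← ENNReal.ofReal_mul (by norm_num)]
    norm_num
  rw [e2, ← two_mul, ← mul_assoc, ← mul_assoc, e3, one_mul]

/-- The smooth elements of the real Sobolev space. -/
def SobolevR.smooth (s : ℝ) : Set (SobolevR s) := {f | ContDiff ℝ ∞ fun t : ℝ => f t}

/-- A continuous real function of finite energy, as an element of the real Sobolev space. -/
def SobolevR.mk {s : ℝ} (w : C(UnitAddCircle, ℝ))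
    (hw : energy s (Complex.ofRealCLM.compLeftContinuous ℝ UnitAddCircle w) ≠ ⊤) : SobolevR s :=
  ⟨w, energy_ne_top_iff.1 hw⟩

/-- Take `g = Re u`: since `f` is real, `f - g` is the real part of `f - u`, and real parts do not
increase the norm. -/
theorem SobolevR.exists_smooth_norm_sub_le {s : ℝ} (f : SobolevR s) (u : SmoothC) :
    ∃ g ∈ SobolevR.smooth s, ‖f - g‖ ≤ ‖f.toComplex - SmoothC.toSobolev s u‖ := by
  have hu : energy s (SmoothC.toSobolev s u).toFun ≠ ⊤ :=
    (SmoothC.toSobolev s u).toFun_energy_ne_top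
  set w : C(UnitAddCircle, ℝ) :=
    ⟨fun x => (u.1 x).re, Complex.continuous_re.comp (SmoothC.continuous u)⟩ with hw
  have hw' (x : UnitAddCircle) : w x = ((SmoothC.toSobolev s u).toFun x).re := rfl
  have hE := ne_top_of_le_ne_top hu (energy_re_le s hw')
  refine ⟨SobolevR.mk w hE, ?_, ?_⟩
  · exact Complex.reCLM.contDiff.comp (SmoothC.contDiff u)
  rw [← SobolevR.norm_toComplex]
  refine SobolevC.norm_le_of_energy_le (norm_nonneg _) ?_
  rw [← energy_toFun]
  refine energy_re_le s (w := (f - SobolevR.mk w hE).toFun)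
    (v := (f.toComplex - SmoothC.toSobolev s u).toFun) fun x => ?_
  change f x - w x = ((f x : ℂ) - u.1 x).re
  simp [hw]

theorem SobolevR.dense_smooth (s : ℝ) : Dense (SobolevR.smooth s) := by
  intro f
  rw [Metric.mem_closure_iff]
  intro ε hε
  obtain ⟨u, hu⟩ := Metric.mem_closure_range_iff.1 (SmoothC.denseRange_toSobolev s f.toComplex) ε hε
  obtain ⟨g, hg, h⟩ := f.exists_smooth_norm_sub_le u
  refine ⟨g, hg, ?_⟩
  rw [dist_eq_norm] at hu ⊢
  exact h.trans_lt hu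

/-! ### Operators on Sobolev spaces -/

namespace SobolevC

open Classical in
/-- Composition with `χ`, as a bounded operator on `Hˢ` (zero if it is not bounded). -/
def compL (s : ℝ) (χ : UnitAddCircle → UnitAddCircle) : SobolevC s →L[ℂ] SobolevC s :=
  if h : ∃ L : SobolevC s →L[ℂ] SobolevC s, ∀ v x, L v x = v (χ x) then h.choose else 0

theorem compL_spec {s : ℝ} (χ : C(UnitAddCircle, UnitAddCircle)) {C : ℝ≥0∞} (hC : C ≠ ⊤)
    (h : ∀ v, energy s v ≠ ⊤ → energy s (v.comp χ) ≤ C * energy s v) :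
    (∀ v x, compL s χ v x = v (χ x)) ∧ ‖compL s χ‖ ≤ √C.toReal := by
  have hb (v : C(UnitAddCircle, ℂ)) (hv : energy s v ≠ ⊤) : energy s (v.comp χ) ≠ ⊤ :=
    ne_top_of_le_ne_top (by finiteness) (h v hv)
  let L : SobolevC s →ₗ[ℂ] SobolevC s :=
    { toFun := fun v => SobolevC.mk (v.toFun.comp χ) (hb _ v.toFun_energy_ne_top)
      map_add' := fun u v => SobolevC.ext fun x => by simp
      map_smul' := fun c v => SobolevC.ext fun x => by simp }
  have hL (v : SobolevC s) : ‖L v‖ ≤ √C.toReal * ‖v‖ := by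
    refine norm_le_of_energy_le (by positivity) ?_
    refine (h _ v.toFun_energy_ne_top).trans (le_of_eq ?_)
    rw [energy_toFun, mul_pow, Real.sq_sqrt ENNReal.toReal_nonneg,
      ENNReal.ofReal_mul ENNReal.toReal_nonneg, ENNReal.ofReal_toReal hC]
  have hex : ∃ L : SobolevC s →L[ℂ] SobolevC s, ∀ v x, L v x = v (χ x) :=
    ⟨L.mkContinuous _ hL, fun v x => rfl⟩
  have h1 : ∀ v x, compL s χ v x = v (χ x) := by
    rw [compL, dif_pos hex]
    exact hex.choose_spec
  refine ⟨h1, ?_⟩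
  -- An operator is determined by its pointwise values, so the chosen one inherits the bound of the
  -- explicit one.
  have e : compL s χ = L.mkContinuous _ hL := by
    ext v x
    exact h1 v x
  rw [e]
  exact L.mkContinuous_norm_le (by positivity) hL

theorem exists_mulL {a s : ℝ} (ha : 1 / 2 < a) (hs : 0 ≤ s) (hsa : s ≤ a) :
    ∃ L : SobolevC a →L[ℂ] SobolevC s →L[ℂ] SobolevC s, ∀ u v x, L u v x = u x * v x := by
  obtain ⟨C, hC, h⟩ := exists_energy_mul_le ha hs hsa
  have hb (u : SobolevC a) (v : SobolevC s) : energy s (u.toFun * v.toFun) ≠ ⊤ :=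
    ne_top_of_le_ne_top (ENNReal.mul_ne_top hC (ENNReal.mul_ne_top u.toFun_energy_ne_top
      v.toFun_energy_ne_top)) (h _ _ u.toFun_energy_ne_top)
  let L : SobolevC a →ₗ[ℂ] SobolevC s →ₗ[ℂ] SobolevC s :=
    LinearMap.mk₂ ℂ (fun u v => SobolevC.mk (u.toFun * v.toFun) (hb u v))
      (fun u u' v => SobolevC.ext fun x => by simp [add_mul])
      (fun c u v => SobolevC.ext fun x => by simp [mul_assoc])
      (fun u v v' => SobolevC.ext fun x => by simp [mul_add])
      (fun c u v => SobolevC.ext fun x => by simp [mul_left_comm])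
  refine ⟨L.mkContinuous₂ (√C.toReal) fun u v => ?_, fun u v x => rfl⟩
  refine norm_le_of_energy_le (by positivity) ?_
  refine (h _ _ u.toFun_energy_ne_top).trans (le_of_eq ?_)
  rw [energy_toFun, energy_toFun, mul_pow, mul_pow, Real.sq_sqrt ENNReal.toReal_nonneg, mul_assoc,
    ENNReal.ofReal_mul ENNReal.toReal_nonneg, ENNReal.ofReal_toReal hC,
    ENNReal.ofReal_mul (by positivity)]

/-- Pointwise multiplication `Hᵃ × Hˢ → Hˢ`, `1/2 < s ≤ a`. -/
def mulL {a s : ℝ} (hs : 1 / 2 < s) (hsa : s ≤ a) :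
    SobolevC a →L[ℂ] SobolevC s →L[ℂ] SobolevC s :=
  (exists_mulL (hs.trans_le hsa) (by linarith) hsa).choose

@[simp] theorem mulL_apply {a s : ℝ} (hs : 1 / 2 < s) (hsa : s ≤ a) (u : SobolevC a)
    (v : SobolevC s) (x : UnitAddCircle) : mulL hs hsa u v x = u x * v x :=
  (exists_mulL (hs.trans_le hsa) (by linarith) hsa).choose_spec u v x

/-! ### Curves in Sobolev spaces with pointwise derivatives -/

/-- Differentiation under the integral sign; the Sobolev embedding turns the norm bound on `z` into
a uniform dominating constant. -/
theorem hasDerivAt_fourierCoeff {s : ℝ} (hs : 3 / 2 < s) {y z : ℝ → SobolevC s} {I : Set ℝ}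
    (hI : IsOpen I) (hd : ∀ t ∈ I, ∀ x, HasDerivAt (fun t => y t x) (z t x) t) {M : ℝ}
    (hM : ∀ t ∈ I, ‖z t‖ ≤ M) {t : ℝ} (ht : t ∈ I) (k : ℤ) :
    HasDerivAt (fun t => fourierCoeff (y t) k) (fourierCoeff (z t) k) t := by
  obtain ⟨K, hK, h⟩ := exists_C1 hs
  have hc (v : SobolevC s) : Continuous fun x => fourier (-k) x • v x :=
    (fourier (-k)).continuous.smul v.toFun.continuous
  have h1 : ∀ᶠ t in 𝓝 t, AEStronglyMeasurable (fun x => fourier (-k) x • y t x)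
      AddCircle.haarAddCircle :=
    Filter.Eventually.of_forall fun t => (hc (y t)).aestronglyMeasurable
  have h2 : Integrable (fun x => fourier (-k) x • y t x) AddCircle.haarAddCircle :=
    (hc (y t)).integrable_of_hasCompactSupport (HasCompactSupport.of_compactSpace _)
  have h3 : ∀ x, ∀ t ∈ I, ‖fourier (-k) x • z t x‖ ≤ K * M := by
    intro x t ht
    rw [norm_smul, fourier_apply, Circle.norm_coe, one_mul]
    refine ((h (z t)).1 x).trans ?_
    have := hM t ht
    gcongr
  have h4 : ∀ x, ∀ t ∈ I, HasDerivAt (fun t => fourier (-k) x • y t x)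
      (fourier (-k) x • z t x) t := fun x t ht => (hd t ht x).const_mul _
  exact (hasDerivAt_integral_of_dominated_loc_of_deriv_le (hI.mem_nhds ht) h1 h2
    (hc (z t)).aestronglyMeasurable (Filter.Eventually.of_forall h3) (integrable_const _)
    (Filter.Eventually.of_forall h4)).2

/-- A mean value inequality that presupposes no continuity of `y` in the Sobolev norm. Pairing with
a truncation of the increment itself gives a scalar function whose derivative is bounded by
Cauchy–Schwarz. -/
theorem norm_sub_le_of_pointwise_deriv {s : ℝ} (hs : 3 / 2 < s) {y z : ℝ → SobolevC s} {I : Set ℝ}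
    (hI : IsOpen I) (hI' : Set.Icc 0 1 ⊆ I)
    (hd : ∀ t ∈ I, ∀ x, HasDerivAt (fun t => y t x) (z t x) t) {M : ℝ}
    (hM : ∀ t ∈ I, ‖z t‖ ≤ M) : ‖y 1 - y 0‖ ≤ M := by
  have hM0 : 0 ≤ M := (norm_nonneg _).trans (hM 0 (hI' (by simp)))
  refine norm_le_of_energy_le hM0 ?_
  rw [energy, ENNReal.tsum_eq_iSup_sum]
  refine iSup_le fun S => ?_
  simp only [energy_term]
  rw [← ENNReal.ofReal_sum_of_nonneg fun k _ => by positivity]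
  refine ENNReal.ofReal_le_ofReal ?_
  set d : ℤ → ℂ := fun k => fourierCoeff (y 1 - y 0).toFun k
  set w : ℤ → ℝ := fun k => (1 + (k : ℝ) ^ 2) ^ s
  have hw (k : ℤ) : 0 ≤ w k := by positivity
  set Q := ∑ k ∈ S, w k * ‖d k‖ ^ 2
  have hQ : 0 ≤ Q := Finset.sum_nonneg fun k _ => by positivity
  have hd1 (k : ℤ) : d k = fourierCoeff (y 1) k - fourierCoeff (y 0) k := by
    change fourierCoeffCLM k ((y 1 - y 0).toFun) = fourierCoeffCLM k (y 1).toFun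
      - fourierCoeffCLM k (y 0).toFun
    rw [map_sub, map_sub]
  -- This functional takes the value `Q` on the increment and has norm at most `√Q`. The scalar mean
  -- value inequality therefore yields `Q ≤ √Q * M`, that is `√Q ≤ M`.
  set l : ℝ → ℂ := fun t => ∑ k ∈ S, (w k * star (d k)) * fourierCoeff (y t) k with hl
  have hl1 : l 1 - l 0 = Q := by
    simp only [hl, Q]
    rw [← Finset.sum_sub_distrib]
    push_cast
    refine Finset.sum_congr rfl fun k _ => ?_
    rw [← mul_sub, ← hd1, mul_assoc]
    congr 1
    exact Complex.conj_mul' (d k)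
  have hld (t : ℝ) (ht : t ∈ I) :
      HasDerivAt l (∑ k ∈ S, (w k * star (d k)) * fourierCoeff (z t) k) t :=
    HasDerivAt.fun_sum fun k _ => (hasDerivAt_fourierCoeff hs hI hd hM ht k).const_mul _
  have hlb (t : ℝ) (ht : t ∈ I) :
      ‖∑ k ∈ S, (w k * star (d k)) * fourierCoeff (z t) k‖ ≤ √Q * M := by
    calc ‖∑ k ∈ S, (w k * star (d k)) * fourierCoeff (z t) k‖
        ≤ ∑ k ∈ S, (√(w k) * ‖d k‖) * (√(w k) * ‖fourierCoeff (z t) k‖) := by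
          refine (norm_sum_le _ _).trans (Finset.sum_le_sum fun k _ => le_of_eq ?_)
          rw [norm_mul, norm_mul, norm_star, Complex.norm_real, Real.norm_of_nonneg (hw k)]
          nth_rw 1 [← Real.mul_self_sqrt (hw k)]
          ring
      _ ≤ √(∑ k ∈ S, (√(w k) * ‖d k‖) ^ 2) * √(∑ k ∈ S, (√(w k) * ‖fourierCoeff (z t) k‖) ^ 2) :=
          Real.sum_mul_le_sqrt_mul_sqrt _ _ _
      _ ≤ √Q * M := by
          simp only [mul_pow, Real.sq_sqrt (hw _)]
          gcongr
          refine Real.sqrt_le_iff.2 ⟨hM0, ?_⟩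
          refine le_trans ?_ (pow_le_pow_left₀ (norm_nonneg _) (hM t ht) 2)
          rw [norm_sq]
          exact (z t).memSobolev.sum_le_tsum S fun k _ => by positivity
  have h1 := Convex.norm_image_sub_le_of_norm_hasDerivWithin_le (s := Set.Icc (0 : ℝ) 1)
    (fun t ht => (hld t (hI' ht)).hasDerivWithinAt) (fun t ht => hlb t (hI' ht))
    (convex_Icc 0 1) (Set.left_mem_Icc.2 zero_le_one) (Set.right_mem_Icc.2 zero_le_one)
  rw [hl1, Complex.norm_real, Real.norm_of_nonneg hQ, sub_zero, norm_one, mul_one] at h1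
  rcases hQ.eq_or_lt with h0 | h0
  · rw [← h0]
    positivity
  · have h2 : √Q * √Q ≤ √Q * M := by rwa [Real.mul_self_sqrt hQ]
    have h3 : √Q ≤ M := le_of_mul_le_mul_left h2 (Real.sqrt_pos.2 h0)
    calc Q = √Q ^ 2 := (Real.sq_sqrt hQ).symm
      _ ≤ M ^ 2 := by gcongr

/-- Subtract the linear part and apply the mean value inequality on the segment from `t₀` to `t`;
continuity of `z` at `t₀` makes the derivative of the remainder small. -/
theorem hasDerivAt_of_pointwise_deriv {s : ℝ} (hs : 3 / 2 < s) {y z : ℝ → SobolevC s} {t₀ : ℝ}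
    (hd : ∀ᶠ t in 𝓝 t₀, ∀ x, HasDerivAt (fun t => y t x) (z t x) t)
    (hz : ContinuousAt z t₀) : HasDerivAt y (z t₀) t₀ := by
  rw [hasDerivAt_iff_isLittleO, Asymptotics.isLittleO_iff]
  intro ε hε
  have h1 : ∀ᶠ t in 𝓝 t₀, ‖z t - z t₀‖ < ε := by
    have := hz.eventually (Metric.ball_mem_nhds (z t₀) hε)
    filter_upwards [this] with t ht
    rwa [← dist_eq_norm]
  obtain ⟨δ, hδ, hball⟩ := Metric.eventually_nhds_iff_ball.1 (hd.and h1)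
  refine Metric.eventually_nhds_iff_ball.2 ⟨δ, hδ, fun t ht => ?_⟩
  set I : Set ℝ := (fun u : ℝ => t₀ + u * (t - t₀)) ⁻¹' Metric.ball t₀ δ
  have hI : IsOpen I := Metric.isOpen_ball.preimage (by fun_prop)
  have hI' : Set.Icc 0 1 ⊆ I := by
    intro u hu
    rw [Metric.mem_ball, Real.dist_eq] at ht
    change t₀ + u * (t - t₀) ∈ Metric.ball t₀ δ
    rw [Metric.mem_ball, Real.dist_eq, add_sub_cancel_left, abs_mul, abs_of_nonneg hu.1]
    exact lt_of_le_of_lt (mul_le_of_le_one_left (abs_nonneg _) hu.2) ht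
  have h := norm_sub_le_of_pointwise_deriv hs (M := ε * ‖t - t₀‖) hI hI'
    (y := fun u => y (t₀ + u * (t - t₀)) - (u * (t - t₀)) • z t₀)
    (z := fun u => (t - t₀) • (z (t₀ + u * (t - t₀)) - z t₀)) ?_ ?_
  · convert h using 2
    simp
    abel
  · intro u hu x
    have h2 := (hball _ hu).1 x
    have h3 : HasDerivAt (fun u : ℝ => t₀ + u * (t - t₀)) (t - t₀) u := by
      simpa using ((hasDerivAt_id u).mul_const (t - t₀)).const_add t₀
    have h4 := h2.scomp u h3
    have h5 : HasDerivAt (fun u : ℝ => (u * (t - t₀)) • z t₀ x) ((t - t₀) • z t₀ x) u := by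
      have := ((hasDerivAt_id u).mul_const (t - t₀)).smul_const (z t₀ x)
      simpa using this
    have h6 := h4.sub h5
    rw [← smul_sub] at h6
    exact h6
  · intro u hu
    rw [norm_smul, mul_comm]
    gcongr
    exact (hball _ hu).2.le

end SobolevC

/-- A locally bounded family of operators that is continuous on a dense set of vectors is jointly
continuous. -/
theorem continuousAt_clm_apply_of_dense {X E F : Type*} [TopologicalSpace X]
    [NormedAddCommGroup E] [NormedSpace ℂ E] [NormedAddCommGroup F] [NormedSpace ℂ F]
    {A : X → E →L[ℂ] F} {x₀ : X} {N : ℝ} (hN : ∀ᶠ x in 𝓝 x₀, ‖A x‖ ≤ N) {S : Set E} (hS : Dense S)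
    (h : ∀ v ∈ S, ContinuousAt (fun x => A x v) x₀) (v₀ : E) :
    ContinuousAt (fun p : X × E => A p.1 p.2) (x₀, v₀) := by
  rw [ContinuousAt, Metric.tendsto_nhds]
  intro ε hε
  have hN0 : ‖A x₀‖ ≤ N := hN.self_of_nhds
  have hN1 : 0 ≤ N := (norm_nonneg _).trans hN0
  set δ := ε / (2 * N + 1 + 1) with hδ
  have hδ0 : 0 < δ := by positivity
  obtain ⟨w, hw, hwv⟩ := Metric.mem_closure_iff.1 (hS v₀) δ hδ0
  have h1 : ∀ᶠ p : X × E in 𝓝 (x₀, v₀), ‖A p.1‖ ≤ N :=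
    (continuous_fst.tendsto (x₀, v₀)).eventually hN
  have h2 : ∀ᶠ p : X × E in 𝓝 (x₀, v₀), dist (A p.1 w) (A x₀ w) < δ :=
    (continuous_fst.tendsto (x₀, v₀)).eventually ((Metric.tendsto_nhds.1 (h w hw)) δ hδ0)
  have h3 : ∀ᶠ p : X × E in 𝓝 (x₀, v₀), dist p.2 w < δ :=
    (continuous_snd.tendsto (x₀, v₀)).eventually (Metric.isOpen_ball.mem_nhds hwv)
  filter_upwards [h1, h2, h3] with p hp1 hp2 hp3
  -- Compare both values through the nearby dense vector `w`: the errors add up to at most `(2N + 1)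
  -- δ`, and the additional 1 in the denominator of `δ` makes this less than `ε`.
  have e : A p.1 p.2 - A x₀ v₀ = A p.1 (p.2 - w) + (A p.1 w - A x₀ w) + A x₀ (w - v₀) := by
    simp only [map_sub]
    abel
  rw [dist_eq_norm] at hp2 hp3 hwv ⊢
  rw [norm_sub_rev] at hwv
  rw [e]
  calc ‖A p.1 (p.2 - w) + (A p.1 w - A x₀ w) + A x₀ (w - v₀)‖
      ≤ ‖A p.1 (p.2 - w)‖ + ‖A p.1 w - A x₀ w‖ + ‖A x₀ (w - v₀)‖ := norm_add₃_le
    _ ≤ N * δ + δ + N * δ := by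
        gcongr
        · exact (ContinuousLinearMap.le_opNorm _ _).trans (by gcongr)
        · exact (ContinuousLinearMap.le_opNorm _ _).trans (by gcongr)
    _ < (2 * N + 1 + 1) * δ := by linarith
    _ = ε := by
        rw [hδ]
        field_simp

/-! ### Strong continuity and differentiability of composition operators. -/

namespace SobolevDiff

variable {q : ℝ}

/-- The operator `v ↦ v ∘ φ` on `Hˢ`. -/
def R (s : ℝ) (φ : SobolevDiff q) : SobolevC s →L[ℂ] SobolevC s := SobolevC.compL s φ.toEquiv

/-- The operator `v ↦ v ∘ φ⁻¹` on `Hˢ`. -/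
def Rinv (s : ℝ) (φ : SobolevDiff q) : SobolevC s →L[ℂ] SobolevC s :=
  SobolevC.compL s φ.toEquiv.symm

theorem segment_subset_ball {f₀ f g : SobolevR q} {ε : ℝ} (hf : f ∈ Metric.ball f₀ ε)
    (hg : g ∈ Metric.ball f₀ ε) :
    Set.Icc (0 : ℝ) 1 ⊆ {t | f + t • (g - f) ∈ Metric.ball f₀ ε} := fun _ ht =>
  (convex_ball f₀ ε).add_smul_sub_mem hf hg ht

theorem isOpen_segment (f₀ f h : SobolevR q) (ε : ℝ) :
    IsOpen {t : ℝ | f + t • h ∈ Metric.ball f₀ ε} :=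
  Metric.isOpen_ball.preimage (by fun_prop)

variable [Fact (3 / 2 < q)]

theorem exists_ball_norm_le {f₀ : SobolevR q} (hf₀ : f₀ ∈ diffeoLifts q) (hq : 5 / 2 < q) :
    ∃ ε > 0, Metric.ball f₀ ε ⊆ diffeoLifts q ∧ ∀ s, 1 / 2 < s → s ≤ q →
      ∃ N : ℝ, 0 ≤ N ∧ ∀ f ∈ Metric.ball f₀ ε,
        (∀ v x, R s (ofLift f) v x = v (ofLift f x)) ∧
        (∀ v x, Rinv s (ofLift f) v x = v ((ofLift f).toEquiv.symm x)) ∧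
        ‖R s (ofLift f)‖ ≤ N ∧ ‖Rinv s (ofLift f)‖ ≤ N := by
  obtain ⟨ε, hε, B, M, hM, h⟩ := exists_diffeoBounds hf₀ hq
  refine ⟨ε, hε, fun f hf => (h f hf).1, fun s hs hsq => ?_⟩
  obtain ⟨C, hC, hc⟩ := DiffeoBounds.exists_energy_comp_le (B := B) hq hs hsq hM
  refine ⟨√C.toReal, by positivity, fun f hf => ?_⟩
  obtain ⟨-, a, k, hb⟩ := h f hf
  have h1 := SobolevC.compL_spec (ofLift f).homeo hC fun v hv => (hc hb v hv).1
  have h2 := SobolevC.compL_spec (ofLift f).homeo.symm hC fun v hv => (hc hb v hv).2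
  exact ⟨h1.1, h2.1, h1.2, h2.2⟩

variable {s : ℝ}

theorem R_apply (hq : 5 / 2 < q) (hs : 1 / 2 < s) (hsq : s ≤ q) (φ : SobolevDiff q) (v : SobolevC s)
    (x : UnitAddCircle) : R s φ v x = v (φ x) := by
  obtain ⟨f, hf, rfl⟩ := exists_ofLift φ
  obtain ⟨ε, hε, -, h⟩ := exists_ball_norm_le hf hq
  obtain ⟨N, -, hN⟩ := h s hs hsq
  exact (hN f (Metric.mem_ball_self hε)).1 v x

theorem Rinv_apply (hq : 5 / 2 < q) (hs : 1 / 2 < s) (hsq : s ≤ q) (φ : SobolevDiff q)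
    (v : SobolevC s) (x : UnitAddCircle) : Rinv s φ v x = v (φ.toEquiv.symm x) := by
  obtain ⟨f, hf, rfl⟩ := exists_ofLift φ
  obtain ⟨ε, hε, -, h⟩ := exists_ball_norm_le hf hq
  obtain ⟨N, -, hN⟩ := h s hs hsq
  exact (hN f (Metric.mem_ball_self hε)).2.1 v x

theorem R_Rinv (hq : 5 / 2 < q) (hs : 1 / 2 < s) (hsq : s ≤ q) (φ : SobolevDiff q)
    (v : SobolevC s) : R s φ (Rinv s φ v) = v := by
  ext x
  rw [R_apply hq hs hsq, Rinv_apply hq hs hsq, Equiv.symm_apply_apply]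

theorem Rinv_R (hq : 5 / 2 < q) (hs : 1 / 2 < s) (hsq : s ≤ q) (φ : SobolevDiff q)
    (v : SobolevC s) : Rinv s φ (R s φ v) = v := by
  ext x
  rw [Rinv_apply hq hs hsq, R_apply hq hs hsq, Equiv.apply_symm_apply]

/-- On the real line the path is affine in `t` with velocity `h(x)`. Openness of the admissible
displacements ensures that this description holds for all nearby `t`. -/
theorem hasDerivAt_comp_path {v v' : C(UnitAddCircle, ℂ)} (hv : IsDerivC v v') {f h : SobolevR q}
    {t : ℝ} (ht : f + t • h ∈ diffeoLifts q) (x : UnitAddCircle) :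
    HasDerivAt (fun t : ℝ => v (ofLift (f + t • h) x)) (h x * v' (ofLift (f + t • h) x)) t := by
  have hU : ∀ᶠ t in 𝓝 t, f + t • h ∈ diffeoLifts q := by
    have hc : Continuous fun t : ℝ => f + t • h := by fun_prop
    exact hc.continuousAt.eventually ((isOpen_diffeoLifts Fact.out).mem_nhds ht)
  induction x using QuotientAddGroup.induction_on with | H X => ?_
  have e (t : ℝ) (ht : f + t • h ∈ diffeoLifts q) :
      ofLift (f + t • h) (X : UnitAddCircle) = ((X + (f X + t * h X) : ℝ) : UnitAddCircle) := by
    rw [ofLift_apply ht]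
    simp
  have h1 : HasDerivAt (fun t : ℝ => X + (f X + t * h X)) (h X) t := by
    simpa using (((hasDerivAt_id t).mul_const (h X)).const_add (f X)).const_add X
  have h2 := (hv (X + (f X + t * h X))).scomp t h1
  have h3 := h2.congr_of_eventuallyEq (f₁ := fun t : ℝ => v (ofLift (f + t • h) X)) (by
    filter_upwards [hU] with t ht
    rw [e t ht]
    rfl)
  refine h3.congr_deriv ?_
  rw [e t ht]
  rfl

theorem hasDerivAt_R_apply (hq : 5 / 2 < q) (hs : 1 / 2 < s) (hsq : s ≤ q) {v v' : SobolevC s}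
    (hv : IsDerivC v.toFun v'.toFun) {f h : SobolevR q} {t : ℝ} (ht : f + t • h ∈ diffeoLifts q)
    (x : UnitAddCircle) :
    HasDerivAt (fun t : ℝ => R s (ofLift (f + t • h)) v x)
      (SobolevC.mulL hs hsq h.toComplex (R s (ofLift (f + t • h)) v') x) t := by
  simp only [SobolevC.mulL_apply, R_apply hq hs hsq]
  exact hasDerivAt_comp_path hv ht x

/-- One extra derivative of `v` in `Hˢ` gives a local Lipschitz bound, by the mean value inequality
along segments. -/
theorem continuousAt_R_of_isDerivC (hq : 5 / 2 < q) (hs : 3 / 2 < s) (hsq : s ≤ q) {v v' : SobolevC s}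
    (hv : IsDerivC v.toFun v'.toFun) {f₀ : SobolevR q} (hf₀ : f₀ ∈ diffeoLifts q) :
    ContinuousAt (fun f => R s (ofLift f) v) f₀ := by
  have hs' : 1 / 2 < s := by linarith
  obtain ⟨ε, hε, hb, h⟩ := exists_ball_norm_le hf₀ hq
  obtain ⟨N, hN0, hN⟩ := h s hs' hsq
  set m := ‖SobolevC.mulL (a := q) hs' hsq‖
  refine continuousAt_of_locally_lipschitz hε (m * (N * ‖v'‖)) fun g hg => ?_
  have h1 := SobolevC.norm_sub_le_of_pointwise_deriv hs
    (y := fun t => R s (ofLift (f₀ + t • (g - f₀))) v)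
    (isOpen_segment f₀ f₀ (g - f₀) ε) (segment_subset_ball (Metric.mem_ball_self hε) hg)
    (fun t ht x => hasDerivAt_R_apply hq hs' hsq hv (hb ht) x)
    (M := m * ‖g - f₀‖ * (N * ‖v'‖)) (fun t ht => by
      refine (ContinuousLinearMap.le_opNorm₂ _ _ _).trans ?_
      rw [SobolevR.norm_toComplex]
      gcongr
      refine (ContinuousLinearMap.le_opNorm _ _).trans ?_
      gcongr
      exact (hN _ ht).2.2.1)
  rw [dist_eq_norm, dist_eq_norm]
  simp only [one_smul, add_sub_cancel, zero_smul, add_zero] at h1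
  linarith

theorem isDerivC_smooth (s : ℝ) (u : SmoothC) : IsDerivC (SmoothC.toSobolev s u).toFun
    (SmoothC.toSobolev s (SmoothC.D u)).toFun := fun t =>
  ((SmoothC.contDiff u).differentiable (by simp)).differentiableAt.hasDerivAt

theorem eventually_norm_le (hq : 5 / 2 < q) (hs : 1 / 2 < s) (hsq : s ≤ q) {f₀ : SobolevR q}
    (hf₀ : f₀ ∈ diffeoLifts q) :
    ∃ N, ∀ᶠ f in 𝓝 f₀, ‖R s (ofLift f)‖ ≤ N ∧ ‖Rinv s (ofLift f)‖ ≤ N := by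
  obtain ⟨ε, hε, hb, h⟩ := exists_ball_norm_le hf₀ hq
  obtain ⟨N, hN0, hN⟩ := h s hs hsq
  exact ⟨N, Filter.eventually_of_mem (Metric.ball_mem_nhds f₀ hε) fun f hf => (hN f hf).2.2⟩

/-- Smooth `v` have a derivative to spare; the locally uniform bounds extend continuity from them to
all of `Hˢ`. Continuity is joint in `φ` and `v`, not in operator norm. -/
theorem continuousAt_R (hq : 5 / 2 < q) (hs : 3 / 2 < s) (hsq : s ≤ q) {f₀ : SobolevR q}
    (hf₀ : f₀ ∈ diffeoLifts q) (v₀ : SobolevC s) :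
    ContinuousAt (fun p : SobolevR q × SobolevC s => R s (ofLift p.1) p.2) (f₀, v₀) := by
  obtain ⟨N, hN⟩ := eventually_norm_le hq (by linarith : 1 / 2 < s) hsq hf₀
  refine continuousAt_clm_apply_of_dense (hN.mono fun f h => h.1)
    (SmoothC.denseRange_toSobolev s) ?_ v₀
  rintro _ ⟨u, rfl⟩
  exact continuousAt_R_of_isDerivC hq hs hsq (isDerivC_smooth s u) hf₀

/-- With `w = R_φ₀⁻¹ v` one has `R_φ⁻¹ v - w = R_φ⁻¹ (v - R_φ w)`, so local boundedness of the
inverses and strong continuity of `R` suffice. -/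
theorem continuousAt_Rinv (hq : 5 / 2 < q) (hs : 3 / 2 < s) (hsq : s ≤ q) {f₀ : SobolevR q}
    (hf₀ : f₀ ∈ diffeoLifts q) (v₀ : SobolevC s) :
    ContinuousAt (fun p : SobolevR q × SobolevC s => Rinv s (ofLift p.1) p.2) (f₀, v₀) := by
  have hs' : 1 / 2 < s := by linarith
  obtain ⟨N, hN⟩ := eventually_norm_le hq hs' hsq hf₀
  refine continuousAt_clm_apply_of_dense (hN.mono fun f h => h.2) dense_univ (fun v _ => ?_) v₀
  set w := Rinv s (ofLift f₀) v
  have h1 : ContinuousAt (fun f => R s (ofLift f) w) f₀ :=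
    (continuousAt_R hq hs hsq hf₀ w).comp (f := fun f => (f, w)) (by fun_prop)
  have h2 : Filter.Tendsto (fun f => N * ‖v - R s (ofLift f) w‖) (𝓝 f₀) (𝓝 0) := by
    have h3 : Filter.Tendsto (fun f => R s (ofLift f) w) (𝓝 f₀) (𝓝 v) := by
      have := h1.tendsto
      rwa [R_Rinv hq hs' hsq] at this
    simpa using ((tendsto_const_nhds (x := v)).sub h3).norm.const_mul N
  refine tendsto_iff_norm_sub_tendsto_zero.2 (squeeze_zero' (Filter.Eventually.of_forall fun _ =>
    norm_nonneg _) ?_ h2)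
  filter_upwards [hN] with f hf
  have e : Rinv s (ofLift f) v - w = Rinv s (ofLift f) (v - R s (ofLift f) w) := by
    rw [map_sub, Rinv_R hq hs' hsq]
  change ‖Rinv s (ofLift f) v - w‖ ≤ _
  rw [e]
  refine (ContinuousLinearMap.le_opNorm _ _).trans ?_
  gcongr
  exact hf.2

/-- The derivative of `t ↦ v ∘ φ_t` along a segment. -/
theorem hasDerivAt_R (hq : 5 / 2 < q) (hs : 3 / 2 < s) (hs' : 1 / 2 < s) (hsq : s ≤ q)
    {v v' : SobolevC s} (hv : IsDerivC v.toFun v'.toFun) {f h : SobolevR q} {t : ℝ}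
    (ht : f + t • h ∈ diffeoLifts q) :
    HasDerivAt (fun t : ℝ => R s (ofLift (f + t • h)) v)
      (SobolevC.mulL hs' hsq h.toComplex (R s (ofLift (f + t • h)) v')) t := by
  have hc : ContinuousAt (fun t : ℝ => f + t • h) t := by fun_prop
  refine SobolevC.hasDerivAt_of_pointwise_deriv hs
    (z := fun t => SobolevC.mulL hs' hsq h.toComplex (R s (ofLift (f + t • h)) v')) ?_ ?_
  · filter_upwards [hc.eventually ((isOpen_diffeoLifts Fact.out).mem_nhds ht)] with t ht x
    exact hasDerivAt_R_apply hq hs' hsq hv ht x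
  · refine (ContinuousLinearMap.continuous _).continuousAt.comp ?_
    exact (continuousAt_R hq hs hsq ht v').comp (f := fun t : ℝ => (f + t • h, v'))
      (hc.prodMk continuousAt_const)

end SobolevDiff

/-- Product rule for a strongly continuous family of operators applied to a curve. -/
theorem hasDerivAt_clm_apply_of_continuousAt {E F : Type*}
    [NormedAddCommGroup E] [NormedSpace ℂ E] [NormedAddCommGroup F] [NormedSpace ℂ F]
    {A : ℝ → E →L[ℂ] F} {y : ℝ → E} {y' : E} {d : F} {t₀ : ℝ} (hy : HasDerivAt y y' t₀)
    (hA : ContinuousAt (fun p : ℝ × E => A p.1 p.2) (t₀, y'))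
    (hd : HasDerivAt (fun t => A t (y t₀)) d t₀) :
    HasDerivAt (fun t => A t (y t)) (A t₀ y' + d) t₀ := by
  rw [hasDerivAt_iff_tendsto_slope] at *
  have h1 : Filter.Tendsto (fun t => A t (slope y t₀ t)) (𝓝[≠] t₀) (𝓝 (A t₀ y')) :=
    hA.tendsto.comp ((tendsto_nhdsWithin_of_tendsto_nhds Filter.tendsto_id).prodMk_nhds hy)
  -- The slope of the product is `A t` applied to the slope of `y`, plus the slope of `A` at the
  -- fixed vector `y t₀`.
  refine (h1.add hd).congr fun t => ?_
  simp only [slope_def_module, ContinuousLinearMap.map_smul_of_tower, map_sub]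
  module

theorem SobolevR.smooth_add_smul {q : ℝ} {f h : SobolevR q} (hf : f ∈ SobolevR.smooth q)
    (hh : h ∈ SobolevR.smooth q) (t : ℝ) : f + t • h ∈ SobolevR.smooth q := by
  have h1 : ContDiff ℝ ∞ fun x : ℝ => f x + t * h x := ContDiff.add hf (contDiff_const.mul hh)
  have e : (fun x : ℝ => (f + t • h) x) = fun x : ℝ => f x + t * h x := by
    ext x
    simp
  change ContDiff ℝ ∞ fun x : ℝ => (f + t • h) x
  rw [e]
  exact h1

theorem SobolevR.exists_smooth_toComplex {q : ℝ} {h : SobolevR q} (hh : h ∈ SobolevR.smooth q) :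
    ∃ H : SmoothC, SmoothC.toSobolev q H = h.toComplex := by
  have h1 : ContDiff ℝ ∞ fun t : ℝ => h t := hh
  have h2 : ContDiff ℝ ∞ fun t : ℝ => ((h t : ℝ) : ℂ) := Complex.ofRealCLM.contDiff.comp h1
  exact ⟨⟨fun x => (h x : ℂ), h2⟩, rfl⟩

namespace SobolevDiff

variable {q : ℝ}

/-! ### Conjugation of multilinear operators -/

/-- The operator `R_φ T R_φ⁻¹`. -/
def conj {σ : ℝ} {n : ℕ} (T : ContinuousMultilinearMap ℂ (fun _ : Fin n => SobolevC q) (SobolevC σ))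
    (φ : SobolevDiff q) : ContinuousMultilinearMap ℂ (fun _ : Fin n => SobolevC q) (SobolevC σ) :=
  (R σ φ).compContinuousMultilinearMap (T.compContinuousLinearMap fun _ => Rinv q φ)

variable {σ : ℝ}

theorem conj_apply {n : ℕ} (T : ContinuousMultilinearMap ℂ (fun _ : Fin n => SobolevC q) (SobolevC σ))
    (φ : SobolevDiff q) (u : Fin n → SobolevC q) :
    conj T φ u = R σ φ (T fun i => Rinv q φ (u i)) := rfl

theorem exists_norm_conj_le {n : ℕ} {D : Set (SobolevDiff q)} {Nσ Nq : ℝ} (hN : 0 ≤ Nσ)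
    (hσ : ∀ φ ∈ D, ‖R σ φ‖ ≤ Nσ) (hq : ∀ φ ∈ D, ‖Rinv q φ‖ ≤ Nq)
    (T : ContinuousMultilinearMap ℂ (fun _ : Fin n => SobolevC q) (SobolevC σ)) :
    ∃ M, 0 ≤ M ∧ ∀ φ ∈ D, ‖conj T φ‖ ≤ M := by
  refine ⟨Nσ * (‖T‖ * |Nq| ^ n), by positivity, fun φ hφ => ?_⟩
  refine (ContinuousLinearMap.norm_compContinuousMultilinearMap_le _ _).trans ?_
  have h1 := T.norm_compContinuousLinearMap_le fun _ => Rinv q φ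
  simp only [Finset.prod_const, Finset.card_univ, Fintype.card_fin] at h1
  have h2 := hσ φ hφ
  gcongr
  refine h1.trans ?_
  gcongr
  exact (hq φ hφ).trans (le_abs_self _)

/-- The recursion for the operators `Pₙ`, in terms of their extensions. -/
theorem multiOp_succ_toSobolev {P : SmoothC →ₗ[ℂ] SmoothC} {n : ℕ}
    {T : ContinuousMultilinearMap ℂ (fun _ : Fin (n + 1) => SobolevC q) (SobolevC σ)}
    {T' : ContinuousMultilinearMap ℂ (fun _ : Fin (n + 2) => SobolevC q) (SobolevC σ)}
    (hT : ∀ u, T (fun i => SmoothC.toSobolev q (u i)) = SmoothC.toSobolev σ (multiOp P n u))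
    (hT' : ∀ u, T' (fun i => SmoothC.toSobolev q (u i)) = SmoothC.toSobolev σ (multiOp P (n + 1) u))
    (w : Fin (n + 1) → SmoothC) (W : SmoothC) (x : UnitAddCircle) :
    T' (Fin.snoc (fun i => SmoothC.toSobolev q (w i)) (SmoothC.toSobolev q W)) x
      = (∑ k, T (Function.update (fun i => SmoothC.toSobolev q (w i)) k
          (-SmoothC.toSobolev q (W * SmoothC.D (w k))))) x
        + W.1 x * (SmoothC.toSobolev σ (SmoothC.D (multiOp P n w))) x := by
  have e1 : (Fin.snoc (fun i => SmoothC.toSobolev q (w i)) (SmoothC.toSobolev q W) :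
      Fin (n + 2) → SobolevC q)
      = fun i => SmoothC.toSobolev q ((Fin.snoc w W : Fin (n + 2) → SmoothC) i) := by
    ext1 i
    refine Fin.lastCases ?_ (fun i => ?_) i <;> simp
  -- The minus sign comes from the derivative of `w ∘ φ⁻¹`; with it, differentiating the arguments
  -- gives the negative terms of the recursion.
  have e2 (k : Fin (n + 1)) : T (Function.update (fun i => SmoothC.toSobolev q (w i)) k
      (-SmoothC.toSobolev q (W * SmoothC.D (w k))))
      = -SmoothC.toSobolev σ (multiOp P n (Function.update w k (W * SmoothC.D (w k)))) := by
    rw [← neg_one_smul ℂ, T.map_update_smul, neg_one_smul, ← hT]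
    congr 2
    ext1 i
    rcases eq_or_ne i k with rfl | hi
    · simp
    · simp [hi]
  rw [e1, hT']
  simp only [e2, multiOp, Fin.init_snoc, Fin.snoc_last, Fin.snoc_castSucc, map_sum, map_neg,
    ContinuousMap.sum_apply, ContinuousMap.neg_apply, Finset.sum_neg_distrib]
  change (W * SmoothC.D (multiOp P n w) - ∑ k : Fin (n + 1), multiOp P n
    (Function.update w k (W * SmoothC.D (w k)))).1 x = -(∑ k : Fin (n + 1), (multiOp P n
    (Function.update w k (W * SmoothC.D (w k)))).1 x) + W.1 x * (SmoothC.D (multiOp P n w)).1 x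
  have e3 : (∑ k : Fin (n + 1), multiOp P n (Function.update w k (W * SmoothC.D (w k)))).1 x
      = ∑ k : Fin (n + 1), (multiOp P n (Function.update w k (W * SmoothC.D (w k)))).1 x := by
    rw [AddSubmonoidClass.coe_finsetSum, Finset.sum_apply]
  rw [← e3, neg_add_eq_sub]
  rfl

variable [Fact (3 / 2 < q)]

/-- The composition of a smooth function and the inverse of a smooth diffeomorphism is smooth. -/
theorem exists_smooth_Rinv (hq : 5 / 2 < q) {f : SobolevR q} (hf : f ∈ diffeoLifts q)
    (hfs : f ∈ SobolevR.smooth q) (u : SmoothC) :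
    ∃ w : SmoothC, SmoothC.toSobolev q w = Rinv q (ofLift f) (SmoothC.toSobolev q u) := by
  obtain ⟨f', hf', -⟩ := f.exists_isDeriv Fact.out
  have hL := isLift_homeo hf hf'
  -- The inverse of a smooth lift with nonvanishing derivative is smooth.
  have h1 : ContDiff ℝ ∞ hL.homeo.symm :=
    hL.homeo.contDiff_symm_deriv (fun x => (hL.pos x).ne') hL.hasDerivAt_add
      (contDiff_id.add hfs)
  refine ⟨⟨fun x => u.1 ((ofLift f).homeo.symm x), ?_⟩, ?_⟩
  · have h2 := (SmoothC.contDiff u).comp h1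
    have e : (fun t : ℝ => u.1 ((ofLift f).homeo.symm t)) = (fun t : ℝ => u.1 t) ∘ hL.homeo.symm := by
      ext t
      rw [hL.symm_coe]
      rfl
    change ContDiff ℝ ∞ fun t : ℝ => u.1 ((ofLift f).homeo.symm t)
    rw [e]
    exact h2
  · ext x
    rw [Rinv_apply hq (by linarith) le_rfl]
    rfl

/-- The derivative of `t ↦ u ∘ φ_t⁻¹` along a segment. -/
theorem hasDerivAt_Rinv (hq : 5 / 2 < q) {f h : SobolevR q} {t₀ : ℝ}
    (ht : f + t₀ • h ∈ diffeoLifts q) {u w w' : SobolevC q}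
    (hw : w = Rinv q (ofLift (f + t₀ • h)) u) (hw' : IsDerivC w.toFun w'.toFun) (z : SobolevC q)
    (hz : ∀ x, z x = -(Rinv q (ofLift (f + t₀ • h)) h.toComplex x * w' x)) :
    HasDerivAt (fun t : ℝ => Rinv q (ofLift (f + t • h)) u) z t₀ := by
  have hs : 3 / 2 < q := Fact.out
  have hs' : 1 / 2 < q := by linarith
  have h1 := hasDerivAt_R hq hs hs' le_rfl hw' ht
  have hc : ContinuousAt (fun t : ℝ => f + t • h) t₀ := by fun_prop
  -- Here `d` is the derivative of `R_φ w`. Since `R_φ⁻¹ u - w = -R_φ⁻¹ (R_φ w - u)`, slopes of the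
  -- inverse family are `-R_φ⁻¹` of slopes of `R_φ w`, and joint continuity gives the limit `R_φ⁻¹
  -- (-d)`.
  set d := SobolevC.mulL hs' le_rfl h.toComplex (R q (ofLift (f + t₀ • h)) w')
  have e : z = Rinv q (ofLift (f + t₀ • h)) (-d) := by
    ext x
    rw [hz, Rinv_apply hq hs' le_rfl, Rinv_apply hq hs' le_rfl, map_neg, ContinuousMap.neg_apply,
      SobolevC.mulL_apply, R_apply hq hs' le_rfl, Equiv.apply_symm_apply]
  rw [hasDerivAt_iff_tendsto_slope] at h1 ⊢
  have h2 : ContinuousAt (fun p : ℝ × SobolevC q => Rinv q (ofLift (f + p.1 • h)) p.2) (t₀, -d) :=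
    (continuousAt_Rinv hq hs le_rfl ht (-d)).comp_of_eq (x := (t₀, -d))
      (f := fun p : ℝ × SobolevC q => (f + p.1 • h, p.2)) (by fun_prop) rfl
  have h3 := h2.tendsto.comp
    ((tendsto_nhdsWithin_of_tendsto_nhds Filter.tendsto_id).prodMk_nhds h1.neg)
  rw [e]
  refine h3.congr fun t => ?_
  simp only [Function.comp_apply, slope_def_module, map_neg, ContinuousLinearMap.map_smul_of_tower,
    map_sub, id]
  rw [Rinv_R hq hs' le_rfl, hw, R_Rinv hq hs' le_rfl, ← smul_neg, neg_sub]

theorem continuousAt_conj (hq : 5 / 2 < q) (hσ : 3 / 2 < σ) (hσq : σ ≤ q) {n : ℕ}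
    (T : ContinuousMultilinearMap ℂ (fun _ : Fin n => SobolevC q) (SobolevC σ)) {f₀ : SobolevR q}
    (hf₀ : f₀ ∈ diffeoLifts q) (u₀ : Fin n → SobolevC q) :
    ContinuousAt (fun p : SobolevR q × (Fin n → SobolevC q) => conj T (ofLift p.1) p.2)
      (f₀, u₀) := by
  simp only [conj_apply]
  have h1 (i : Fin n) : ContinuousAt (fun p : SobolevR q × (Fin n → SobolevC q) =>
      Rinv q (ofLift p.1) (p.2 i)) (f₀, u₀) :=
    (continuousAt_Rinv hq Fact.out le_rfl hf₀ (u₀ i)).comp_of_eq (x := (f₀, u₀))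
      (f := fun p : SobolevR q × (Fin n → SobolevC q) => (p.1, p.2 i)) (by fun_prop) rfl
  have h2 : ContinuousAt (fun p : SobolevR q × (Fin n → SobolevC q) =>
      T fun i => Rinv q (ofLift p.1) (p.2 i)) (f₀, u₀) :=
    T.cont.continuousAt.comp (continuousAt_pi.2 h1)
  exact (continuousAt_R hq hσ hσq hf₀ _).comp
    (f := fun p : SobolevR q × (Fin n → SobolevC q) =>
      (p.1, T fun i => Rinv q (ofLift p.1) (p.2 i))) (continuousAt_fst.prodMk h2)

theorem isConjugate_conj (hq : 5 / 2 < q) (hσ : 1 / 2 < σ) (hσq : σ ≤ q) {n : ℕ}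
    (T : ContinuousMultilinearMap ℂ (fun _ : Fin (n + 1) => SobolevC q) (SobolevC σ))
    (φ : SobolevDiff q) (u : Fin (n + 1) → SobolevC q) : IsConjugate φ T u (conj T φ u) :=
  ⟨fun i => Rinv q φ (u i), fun i x => Rinv_apply hq (by linarith) le_rfl φ (u i) x,
    fun x => by rw [conj_apply, R_apply hq hσ hσq]⟩

theorem hasDerivAt_Rinv_smooth (hq : 5 / 2 < q) {f h : SobolevR q} {t₀ : ℝ}
    (ht : f + t₀ • h ∈ diffeoLifts q) {u w W : SmoothC}
    (hw : SmoothC.toSobolev q w = Rinv q (ofLift (f + t₀ • h)) (SmoothC.toSobolev q u))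
    (hW : SmoothC.toSobolev q W = Rinv q (ofLift (f + t₀ • h)) h.toComplex) :
    HasDerivAt (fun t : ℝ => Rinv q (ofLift (f + t • h)) (SmoothC.toSobolev q u))
      (-SmoothC.toSobolev q (W * SmoothC.D w)) t₀ := by
  refine hasDerivAt_Rinv hq ht hw (isDerivC_smooth q w) _ fun x => ?_
  rw [← hW]
  rfl

/-- The derivative of `R_φ T R_φ⁻¹` along a segment. -/
theorem hasDerivAt_conj (hq : 5 / 2 < q) (hσ : 3 / 2 < σ) (hσ' : 1 / 2 < σ) (hσq : σ ≤ q) {n : ℕ}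
    (T : ContinuousMultilinearMap ℂ (fun _ : Fin n => SobolevC q) (SobolevC σ))
    {f h : SobolevR q} {t₀ : ℝ} (ht : f + t₀ • h ∈ diffeoLifts q) {u w' : Fin n → SobolevC q}
    (hd : ∀ i, HasDerivAt (fun t : ℝ => Rinv q (ofLift (f + t • h)) (u i)) (w' i) t₀)
    {v v' : SobolevC σ} (hv : v = T fun i => Rinv q (ofLift (f + t₀ • h)) (u i))
    (hv' : IsDerivC v.toFun v'.toFun) :
    HasDerivAt (fun t : ℝ => conj T (ofLift (f + t • h)) u)
      (R σ (ofLift (f + t₀ • h))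
        (∑ k, T (Function.update (fun i => Rinv q (ofLift (f + t₀ • h)) (u i)) k (w' k)))
        + SobolevC.mulL hσ' hσq h.toComplex (R σ (ofLift (f + t₀ • h)) v')) t₀ := by
  have hY : HasDerivAt (fun t : ℝ => T fun i => Rinv q (ofLift (f + t • h)) (u i))
      (∑ k, T (Function.update (fun i => Rinv q (ofLift (f + t₀ • h)) (u i)) k (w' k))) t₀ := by
    have h1 := ((T.hasFDerivAt fun i => Rinv q (ofLift (f + t₀ • h)) (u i)).restrictScalars
      ℝ).comp_hasDerivAt t₀ (hasDerivAt_pi.2 hd)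
    refine h1.congr_deriv ?_
    rw [ContinuousLinearMap.coe_restrictScalars', ContinuousMultilinearMap.linearDeriv_apply]
  refine hasDerivAt_clm_apply_of_continuousAt (A := fun t => R σ (ofLift (f + t • h)))
    (y := fun t => T fun i => Rinv q (ofLift (f + t • h)) (u i)) hY ?_ ?_
  · exact (continuousAt_R hq hσ hσq ht _).comp_of_eq
      (f := fun p : ℝ × SobolevC σ => (f + p.1 • h, p.2)) (by fun_prop) rfl
  · simp only [← hv]
    exact hasDerivAt_R hq hσ hσ' hσq hv' ht

/-- The derivative of `R_φ Pₙ R_φ⁻¹` along a segment, for smooth arguments. -/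
theorem hasDerivAt_conj_smooth (hq : 5 / 2 < q) (hσ : 3 / 2 < σ) (hσq : σ ≤ q)
    {P : SmoothC →ₗ[ℂ] SmoothC} {n : ℕ}
    {T : ContinuousMultilinearMap ℂ (fun _ : Fin (n + 1) => SobolevC q) (SobolevC σ)}
    {T' : ContinuousMultilinearMap ℂ (fun _ : Fin (n + 2) => SobolevC q) (SobolevC σ)}
    (hT : ∀ u, T (fun i => SmoothC.toSobolev q (u i)) = SmoothC.toSobolev σ (multiOp P n u))
    (hT' : ∀ u, T' (fun i => SmoothC.toSobolev q (u i)) = SmoothC.toSobolev σ (multiOp P (n + 1) u))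
    {f h : SobolevR q} (hf : f ∈ SobolevR.smooth q) (hh : h ∈ SobolevR.smooth q)
    (u : Fin (n + 1) → SmoothC) {t₀ : ℝ} (ht : f + t₀ • h ∈ diffeoLifts q) :
    HasDerivAt (fun t : ℝ => conj T (ofLift (f + t • h)) fun i => SmoothC.toSobolev q (u i))
      (conj T' (ofLift (f + t₀ • h))
        (Fin.snoc (fun i => SmoothC.toSobolev q (u i)) h.toComplex)) t₀ := by
  have hσ' : 1 / 2 < σ := by linarith
  have hfs := SobolevR.smooth_add_smul hf hh t₀
  obtain ⟨H, hH⟩ := SobolevR.exists_smooth_toComplex hh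
  -- All pulled-back arguments, and the pulled-back direction `W`, are smooth, so `T` and `T'` can
  -- be evaluated through `multiOp` and its recursion.
  choose w hw using fun i => exists_smooth_Rinv hq ht hfs (u i)
  obtain ⟨W, hW⟩ := exists_smooth_Rinv hq ht hfs H
  rw [hH] at hW
  have hv : SmoothC.toSobolev σ (multiOp P n w)
      = T fun i => Rinv q (ofLift (f + t₀ • h)) (SmoothC.toSobolev q (u i)) := by
    simp only [← hw]
    exact (hT w).symm
  refine (hasDerivAt_conj hq hσ hσ' hσq T ht (fun i => hasDerivAt_Rinv_smooth hq ht (hw i) hW)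
    hv (isDerivC_smooth σ (multiOp P n w))).congr_deriv ?_
  have e1 : (fun i => Rinv q (ofLift (f + t₀ • h)) ((Fin.snoc
      (fun i => SmoothC.toSobolev q (u i)) h.toComplex : Fin (n + 2) → SobolevC q) i))
      = Fin.snoc (fun i => SmoothC.toSobolev q (w i)) (SmoothC.toSobolev q W) := by
    ext1 i
    refine Fin.lastCases ?_ (fun i => ?_) i
    · simp [hW]
    · simp [hw]
  -- Because `W ∘ φ = h`, the term from differentiating the outer `R_φ` is `(W D Pₙ(w)) ∘ φ`, the
  -- first half of the commutator.
  have hWx (x : UnitAddCircle) : W.1 (ofLift (f + t₀ • h) x) = h x := by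
    change SmoothC.toSobolev q W (ofLift (f + t₀ • h) x) = h x
    rw [hW, Rinv_apply hq (by linarith) le_rfl, Equiv.symm_apply_apply, SobolevR.toComplex_apply]
  rw [conj_apply, e1]
  simp only [← hw]
  ext x
  rw [map_add, ContinuousMap.add_apply, SobolevC.mulL_apply, R_apply hq hσ' hσq,
    R_apply hq hσ' hσq, R_apply hq hσ' hσq, multiOp_succ_toSobolev hT hT', hWx,
    SobolevR.toComplex_apply]

end SobolevDiff

/-! ### Families of multilinear maps that are successive derivatives -/

section Taylor

variable {E F : Type*} [NormedAddCommGroup E] [NormedSpace ℝ E] [NormedAddCommGroup F]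
  [NormedSpace ℝ F] {U : Set E} {D : E → FormalMultilinearSeries ℝ E F}

theorem hasFDerivAt_apply_of_curryRight {x : E} {n : ℕ}
    (h : HasFDerivAt (fun x => D x n) ((D x (n + 1)).curryRight.flipLinear) x) (δ : Fin n → E) :
    HasFDerivAt (fun x => D x n δ) ((D x (n + 1)).curryRight δ) x :=
  (ContinuousMultilinearMap.apply ℝ (fun _ : Fin n => E) F δ).hasFDerivAt.comp x h

/-- The derivatives are invariant under cyclic permutations of their arguments. -/
theorem apply_snoc_eq_apply_cons (hU : IsOpen U)
    (h : ∀ n, ∀ x ∈ U, HasFDerivAt (fun x => D x n) ((D x (n + 1)).curryRight.flipLinear) x)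
    (n : ℕ) : ∀ x ∈ U, ∀ (d : E) (δ : Fin n → E),
      D x (n + 1) (Fin.snoc δ d) = D x (n + 1) (Fin.cons d δ) := by
  induction n with
  | zero =>
    intro x _ d δ
    congr 1
    ext i
    fin_cases i
    rfl
  | succ n ih =>
    intro x hx d δ
    obtain ⟨δ, e, rfl⟩ : ∃ (δ' : Fin n → E) (e : E), δ = Fin.snoc δ' e :=
      ⟨Fin.init δ, δ (Fin.last n), (Fin.snoc_init_self δ).symm⟩
    have h1 : ∀ᶠ y in 𝓝 x, HasFDerivAt (fun y => D y n δ) ((D y (n + 1)).curryRight δ) y :=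
      Filter.eventually_of_mem (hU.mem_nhds hx) fun y hy =>
        hasFDerivAt_apply_of_curryRight (h n y hy) δ
    let A : (E [×(n + 1)]→L[ℝ] F) →L[ℝ] (E →L[ℝ] F) :=
      (ContinuousMultilinearMap.apply ℝ (fun _ : Fin n => E) (E →L[ℝ] F) δ).comp
        (continuousMultilinearCurryRightEquiv' ℝ n E F).toContinuousLinearEquiv.toContinuousLinearMap
    have h2 : HasFDerivAt (fun y => (D y (n + 1)).curryRight δ)
        (A.comp ((D x (n + 1 + 1)).curryRight.flipLinear)) x :=
      A.hasFDerivAt.comp x (h (n + 1) x hx)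
    -- Two moves bring `d` to the front: symmetry of the second derivative exchanges the last two
    -- arguments, and differentiating the induction hypothesis in direction `e` moves `d` to the
    -- front of the others.
    have h3 : D x (n + 1 + 1) (Fin.snoc (Fin.snoc δ e : Fin (n + 1) → E) d)
        = D x (n + 1 + 1) (Fin.snoc (Fin.snoc δ d : Fin (n + 1) → E) e) :=
      second_derivative_symmetric_of_eventually_of_real h1 h2 d e
    have h4 : HasFDerivAt (fun y => D y (n + 1) (Fin.snoc δ d))
        ((D x (n + 1 + 1)).curryRight (Fin.cons d δ)) x := by
      refine (hasFDerivAt_apply_of_curryRight (h (n + 1) x hx) (Fin.cons d δ)).congr_of_eventuallyEq ?_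
      exact Filter.eventually_of_mem (hU.mem_nhds hx) fun y hy => ih y hy d δ
    have h5 := (hasFDerivAt_apply_of_curryRight (h (n + 1) x hx) (Fin.snoc δ d)).unique h4
    have h6 : D x (n + 1 + 1) (Fin.snoc (Fin.snoc δ d : Fin (n + 1) → E) e)
        = D x (n + 1 + 1) (Fin.snoc (Fin.cons d δ : Fin (n + 1) → E) e) :=
      congrArg (fun L : E →L[ℝ] F => L e) h5
    rw [h3, h6, Fin.cons_snoc_eq_snoc_cons]

/-- Taylor series place the newest direction first, the recursion last; cyclic invariance identifies
the two curryings. -/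
theorem hasFTaylorSeriesUpToOn_of_curryRight (hU : IsOpen U)
    (h : ∀ n, ∀ x ∈ U, HasFDerivAt (fun x => D x n) ((D x (n + 1)).curryRight.flipLinear) x) :
    HasFTaylorSeriesUpToOn ∞ (fun x => (D x 0).curry0) D U where
  zero_eq _ _ := rfl
  fderivWithin n _ x hx := by
    have e : (D x (n + 1)).curryRight.flipLinear = (D x (n + 1)).curryLeft := by
      ext d δ
      exact apply_snoc_eq_apply_cons hU h n x hx d δ
    exact (e ▸ h n x hx).hasFDerivWithinAt
  cont n _ x hx := (h n x hx).continuousAt.continuousWithinAt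

end Taylor

theorem Dense.forall_le_of_continuousAt {X : Type*} [TopologicalSpace X] {S O : Set X}
    (hS : Dense S) (hO : IsOpen O) {F G : X → ℝ} (hF : ∀ x ∈ O, ContinuousAt F x)
    (hG : ∀ x ∈ O, ContinuousAt G x) (h : ∀ x ∈ O, x ∈ S → F x ≤ G x) : ∀ x ∈ O, F x ≤ G x :=
  fun x hx => ContinuousWithinAt.closure_le (hS.open_subset_closure_inter hO hx)
    (hF x hx).continuousWithinAt (hG x hx).continuousWithinAt fun y hy => h y hy.1 hy.2

/-- The mean value inequality for `t ↦ y t - t • z 0`. -/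
theorem norm_sub_sub_le_of_hasDerivAt {F : Type*} [NormedAddCommGroup F] [NormedSpace ℝ F]
    {y z : ℝ → F} {C : ℝ} (hy : ∀ t ∈ Set.Icc (0 : ℝ) 1, HasDerivAt y (z t) t)
    (hz : ∀ t ∈ Set.Icc (0 : ℝ) 1, ‖z t - z 0‖ ≤ C) : ‖y 1 - y 0 - z 0‖ ≤ C := by
  have h1 := norm_image_sub_le_of_norm_deriv_le_segment_01' (f := fun t : ℝ => y t - t • z 0)
    (f' := fun t => z t - z 0) (C := C)
    (fun t ht => by
      have h3 : HasDerivAt (fun t : ℝ => t • z 0) (z 0) t := by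
        simpa using (hasDerivAt_id t).smul_const (z 0)
      exact ((hy t ht).sub h3).hasDerivWithinAt)
    (fun t ht => hz t (Set.Ico_subset_Icc_self ht))
  rwa [one_smul, zero_smul, sub_zero, sub_right_comm] at h1

/-- The inclusion of the real Sobolev space as a continuous linear map. -/
def SobolevR.toComplexL {s : ℝ} : SobolevR s →L[ℝ] SobolevC s :=
  SobolevR.toComplex.mkContinuous 1 fun f => by rw [norm_toComplex, one_mul]

namespace SobolevDiff

variable {q σ : ℝ}

/-! ### Taylor estimates for conjugated operators -/

theorem prod_norm_snoc {n : ℕ} (u : Fin n → SobolevC q) (h : SobolevR q) :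
    ∏ i, ‖(Fin.snoc u h.toComplex : Fin (n + 1) → SobolevC q) i‖ = (∏ i, ‖u i‖) * ‖h‖ := by
  rw [Fin.prod_univ_castSucc]
  simp only [Fin.snoc_castSucc, Fin.snoc_last, SobolevR.norm_toComplex]

theorem norm_apply_snoc_le {n : ℕ}
    (T : ContinuousMultilinearMap ℂ (fun _ : Fin (n + 1) => SobolevC q) (SobolevC σ)) {M : ℝ}
    (hM : ‖T‖ ≤ M) (u : Fin n → SobolevC q) (h : SobolevR q) :
    ‖T (Fin.snoc u h.toComplex)‖ ≤ M * (∏ i, ‖u i‖) * ‖h‖ := by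
  refine (T.le_opNorm _).trans ?_
  rw [prod_norm_snoc, mul_assoc]
  gcongr

/-- The smooth arguments are dense. -/
theorem dense_smooth_arguments (q : ℝ) (n : ℕ) :
    Dense (SobolevR.smooth q ×ˢ (SobolevR.smooth q ×ˢ
      Set.range fun (u : Fin n → SmoothC) i => SmoothC.toSobolev q (u i))) := by
  refine (SobolevR.dense_smooth q).prod ((SobolevR.dense_smooth q).prod ?_)
  exact DenseRange.piMap fun _ => SmoothC.denseRange_toSobolev q

variable [Fact (3 / 2 < q)]

theorem norm_conj_sub_le_smooth (hq : 5 / 2 < q) (hσ : 3 / 2 < σ) (hσq : σ ≤ q)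
    {P : SmoothC →ₗ[ℂ] SmoothC} {n : ℕ}
    {T : ContinuousMultilinearMap ℂ (fun _ : Fin (n + 1) => SobolevC q) (SobolevC σ)}
    {T' : ContinuousMultilinearMap ℂ (fun _ : Fin (n + 2) => SobolevC q) (SobolevC σ)}
    (hT : ∀ u, T (fun i => SmoothC.toSobolev q (u i)) = SmoothC.toSobolev σ (multiOp P n u))
    (hT' : ∀ u, T' (fun i => SmoothC.toSobolev q (u i)) = SmoothC.toSobolev σ (multiOp P (n + 1) u))
    {f₀ : SobolevR q} {ε M : ℝ} (hb : Metric.ball f₀ ε ⊆ diffeoLifts q)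
    (hM : ∀ f ∈ Metric.ball f₀ ε, ‖conj T' (ofLift f)‖ ≤ M)
    {f g : SobolevR q} (hf : f ∈ Metric.ball f₀ ε) (hg : g ∈ Metric.ball f₀ ε)
    (hfs : f ∈ SobolevR.smooth q) (hgs : g ∈ SobolevR.smooth q) (u : Fin (n + 1) → SmoothC) :
    ‖conj T (ofLift g) (fun i => SmoothC.toSobolev q (u i))
        - conj T (ofLift f) (fun i => SmoothC.toSobolev q (u i))‖
      ≤ M * (∏ i, ‖SmoothC.toSobolev q (u i)‖) * ‖g - f‖ := by
  have hh : g - f ∈ SobolevR.smooth q := by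
    have := SobolevR.smooth_add_smul hgs hfs (-1)
    rwa [neg_one_smul, ← sub_eq_add_neg] at this
  have h1 := norm_image_sub_le_of_norm_deriv_le_segment_01'
    (f := fun t : ℝ => conj T (ofLift (f + t • (g - f))) fun i => SmoothC.toSobolev q (u i))
    (fun t ht => (hasDerivAt_conj_smooth hq hσ hσq hT hT' hfs hh u
      (hb (segment_subset_ball hf hg ht))).hasDerivWithinAt)
    (fun t ht => norm_apply_snoc_le _ (hM _ (segment_subset_ball hf hg (Set.Ico_subset_Icc_self ht)))
      (fun i => SmoothC.toSobolev q (u i)) (g - f))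
  simpa using h1

/-- The path `R_φ T R_φ⁻¹ u` has been differentiated only for smooth data, but both sides of the
mean value estimate are jointly continuous, so density extends it. -/
theorem norm_conj_sub_le (hq : 5 / 2 < q) (hσ : 3 / 2 < σ) (hσq : σ ≤ q)
    {P : SmoothC →ₗ[ℂ] SmoothC} {n : ℕ}
    {T : ContinuousMultilinearMap ℂ (fun _ : Fin (n + 1) => SobolevC q) (SobolevC σ)}
    {T' : ContinuousMultilinearMap ℂ (fun _ : Fin (n + 2) => SobolevC q) (SobolevC σ)}
    (hT : ∀ u, T (fun i => SmoothC.toSobolev q (u i)) = SmoothC.toSobolev σ (multiOp P n u))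
    (hT' : ∀ u, T' (fun i => SmoothC.toSobolev q (u i)) = SmoothC.toSobolev σ (multiOp P (n + 1) u))
    {f₀ : SobolevR q} {ε M : ℝ} (hb : Metric.ball f₀ ε ⊆ diffeoLifts q)
    (hM : ∀ f ∈ Metric.ball f₀ ε, ‖conj T' (ofLift f)‖ ≤ M)
    {f g : SobolevR q} (hf : f ∈ Metric.ball f₀ ε) (hg : g ∈ Metric.ball f₀ ε)
    (u : Fin (n + 1) → SobolevC q) :
    ‖conj T (ofLift g) u - conj T (ofLift f) u‖ ≤ M * (∏ i, ‖u i‖) * ‖g - f‖ := by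
  refine (dense_smooth_arguments q (n + 1)).forall_le_of_continuousAt
    (O := Metric.ball f₀ ε ×ˢ (Metric.ball f₀ ε ×ˢ Set.univ))
    (F := fun p => ‖conj T (ofLift p.2.1) p.2.2 - conj T (ofLift p.1) p.2.2‖)
    (G := fun p => M * (∏ i, ‖p.2.2 i‖) * ‖p.2.1 - p.1‖)
    (Metric.isOpen_ball.prod (Metric.isOpen_ball.prod isOpen_univ)) ?_ ?_ ?_ (f, g, u)
    ⟨hf, hg, trivial⟩
  · rintro ⟨f, g, u⟩ ⟨hf, hg, -⟩
    refine (ContinuousAt.sub ?_ ?_).norm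
    · exact (continuousAt_conj hq hσ hσq T (hb hg) u).comp_of_eq (x := (f, g, u))
        (f := fun p : SobolevR q × SobolevR q × (Fin (n + 1) → SobolevC q) => p.2)
        (by fun_prop) rfl
    · exact (continuousAt_conj hq hσ hσq T (hb hf) u).comp_of_eq (x := (f, g, u))
        (f := fun p : SobolevR q × SobolevR q × (Fin (n + 1) → SobolevC q) => (p.1, p.2.2))
        (by fun_prop) rfl
  · intro p _
    fun_prop
  · rintro ⟨f, g, -⟩ ⟨hf, hg, -⟩ ⟨hfs, hgs, u, rfl⟩
    exact norm_conj_sub_le_smooth hq hσ hσq hT hT' hb hM hf hg hfs hgs u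

theorem norm_conj_segment_sub_le (hq : 5 / 2 < q) (hσ : 3 / 2 < σ) (hσq : σ ≤ q)
    {P : SmoothC →ₗ[ℂ] SmoothC} {n : ℕ}
    {T : ContinuousMultilinearMap ℂ (fun _ : Fin (n + 1) => SobolevC q) (SobolevC σ)}
    {T' : ContinuousMultilinearMap ℂ (fun _ : Fin (n + 2) => SobolevC q) (SobolevC σ)}
    (hT : ∀ u, T (fun i => SmoothC.toSobolev q (u i)) = SmoothC.toSobolev σ (multiOp P n u))
    (hT' : ∀ u, T' (fun i => SmoothC.toSobolev q (u i)) = SmoothC.toSobolev σ (multiOp P (n + 1) u))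
    {f₀ : SobolevR q} {ε M : ℝ} (hM0 : 0 ≤ M) (hb : Metric.ball f₀ ε ⊆ diffeoLifts q)
    (hM : ∀ f ∈ Metric.ball f₀ ε, ‖conj T' (ofLift f)‖ ≤ M)
    {f g : SobolevR q} (hf : f ∈ Metric.ball f₀ ε) (hg : g ∈ Metric.ball f₀ ε)
    (u : Fin n → SobolevC q) {t : ℝ} (ht : t ∈ Set.Icc (0 : ℝ) 1) :
    ‖conj T (ofLift (f + t • (g - f))) (Fin.snoc u (g - f).toComplex)
        - conj T (ofLift f) (Fin.snoc u (g - f).toComplex)‖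
      ≤ M * (∏ i, ‖u i‖) * ‖g - f‖ * ‖g - f‖ := by
  have h2 := norm_conj_sub_le hq hσ hσq hT hT' hb hM hf (segment_subset_ball hf hg ht)
    (Fin.snoc u (g - f).toComplex)
  rw [prod_norm_snoc, ← mul_assoc, add_sub_cancel_left, norm_smul, Real.norm_of_nonneg ht.1] at h2
  exact h2.trans (mul_le_mul_of_nonneg_left (mul_le_of_le_one_left (norm_nonneg _) ht.2)
    (by positivity))

/-- The derivative along the segment is the operator of level `n + 1`, whose variation is linear in
`g - f` by the Lipschitz estimate with constant from level `n + 2`. Its argument `g - f` supplies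
the second factor. -/
theorem norm_conj_taylor_le_smooth (hq : 5 / 2 < q) (hσ : 3 / 2 < σ) (hσq : σ ≤ q)
    {P : SmoothC →ₗ[ℂ] SmoothC} {n : ℕ}
    {T : ∀ n : ℕ, ContinuousMultilinearMap ℂ (fun _ : Fin (n + 1) => SobolevC q) (SobolevC σ)}
    (hT : ∀ (n : ℕ) (u : Fin (n + 1) → SmoothC),
      T n (fun i => SmoothC.toSobolev q (u i)) = SmoothC.toSobolev σ (multiOp P n u))
    {f₀ : SobolevR q} {ε M : ℝ} (hM0 : 0 ≤ M) (hb : Metric.ball f₀ ε ⊆ diffeoLifts q)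
    (hM : ∀ f ∈ Metric.ball f₀ ε, ‖conj (T (n + 2)) (ofLift f)‖ ≤ M)
    {f g : SobolevR q} (hf : f ∈ Metric.ball f₀ ε) (hg : g ∈ Metric.ball f₀ ε)
    (hfs : f ∈ SobolevR.smooth q) (hgs : g ∈ SobolevR.smooth q) (u : Fin (n + 1) → SmoothC) :
    ‖conj (T n) (ofLift g) (fun i => SmoothC.toSobolev q (u i))
        - conj (T n) (ofLift f) (fun i => SmoothC.toSobolev q (u i))
        - conj (T (n + 1)) (ofLift f)
          (Fin.snoc (fun i => SmoothC.toSobolev q (u i)) (g - f).toComplex)‖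
      ≤ M * (∏ i, ‖SmoothC.toSobolev q (u i)‖) * ‖g - f‖ * ‖g - f‖ := by
  have hh : g - f ∈ SobolevR.smooth q := by
    have := SobolevR.smooth_add_smul hgs hfs (-1)
    rwa [neg_one_smul, ← sub_eq_add_neg] at this
  have h1 := norm_sub_sub_le_of_hasDerivAt
    (y := fun t : ℝ => conj (T n) (ofLift (f + t • (g - f))) fun i => SmoothC.toSobolev q (u i))
    (z := fun t : ℝ => conj (T (n + 1)) (ofLift (f + t • (g - f)))
      (Fin.snoc (fun i => SmoothC.toSobolev q (u i)) (g - f).toComplex))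
    (C := M * (∏ i, ‖SmoothC.toSobolev q (u i)‖) * ‖g - f‖ * ‖g - f‖)
    (fun t ht => hasDerivAt_conj_smooth hq hσ hσq (hT n) (hT (n + 1)) hfs hh u
      (hb (segment_subset_ball hf hg ht)))
    (fun t ht => by
      simp only [zero_smul, add_zero]
      exact norm_conj_segment_sub_le hq hσ hσq (hT (n + 1)) (hT (n + 2)) hM0 hb hM hf hg
        (fun i => SmoothC.toSobolev q (u i)) ht)
  simpa only [one_smul, zero_smul, add_zero, add_sub_cancel] using h1

theorem norm_conj_taylor_le (hq : 5 / 2 < q) (hσ : 3 / 2 < σ) (hσq : σ ≤ q)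
    {P : SmoothC →ₗ[ℂ] SmoothC} {n : ℕ}
    {T : ∀ n : ℕ, ContinuousMultilinearMap ℂ (fun _ : Fin (n + 1) => SobolevC q) (SobolevC σ)}
    (hT : ∀ (n : ℕ) (u : Fin (n + 1) → SmoothC),
      T n (fun i => SmoothC.toSobolev q (u i)) = SmoothC.toSobolev σ (multiOp P n u))
    {f₀ : SobolevR q} {ε M : ℝ} (hM0 : 0 ≤ M) (hb : Metric.ball f₀ ε ⊆ diffeoLifts q)
    (hM : ∀ f ∈ Metric.ball f₀ ε, ‖conj (T (n + 2)) (ofLift f)‖ ≤ M)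
    {f g : SobolevR q} (hf : f ∈ Metric.ball f₀ ε) (hg : g ∈ Metric.ball f₀ ε)
    (u : Fin (n + 1) → SobolevC q) :
    ‖conj (T n) (ofLift g) u - conj (T n) (ofLift f) u
        - conj (T (n + 1)) (ofLift f) (Fin.snoc u (g - f).toComplex)‖
      ≤ M * (∏ i, ‖u i‖) * ‖g - f‖ * ‖g - f‖ := by
  refine (dense_smooth_arguments q (n + 1)).forall_le_of_continuousAt
    (O := Metric.ball f₀ ε ×ˢ (Metric.ball f₀ ε ×ˢ Set.univ))
    (F := fun p => ‖conj (T n) (ofLift p.2.1) p.2.2 - conj (T n) (ofLift p.1) p.2.2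
      - conj (T (n + 1)) (ofLift p.1) (Fin.snoc p.2.2 (p.2.1 - p.1).toComplex)‖)
    (G := fun p => M * (∏ i, ‖p.2.2 i‖) * ‖p.2.1 - p.1‖ * ‖p.2.1 - p.1‖)
    (Metric.isOpen_ball.prod (Metric.isOpen_ball.prod isOpen_univ)) ?_ ?_ ?_ (f, g, u)
    ⟨hf, hg, trivial⟩
  · rintro ⟨f, g, u⟩ ⟨hf, hg, -⟩
    refine ((ContinuousAt.sub ?_ ?_).sub ?_).norm
    · exact (continuousAt_conj hq hσ hσq (T n) (hb hg) u).comp_of_eq (x := (f, g, u))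
        (f := fun p : SobolevR q × SobolevR q × (Fin (n + 1) → SobolevC q) => p.2)
        (by fun_prop) rfl
    · exact (continuousAt_conj hq hσ hσq (T n) (hb hf) u).comp_of_eq (x := (f, g, u))
        (f := fun p : SobolevR q × SobolevR q × (Fin (n + 1) → SobolevC q) => (p.1, p.2.2))
        (by fun_prop) rfl
    -- The direction `g - f` is itself one of the varying arguments, so continuity of the inclusion
    -- of real into complex Sobolev functions enters.
    · refine (continuousAt_conj hq hσ hσq (T (n + 1)) (hb hf)
        (Fin.snoc u (g - f).toComplex)).comp_of_eq (x := (f, g, u))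
        (f := fun p : SobolevR q × SobolevR q × (Fin (n + 1) → SobolevC q) =>
          (p.1, (Fin.snoc p.2.2 (p.2.1 - p.1).toComplex : Fin (n + 2) → SobolevC q))) ?_ rfl
      refine continuousAt_fst.prodMk (continuousAt_pi.2 fun i => ?_)
      refine Fin.lastCases ?_ (fun i => ?_) i
      · simp only [Fin.snoc_last]
        exact (SobolevR.toComplexL.continuous.comp (by fun_prop)).continuousAt
      · simp only [Fin.snoc_castSucc]
        fun_prop
  · intro p _
    fun_prop
  · rintro ⟨f, g, -⟩ ⟨hf, hg, -⟩ ⟨hfs, hgs, u, rfl⟩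
    exact norm_conj_taylor_le_smooth hq hσ hσq hT hM0 hb hM hf hg hfs hgs u

/-- Locally uniform Taylor estimates. -/
theorem exists_norm_conj_taylor_le (hq : 5 / 2 < q) (hσ : 3 / 2 < σ) (hσq : σ ≤ q)
    {P : SmoothC →ₗ[ℂ] SmoothC}
    {T : ∀ n : ℕ, ContinuousMultilinearMap ℂ (fun _ : Fin (n + 1) => SobolevC q) (SobolevC σ)}
    (hT : ∀ (n : ℕ) (u : Fin (n + 1) → SmoothC),
      T n (fun i => SmoothC.toSobolev q (u i)) = SmoothC.toSobolev σ (multiOp P n u))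
    {f : SobolevR q} (hf : f ∈ diffeoLifts q) (n : ℕ) :
    ∃ M, 0 ≤ M ∧ ∀ᶠ g in 𝓝 f, ∀ u : Fin (n + 1) → SobolevC q,
      ‖conj (T n) (ofLift g) u - conj (T n) (ofLift f) u
        - conj (T (n + 1)) (ofLift f) (Fin.snoc u (g - f).toComplex)‖
      ≤ M * (∏ i, ‖u i‖) * ‖g - f‖ * ‖g - f‖ := by
  obtain ⟨ε, hε, hb, h⟩ := exists_ball_norm_le hf hq
  obtain ⟨Nσ, hNσ, hσb⟩ := h σ (by linarith) hσq
  obtain ⟨Nq, -, hqb⟩ := h q (by linarith) le_rfl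
  obtain ⟨M, hM0, hM⟩ := exists_norm_conj_le (D := ofLift '' Metric.ball f ε) hNσ
    (by rintro _ ⟨g, hg, rfl⟩; exact (hσb g hg).2.2.1)
    (by rintro _ ⟨g, hg, rfl⟩; exact (hqb g hg).2.2.2) (T (n + 2))
  exact ⟨M, hM0, Filter.eventually_of_mem (Metric.ball_mem_nhds f hε) fun g hg u =>
    norm_conj_taylor_le hq hσ hσq hT hM0 hb (fun f hf => hM _ ⟨f, hf, rfl⟩)
      (Metric.mem_ball_self hε) hg u⟩

end SobolevDiff

/-- A quadratic remainder is little-o of the increment. -/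
theorem hasFDerivAt_of_norm_sub_le {E F : Type*} [NormedAddCommGroup E] [NormedSpace ℝ E]
    [NormedAddCommGroup F] [NormedSpace ℝ F] {Φ : E → F} {L : E →L[ℝ] F} {x : E} {M : ℝ}
    (h : ∀ᶠ y in 𝓝 x, ‖Φ y - Φ x - L (y - x)‖ ≤ M * (‖y - x‖ * ‖y - x‖)) : HasFDerivAt Φ L x := by
  refine .of_isLittleO ?_
  have h1 : (fun y => Φ y - Φ x - L (y - x)) =O[𝓝 x] fun y => ‖y - x‖ * ‖y - x‖ :=
    Asymptotics.IsBigO.of_bound M (h.mono fun y hy => by simpa using hy)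
  have h2 : (fun y => ‖y - x‖) =o[𝓝 x] fun _ => (1 : ℝ) := by
    rw [Asymptotics.isLittleO_one_iff]
    have : ContinuousAt (fun y => ‖y - x‖) x := by fun_prop
    simpa using this.tendsto
  have h3 := h2.mul_isBigO (Asymptotics.isBigO_refl (fun y => ‖y - x‖) (𝓝 x))
  simp only [one_mul] at h3
  exact (h1.trans_isLittleO h3).of_norm_right

/-! ### Fréchet derivatives in operator norm and the Taylor series. -/

namespace SobolevDiff

variable {q σ : ℝ}

/-- The operator `R_φ T R_φ⁻¹` as a real multilinear map with values in the operators on its first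
argument. -/
def conjDeriv {n : ℕ} (T : ContinuousMultilinearMap ℂ (fun _ : Fin (n + 1) => SobolevC q) (SobolevC σ))
    (φ : SobolevDiff q) : SobolevR q [×n]→L[ℝ] (SobolevC q →L[ℂ] SobolevC σ) :=
  ((conj T φ).curryLeft.flipMultilinear.restrictScalars ℝ).compContinuousLinearMap
    fun _ => SobolevR.toComplexL

theorem conjDeriv_apply {n : ℕ}
    (T : ContinuousMultilinearMap ℂ (fun _ : Fin (n + 1) => SobolevC q) (SobolevC σ))
    (φ : SobolevDiff q) (δ : Fin n → SobolevR q) (v : SobolevC q) :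
    conjDeriv T φ δ v = conj T φ (Fin.cons v fun i => (δ i).toComplex) := rfl

theorem snoc_cons_toComplex {n : ℕ} (v : SobolevC q) (δ : Fin n → SobolevR q) (h : SobolevR q) :
    (Fin.snoc (Fin.cons v fun i => (δ i).toComplex : Fin (n + 1) → SobolevC q) h.toComplex :
      Fin (n + 2) → SobolevC q)
      = Fin.cons v fun i => ((Fin.snoc δ h : Fin (n + 1) → SobolevR q) i).toComplex := by
  rw [← Fin.cons_snoc_eq_snoc_cons]
  congr 1
  ext1 i
  refine Fin.lastCases ?_ (fun i => ?_) i <;> simp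

variable [Fact (3 / 2 < q)]

/-- The remainder estimate is proportional to the norms of `v` and of the directions, on a
neighbourhood independent of them. Taking operator norms therefore upgrades differentiability on
fixed arguments to Fréchet differentiability. -/
theorem hasFDerivAt_conjDeriv (hq : 5 / 2 < q) (hσ : 3 / 2 < σ) (hσq : σ ≤ q)
    {P : SmoothC →ₗ[ℂ] SmoothC}
    {T : ∀ n : ℕ, ContinuousMultilinearMap ℂ (fun _ : Fin (n + 1) => SobolevC q) (SobolevC σ)}
    (hT : ∀ (n : ℕ) (u : Fin (n + 1) → SmoothC),
      T n (fun i => SmoothC.toSobolev q (u i)) = SmoothC.toSobolev σ (multiOp P n u))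
    {f : SobolevR q} (hf : f ∈ diffeoLifts q) (n : ℕ) :
    HasFDerivAt (fun f => conjDeriv (T n) (ofLift f))
      ((conjDeriv (T (n + 1)) (ofLift f)).curryRight.flipLinear) f := by
  obtain ⟨M, hM0, hM⟩ := exists_norm_conj_taylor_le hq hσ hσq hT hf n
  refine hasFDerivAt_of_norm_sub_le (E := SobolevR q)
    (F := SobolevR q [×n]→L[ℝ] (SobolevC q →L[ℂ] SobolevC σ)) (M := M) ?_
  filter_upwards [hM] with g hg
  refine ContinuousMultilinearMap.opNorm_le_bound (f := conjDeriv (T n) (ofLift g)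
    - conjDeriv (T n) (ofLift f) - (conjDeriv (T (n + 1)) (ofLift f)).curryRight.flipLinear (g - f))
    (by positivity) fun δ => ?_
  refine ContinuousLinearMap.opNorm_le_bound _ (by positivity) fun v => ?_
  have h1 := hg (Fin.cons v fun i => (δ i).toComplex)
  rw [snoc_cons_toComplex, Fin.prod_univ_succ] at h1
  simp only [Fin.cons_zero, Fin.cons_succ, SobolevR.norm_toComplex] at h1
  refine (le_of_eq ?_).trans (h1.trans (le_of_eq (by ring)))
  rfl

theorem hasFTaylorSeriesUpToOn_conjDeriv (hq : 5 / 2 < q) (hσ : 3 / 2 < σ) (hσq : σ ≤ q)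
    {P : SmoothC →ₗ[ℂ] SmoothC}
    {T : ∀ n : ℕ, ContinuousMultilinearMap ℂ (fun _ : Fin (n + 1) => SobolevC q) (SobolevC σ)}
    (hT : ∀ (n : ℕ) (u : Fin (n + 1) → SmoothC),
      T n (fun i => SmoothC.toSobolev q (u i)) = SmoothC.toSobolev σ (multiOp P n u)) :
    HasFTaylorSeriesUpToOn ∞ (fun f => (conjDeriv (T 0) (ofLift f)).curry0)
      (fun g n => conjDeriv (T n) (ofLift g)) (diffeoLifts q) :=
  hasFTaylorSeriesUpToOn_of_curryRight 
    (isOpen_diffeoLifts Fact.out) fun n _ hf => hasFDerivAt_conjDeriv hq hσ hσq hT hf n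

theorem chart_mem_chartTarget {c : ℝ} {φ : SobolevDiff q} (h : φ ∈ (chart q c).source) :
    chart q c φ ∈ chartTarget q c := (chart q c).map_source h

/-- A map on `D^q` is smooth if it is smooth as a function of the displacement. -/
theorem contMDiff_of_contDiffOn {F : Type*} [NormedAddCommGroup F] [NormedSpace ℝ F]
    {Φ : SobolevDiff q → F} (h : ContDiffOn ℝ ∞ (fun f => Φ (ofLift f)) (diffeoLifts q)) :
    ContMDiff 𝓘(ℝ, SobolevR q) 𝓘(ℝ, F) ∞ Φ := by
  intro φ
  rw [contMDiffAt_iff_source, contMDiffWithinAt_iff_contDiffWithinAt]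
  rw [modelWithCornersSelf_coe, Set.range_id, contDiffWithinAt_univ]
  have h1 : extChartAt 𝓘(ℝ, SobolevR q) φ φ ∈ diffeoLifts q :=
    (chart_mem_chartTarget (mem_chart_source (SobolevR q) φ)).1
  -- In every chart the inverse is `ofLift`, so the local expression is the given function,
  -- restricted to an open set of displacements.
  exact h.contDiffAt ((isOpen_diffeoLifts Fact.out).mem_nhds h1)

end SobolevDiff

end

theorem mainTheorem3 {q r : ℝ} [Fact (3 / 2 < q)] (hr : 1 ≤ r) (hq : 3 / 2 + r < q)
    (P : SmoothC →ₗ[ℂ] SmoothC) (p : ℤ → ℂ) (hP : IsFourierMultiplier P p) (hp : HasOrder p r)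
    (T : ∀ n : ℕ, ContinuousMultilinearMap ℂ (fun _ : Fin (n + 1) => SobolevC q) (SobolevC (q - r)))
    (hT : ∀ (n : ℕ) (u : Fin (n + 1) → SmoothC),
      T n (fun i => SmoothC.toSobolev q (u i)) = SmoothC.toSobolev (q - r) (multiOp P n u)) :
    ∃ F : SobolevDiff q → (SobolevC q →L[ℂ] SobolevC (q - r)),
      (∀ (φ : SobolevDiff q) (v : SobolevC q), IsConjugate φ (T 0) (fun _ => v) (F φ v)) ∧
      ContMDiff 𝓘(ℝ, SobolevR q) 𝓘(ℝ, SobolevC q →L[ℂ] SobolevC (q - r)) ∞ F ∧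
      ∀ (n : ℕ), 1 ≤ n → ∀ (c : ℝ), ∀ φ ∈ (SobolevDiff.chart q c).source,
        ∀ (δ : Fin n → SobolevR q) (v : SobolevC q),
          IsConjugate φ (T n) (Fin.cons v fun i => (δ i).toComplex)
            (iteratedFDeriv ℝ n (F ∘ (SobolevDiff.chart q c).symm)
              (SobolevDiff.chart q c φ) δ v) := by
  -- The condition `r ≥ 1` gives `q > 5/2`, so `φ'` is in `H^(q-1)` with `q - 1 > 3/2`; the target
  -- order `q - r` also exceeds `3/2`, as the derivatives along paths require.
  have hq' : 5 / 2 < q := by linarith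
  have hσ : 3 / 2 < q - r := by linarith
  have hσq : q - r ≤ q := by linarith
  have hU : IsOpen (diffeoLifts q) := isOpen_diffeoLifts Fact.out
  have hF := SobolevDiff.hasFTaylorSeriesUpToOn_conjDeriv hq' hσ hσq hT
  refine ⟨fun φ => (SobolevDiff.conjDeriv (T 0) φ).curry0, fun φ v => ?_,
    SobolevDiff.contMDiff_of_contDiffOn hF.contDiffOn, fun n _ c φ hφ δ v => ?_⟩
  · have h := SobolevDiff.isConjugate_conj hq' (by linarith) hσq (T 0) φ fun _ => v
    have e : (fun _ => v : Fin 1 → SobolevC q)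
        = Fin.cons v fun i => (((0 : Fin 0 → SobolevR q)) i).toComplex := by
      ext1 i
      fin_cases i
      rfl
    have e2 : (SobolevDiff.conjDeriv (T 0) φ).curry0 v
        = SobolevDiff.conj (T 0) φ fun _ => v := by
      rw [e]
      rfl
    rw [e2]
    exact h
  · have hf := SobolevDiff.chart_mem_chartTarget hφ
    have h1 : iteratedFDeriv ℝ n (fun f => (SobolevDiff.conjDeriv (T 0) (SobolevDiff.ofLift f)).curry0)
        (SobolevDiff.chart q c φ) = SobolevDiff.conjDeriv (T n) φ := by
      -- On the open set of admissible displacements the iterated derivative is independent of the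
      -- junk values of `ofLift` elsewhere, and uniqueness of Taylor series identifies it.
      rw [← iteratedFDerivWithin_of_isOpen n hU hf.1,
        ← hF.eq_iteratedFDerivWithin_of_uniqueDiffOn (mod_cast le_top) hU.uniqueDiffOn hf.1]
      rw [← SobolevDiff.chart_symm_apply c, (SobolevDiff.chart q c).left_inv hφ]
    have h2 := SobolevDiff.isConjugate_conj hq' (by linarith) hσq (T n) φ
      (Fin.cons v fun i => (δ i).toComplex)
    rw [← SobolevDiff.conjDeriv_apply, ← h1] at h2
    exact h2
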